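/- All vector spaces and tensor products without subscript are over $\mathbb{C}$, algebras are unital, and comodules are left comodules, written $m\mapsto m_{(-1)}\otimes m_{(0)}$. **Setting.** Let $A$ be a Hopf $*$-algebra (a Hopf algebra with antipode $S$ and a conjugate-linear antimultiplicative involution such that $\Delta$ is a $*$-homomorphism), and $B$ an $A$-comodule $*$-algebra (the coaction is a unital $*$-homomorphism $B\to A\otimes B$). A *relative Hopf module* in ${}^A_B\mathcal{M}_B$ is a $B$-bimodule $\mathcal{E}$ with a left $A$-coaction $\delta$ such that $\delta(b e b')=\delta(b)\delta(e)\delta(b')$. An *$A$-covariant $*$-differential calculus* on $B$ is a differential graded algebra $(\Omega^\bullet=\bigoplus_{k\ge0}\Omega^k,\wedge,d)$ with $\Omega^0=B$, generated as an algebra by $B$ and $dB$, together with a coaction making $\Omega^\bullet$ a comodule algebra, extending that of $B$, preserving every $\Omega^k$ and commuting with $d$, and with a conjugate-linear involution $*$ extending that of $B$, preserving degrees, with $(d\omega)^*=d(\omega^*)$, $(\omega\wedge\nu)^*=(-1)^{kl}\nu^*\wedge\omega^*$ for $\omega\in\Omega^k,\nu\in\Omega^l$, and $\delta(\omega^*)=\omega_{(-1)}^*\otimes\omega_{(0)}^*$.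 An *$A$-covariant complex structure* on it is an $\mathbb{N}_0^2$-algebra grading $\Omega^\bullet=\bigoplus\Omega^{(p,q)}$ by subcomodules with $\Omega^{(0,0)}=B$, $\Omega^k=\bigoplus_{p+q=k}\Omega^{(p,q)}$, $(\Omega^{(p,q)})^*=\Omega^{(q,p)}$ and $d\Omega^{(p,q)}\subseteq\Omega^{(p+1,q)}\oplus\Omega^{(p,q+1)}$; $\overline\partial:\Omega^{(p,q)}\to\Omega^{(p,q+1)}$ is the corresponding component of $d$. An *$A$-covariant holomorphic bimodule* over these data is a pair $(\mathcal{E},\overline\partial_{\mathcal{E}})$ of a relative Hopf module $\mathcal{E}$ in ${}^A_B\mathcal{M}_B$ and an $A$-covariant $\mathbb{C}$-linear map $\overline\partial_{\mathcal{E}}:\mathcal{E}\to\Omega^{(0,1)}\otimes_B\mathcal{E}$ (diagonal coaction on the target) with $$\overline\partial_{\mathcal{E}}(be)=b\,\overline\partial_{\mathcal{E}}(e)+\overline\partial(b)\otimes_B e,\qquad R^{\mathrm{Hol}}_{\mathcal{E}}=(\overline\partial\otimes_B\mathrm{id}-\mathrm{id}\wedge\overline\partial_{\mathcal{E}})\,\overline\partial_{\mathcal{E}}=0:\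 \mathcal{E}\to\Omega^{(0,2)}\otimes_B\mathcal{E}.$$ **Cocycle twist.** A *unitary $2$-cocycle* is a linear map $\gamma:A\otimes A\to\mathbb{C}$ with a convolution inverse $\bar\gamma$ such that $\gamma(g_{(1)}\otimes h_{(1)})\gamma(g_{(2)}h_{(2)}\otimes k)=\gamma(h_{(1)}\otimes k_{(1)})\gamma(g\otimes h_{(2)}k_{(2)})$, $\gamma(h\otimes1)=\epsilon(h)=\gamma(1\otimes h)$ and $\overline{\gamma(a\otimes b)}=\bar\gamma(S(a)^*\otimes S(b)^*)$. Put $U(k)=\gamma(k_{(1)}\otimes S(k_{(2)}))$, $\bar U(k)=\bar\gamma(S(k_{(1)})\otimes k_{(2)})$, $V=U\circ S^{-1}$, $\bar V=\bar U\circ S^{-1}$. Let $A_\gamma$ be the coalgebra $A$ with the same unit and $$h\cdot_\gamma k=\gamma(h_{(1)}\otimes k_{(1)})h_{(2)}k_{(2)}\bar\gamma(h_{(3)}\otimes k_{(3)}),\quad S_\gamma(h)=U(h_{(1)})S(h_{(2)})\bar U(h_{(3)}),\quad h^{*_\gamma}=\bar V(h_{(1)}^*)h_{(2)}^*V(h_{(3)}^*).$$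 Let $B_\gamma$ and $(\Omega^\bullet_\gamma,\wedge_\gamma)$ be $B$ and $\Omega^\bullet$ with the same coaction and unit and with $x\cdot_\gamma y=\gamma(x_{(-1)}\otimes y_{(-1)})x_{(0)}y_{(0)}$, $x^{*_\gamma}=\bar V(x_{(-1)}^*)x_{(0)}^*$; the differential, the grading and the bigrading $\Omega_\gamma^{(p,q)}=\Omega^{(p,q)}$ of $\Omega^\bullet_\gamma$ are unchanged. For $\mathcal{E}$ in ${}^A_B\mathcal{M}_B$ let $\Gamma(\mathcal{E})$ be $\mathcal{E}$ with the same coaction and with the actions $b\cdot_\gamma e=\gamma(b_{(-1)}\otimes e_{(-1)})b_{(0)}e_{(0)}$, $e\cdot_\gamma b=\gamma(e_{(-1)}\otimes b_{(-1)})e_{(0)}b_{(0)}$. **Theorem.** Let $(\mathcal{E},\overline\partial_{\mathcal{E}})$ be an $A$-covariant holomorphic bimodule in ${}^A_B\mathcal{M}_B$ with respect to an $A$-covariant complex structure on $B$, and let $\gamma$ be a unitary $2$-cocycle on $A$. Then: 1. the formula $\varphi(\omega\otimes_{B_\gamma}e)=\gamma(\omega_{(-1)}\otimes e_{(-1)})\,\omega_{(0)}\otimes_B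 e_{(0)}$ defines a linear isomorphism $\varphi:\Omega^{(0,1)}_\gamma\otimes_{B_\gamma}\Gamma(\mathcal{E})\to\Omega^{(0,1)}\otimes_B\mathcal{E}$, with inverse $\omega\otimes_B e\mapsto\bar\gamma(\omega_{(-1)}\otimes e_{(-1)})\,\omega_{(0)}\otimes_{B_\gamma}e_{(0)}$; 2. with $\overline\partial_{\Gamma(\mathcal{E})}:=\varphi^{-1}\circ\overline\partial_{\mathcal{E}}:\Gamma(\mathcal{E})\to\Omega^{(0,1)}_\gamma\otimes_{B_\gamma}\Gamma(\mathcal{E})$, the pair $(\Gamma(\mathcal{E}),\overline\partial_{\Gamma(\mathcal{E})})$ is an $A_\gamma$-covariant holomorphic bimodule in ${}^{A_\gamma}_{B_\gamma}\mathcal{M}_{B_\gamma}$ with respect to the complex structure $\Omega_\gamma^{(\bullet,\bullet)}$. This includes that $A_\gamma$ is a Hopf $*$-algebra, $B_\gamma$ an $A_\gamma$-comodule $*$-algebra, $\Omega_\gamma^{(\bullet,\bullet)}$ an $A_\gamma$-covariant complex structure on $B_\gamma$, $\Gamma(\mathcal{E})$ a relative Hopf module, and $\overline\partial_{\Gamma(\mathcal{E})}$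 an $A_\gamma$-covariant left $\overline\partial$-connection with vanishing holomorphic curvature. -/

import Mathlib

open scoped TensorProduct

/-!
All vector spaces are complex.  Cocycle deformation keeps the underlying vector spaces, the coalgebra
and all coactions, and replaces products, actions and involutions on the same spaces.  Therefore the
operations are explicit data here (structures ending in `Ops`), and "is a Hopf star-algebra",
"is a relative Hopf module", ... are propositions about such data; the coalgebra structure is that
of Mathlib.
-/

namespace CocycleTwist

noncomputable section

/-! ### Convolution and coactions -/

section Linear

variable {A C M N X : Type*}
  [AddCommGroup A] [Module ℂ A] [AddCommGroup C] [Module ℂ C] [AddCommGroup M] [Module ℂ M]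
  [AddCommGroup N] [Module ℂ N] [AddCommGroup X] [Module ℂ X]

/-- `c ↦ φ(c₍₁₎) f(c₍₂₎)`. -/
def convL [Coalgebra ℂ C] (φ : C →ₗ[ℂ] ℂ) (f : C →ₗ[ℂ] X) : C →ₗ[ℂ] X :=
  (TensorProduct.lid ℂ X).toLinearMap ∘ₗ TensorProduct.map φ f ∘ₗ Coalgebra.comul

/-- `c ↦ f(c₍₁₎) φ(c₍₂₎)`. -/
def convR [Coalgebra ℂ C] (f : C →ₗ[ℂ] X) (φ : C →ₗ[ℂ] ℂ) : C →ₗ[ℂ] X :=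
  (TensorProduct.rid ℂ X).toLinearMap ∘ₗ TensorProduct.map f φ ∘ₗ Coalgebra.comul

/-- `m ⊗ n ↦ (m₍₋₁₎ ⊗ n₍₋₁₎) ⊗ (m₍₀₎ ⊗ n₍₀₎)`. -/
def pairCoact (δM : M →ₗ[ℂ] A ⊗[ℂ] M) (δN : N →ₗ[ℂ] A ⊗[ℂ] N) :
    M ⊗[ℂ] N →ₗ[ℂ] (A ⊗[ℂ] A) ⊗[ℂ] (M ⊗[ℂ] N) :=
  (TensorProduct.tensorTensorTensorComm ℂ A M A N).toLinearMap ∘ₗ TensorProduct.map δM δN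

/-- The diagonal coaction `m ⊗ n ↦ m₍₋₁₎ n₍₋₁₎ ⊗ (m₍₀₎ ⊗ n₍₀₎)` for a product `mulA` on `A`. -/
def tensorCoact (mulA : A ⊗[ℂ] A →ₗ[ℂ] A) (δM : M →ₗ[ℂ] A ⊗[ℂ] M) (δN : N →ₗ[ℂ] A ⊗[ℂ] N) :
    M ⊗[ℂ] N →ₗ[ℂ] A ⊗[ℂ] (M ⊗[ℂ] N) :=
  mulA.rTensor (M ⊗[ℂ] N) ∘ₗ pairCoact δM δN

/-- `m ⊗ n ↦ γ(m₍₋₁₎ ⊗ n₍₋₁₎) m₍₀₎ ⊗ n₍₀₎`. -/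
def scale (γ : A ⊗[ℂ] A →ₗ[ℂ] ℂ) (δM : M →ₗ[ℂ] A ⊗[ℂ] M) (δN : N →ₗ[ℂ] A ⊗[ℂ] N) :
    M ⊗[ℂ] N →ₗ[ℂ] M ⊗[ℂ] N :=
  (TensorProduct.lid ℂ (M ⊗[ℂ] N)).toLinearMap ∘ₗ γ.rTensor (M ⊗[ℂ] N) ∘ₗ pairCoact δM δN

/-- Left comodules over the coalgebra `A`. -/
structure IsComodule [Coalgebra ℂ A] (δ : M →ₗ[ℂ] A ⊗[ℂ] M) : Prop where
  coassoc : ∀ m, TensorProduct.assoc ℂ A A M ((Coalgebra.comul (R := ℂ)).rTensor M (δ m)) =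
    δ.lTensor A (δ m)
  counit : ∀ m, TensorProduct.lid ℂ M ((Coalgebra.counit (R := ℂ)).rTensor M (δ m)) = m

/-- `f` is covariant: `δ (f m) = (id ⊗ f) (δ m)`. -/
def IsCovariant (δM : M →ₗ[ℂ] A ⊗[ℂ] M) (δN : N →ₗ[ℂ] A ⊗[ℂ] N) (f : M →ₗ[ℂ] N) : Prop :=
  ∀ m, δN (f m) = f.lTensor A (δM m)

/-- `δ` maps the subspace `W` into `A ⊗ W`. -/
def IsSubcomodule (δ : M →ₗ[ℂ] A ⊗[ℂ] M) (W : Submodule ℂ M) : Prop :=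
  ∀ m ∈ W, δ m ∈ LinearMap.range (W.subtype.lTensor A)

end Linear

/-! ### Hopf star-algebras, comodule star-algebras, relative Hopf modules -/

/-- Product, unit and conjugate linear star operation. -/
structure StarAlgebraOps (X : Type*) [AddCommGroup X] [Module ℂ X] where
  mul : X ⊗[ℂ] X →ₗ[ℂ] X
  one : X
  star : X →ₗ⋆[ℂ] X

/-- The product is associative with two-sided unit `one`. -/
structure StarAlgebraOps.IsAlgebra {X : Type*} [AddCommGroup X] [Module ℂ X]
    (O : StarAlgebraOps X) : Prop where
  mul_assoc : ∀ x y z, O.mul (O.mul (x ⊗ₜ y) ⊗ₜ z) = O.mul (x ⊗ₜ O.mul (y ⊗ₜ z))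
  one_mul : ∀ x, O.mul (O.one ⊗ₜ x) = x
  mul_one : ∀ x, O.mul (x ⊗ₜ O.one) = x

structure HopfStarOps (A : Type*) [AddCommGroup A] [Module ℂ A] extends StarAlgebraOps A where
  antipode : A →ₗ[ℂ] A

/-- The operations `H` make the coalgebra `A` a Hopf star-algebra. -/
structure IsHopfStarAlgebra {A : Type*} [AddCommGroup A] [Module ℂ A] [Coalgebra ℂ A]
    (H : HopfStarOps A) : Prop extends H.toStarAlgebraOps.IsAlgebra where
  comul_one : Coalgebra.comul (R := ℂ) H.one = H.one ⊗ₜ[ℂ] H.one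
  comul_mul : ∀ x : A ⊗[ℂ] A, Coalgebra.comul (R := ℂ) (H.mul x) =
    TensorProduct.map H.mul H.mul (Coalgebra.comul (R := ℂ) x)
  counit_one : Coalgebra.counit (R := ℂ) H.one = (1 : ℂ)
  counit_mul : ∀ a b, Coalgebra.counit (R := ℂ) (H.mul (a ⊗ₜ b)) =
    (Coalgebra.counit a * Coalgebra.counit b : ℂ)
  antipode_mul : ∀ a, H.mul (H.antipode.rTensor A (Coalgebra.comul (R := ℂ) a)) =
    (Coalgebra.counit a : ℂ) • H.one
  mul_antipode : ∀ a, H.mul (H.antipode.lTensor A (Coalgebra.comul (R := ℂ) a)) =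
    (Coalgebra.counit a : ℂ) • H.one
  star_star : ∀ a, H.star (H.star a) = a
  star_mul : ∀ a b, H.star (H.mul (a ⊗ₜ b)) = H.mul (H.star b ⊗ₜ H.star a)
  comul_star : ∀ a, Coalgebra.comul (R := ℂ) (H.star a) =
    TensorProduct.map H.star H.star (Coalgebra.comul (R := ℂ) a)

structure ComoduleStarOps (A B : Type*) [AddCommGroup A] [Module ℂ A] [AddCommGroup B]
    [Module ℂ B] extends StarAlgebraOps B where
  coact : B →ₗ[ℂ] A ⊗[ℂ] B

section Comodules

variable {A B : Type*} [AddCommGroup A] [Module ℂ A] [Coalgebra ℂ A] [AddCommGroup B] [Module ℂ B]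

/-- The coaction makes `B` a left `A`-comodule, is a unital algebra map and respects stars. -/
structure IsComoduleAlgebra (H : HopfStarOps A) (O : ComoduleStarOps A B) : Prop
    extends O.toStarAlgebraOps.IsAlgebra, IsComodule O.coact where
  coact_one : O.coact O.one = H.one ⊗ₜ O.one
  coact_mul : IsCovariant (tensorCoact H.mul O.coact O.coact) O.coact O.mul
  coact_star : ∀ b, O.coact (O.star b) = TensorProduct.map H.star O.star (O.coact b)

/-- Left `A`-comodule star-algebras. -/
structure IsComoduleStarAlgebra (H : HopfStarOps A) (O : ComoduleStarOps A B) : Prop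
    extends IsComoduleAlgebra H O where
  star_star : ∀ b, O.star (O.star b) = b
  star_mul : ∀ b c, O.star (O.mul (b ⊗ₜ c)) = O.mul (O.star c ⊗ₜ O.star b)

end Comodules

/-- Left action, right action and coaction. -/
structure RelHopfOps (A B M : Type*) [AddCommGroup A] [Module ℂ A] [AddCommGroup B] [Module ℂ B]
    [AddCommGroup M] [Module ℂ M] where
  lact : B ⊗[ℂ] M →ₗ[ℂ] M
  ract : M ⊗[ℂ] B →ₗ[ℂ] M
  coact : M →ₗ[ℂ] A ⊗[ℂ] M

section RelHopf

variable {A B M N N' : Type*} [AddCommGroup A] [Module ℂ A]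
  [AddCommGroup B] [Module ℂ B] [AddCommGroup M] [Module ℂ M] [AddCommGroup N] [Module ℂ N]
  [AddCommGroup N'] [Module ℂ N']

/-- Relative Hopf modules: `B`-bimodules with a left `A`-coaction such that
`δ(b e) = δ(b) δ(e)` and `δ(e b) = δ(e) δ(b)`. -/
structure IsRelHopfModule [Coalgebra ℂ A] (H : HopfStarOps A) (𝔅 : ComoduleStarOps A B) (ℳ : RelHopfOps A B M) :
    Prop extends IsComodule ℳ.coact where
  one_lact : ∀ m, ℳ.lact (𝔅.one ⊗ₜ m) = m
  mul_lact : ∀ b c m, ℳ.lact (𝔅.mul (b ⊗ₜ c) ⊗ₜ m) = ℳ.lact (b ⊗ₜ ℳ.lact (c ⊗ₜ m))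
  ract_one : ∀ m, ℳ.ract (m ⊗ₜ 𝔅.one) = m
  ract_mul : ∀ m b c, ℳ.ract (m ⊗ₜ 𝔅.mul (b ⊗ₜ c)) = ℳ.ract (ℳ.ract (m ⊗ₜ b) ⊗ₜ c)
  lact_ract : ∀ b m c, ℳ.ract (ℳ.lact (b ⊗ₜ m) ⊗ₜ c) = ℳ.lact (b ⊗ₜ ℳ.ract (m ⊗ₜ c))
  coact_lact : IsCovariant (tensorCoact H.mul 𝔅.coact ℳ.coact) ℳ.coact ℳ.lact
  coact_ract : IsCovariant (tensorCoact H.mul ℳ.coact 𝔅.coact) ℳ.coact ℳ.ract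

/-! ### The tensor product over `B` -/

/-- The relations `m b ⊗ n = m ⊗ b n`. -/
def balancedRel (ℳ : RelHopfOps A B M) (𝒩 : RelHopfOps A B N) : Submodule ℂ (M ⊗[ℂ] N) :=
  Submodule.span ℂ {t | ∃ m b n, t = ℳ.ract (m ⊗ₜ b) ⊗ₜ n - m ⊗ₜ 𝒩.lact (b ⊗ₜ n)}

/-- `M ⊗_B N`. -/
abbrev BTensor (ℳ : RelHopfOps A B M) (𝒩 : RelHopfOps A B N) : Type _ :=
  (M ⊗[ℂ] N) ⧸ balancedRel ℳ 𝒩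

/-- The projection `M ⊗_ℂ N → M ⊗_B N`. -/
def BTensor.mk (ℳ : RelHopfOps A B M) (𝒩 : RelHopfOps A B N) :
    M ⊗[ℂ] N →ₗ[ℂ] BTensor ℳ 𝒩 :=
  (balancedRel ℳ 𝒩).mkQ

theorem BTensor.mk_balanced (ℳ : RelHopfOps A B M) (𝒩 : RelHopfOps A B N) (m : M) (b : B) (n : N) :
    BTensor.mk ℳ 𝒩 (ℳ.ract (m ⊗ₜ b) ⊗ₜ n) = BTensor.mk ℳ 𝒩 (m ⊗ₜ 𝒩.lact (b ⊗ₜ n)) :=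
  (Submodule.Quotient.eq _).2 (Submodule.subset_span ⟨m, b, n, rfl⟩)

/-- Linear maps out of `M ⊗_B N`. -/
def BTensor.lift {X : Type*} [AddCommGroup X] [Module ℂ X] (ℳ : RelHopfOps A B M)
    (𝒩 : RelHopfOps A B N) (f : M ⊗[ℂ] N →ₗ[ℂ] X)
    (hf : ∀ m b n, f (ℳ.ract (m ⊗ₜ b) ⊗ₜ n) = f (m ⊗ₜ 𝒩.lact (b ⊗ₜ n))) :
    BTensor ℳ 𝒩 →ₗ[ℂ] X :=
  (balancedRel ℳ 𝒩).liftQ f (Submodule.span_le.2 (by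
    rintro _ ⟨m, b, n, rfl⟩
    simp [hf m b n]))

@[simp] theorem BTensor.lift_mk {X : Type*} [AddCommGroup X] [Module ℂ X] (ℳ : RelHopfOps A B M)
    (𝒩 : RelHopfOps A B N) (f : M ⊗[ℂ] N →ₗ[ℂ] X) (hf) (t : M ⊗[ℂ] N) :
    BTensor.lift ℳ 𝒩 f hf (BTensor.mk ℳ 𝒩 t) = f t := rfl

/-- `f ⊗_B id` for a right `B`-linear map `f`. -/
def BTensor.mapLeft (ℳ : RelHopfOps A B M) (ℳ' : RelHopfOps A B N') (𝒩 : RelHopfOps A B N)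
    (f : M →ₗ[ℂ] N') (hf : ∀ m b, f (ℳ.ract (m ⊗ₜ b)) = ℳ'.ract (f m ⊗ₜ b)) :
    BTensor ℳ 𝒩 →ₗ[ℂ] BTensor ℳ' 𝒩 :=
  BTensor.lift ℳ 𝒩 (BTensor.mk ℳ' 𝒩 ∘ₗ f.rTensor N) (fun m b n => by
    simp [hf, BTensor.mk_balanced])

@[simp] theorem BTensor.mapLeft_mk (ℳ : RelHopfOps A B M) (ℳ' : RelHopfOps A B N')
    (𝒩 : RelHopfOps A B N) (f : M →ₗ[ℂ] N') (hf) (m : M) (n : N) :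
    BTensor.mapLeft ℳ ℳ' 𝒩 f hf (BTensor.mk ℳ 𝒩 (m ⊗ₜ n)) = BTensor.mk ℳ' 𝒩 (f m ⊗ₜ n) := rfl

theorem BTensor.induction {ℳ : RelHopfOps A B M} {𝒩 : RelHopfOps A B N}
    {P : BTensor ℳ 𝒩 → Prop} (x : BTensor ℳ 𝒩) (h0 : P 0)
    (ht : ∀ m n, P (BTensor.mk ℳ 𝒩 (m ⊗ₜ n))) (ha : ∀ x y, P x → P y → P (x + y)) : P x := by
  obtain ⟨t, rfl⟩ := (balancedRel ℳ 𝒩).mkQ_surjective x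
  induction t using TensorProduct.induction_on with
  | zero => simpa using h0
  | tmul m n => exact ht m n
  | add s t hs ht' => simpa using ha _ _ hs ht'

/-- The left action `b (m ⊗ n) = b m ⊗ n` of `b` on `M ⊗_B N`. -/
def BTensor.lact [Coalgebra ℂ A] {H : HopfStarOps A} {𝔅 : ComoduleStarOps A B} {ℳ : RelHopfOps A B M}
    (hM : IsRelHopfModule H 𝔅 ℳ) (𝒩 : RelHopfOps A B N) (b : B) :
    BTensor ℳ 𝒩 →ₗ[ℂ] BTensor ℳ 𝒩 :=
  BTensor.mapLeft ℳ ℳ 𝒩 (ℳ.lact ∘ₗ TensorProduct.mk ℂ B M b)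
    (fun m c => (hM.lact_ract b m c).symm)

theorem BTensor.lact_mk [Coalgebra ℂ A] {H : HopfStarOps A} {𝔅 : ComoduleStarOps A B}
    {ℳ : RelHopfOps A B M} (hM : IsRelHopfModule H 𝔅 ℳ) (𝒩 : RelHopfOps A B N) (b : B) (m : M)
    (n : N) : BTensor.lact hM 𝒩 b (BTensor.mk ℳ 𝒩 (m ⊗ₜ n)) =
      BTensor.mk ℳ 𝒩 (ℳ.lact (b ⊗ₜ m) ⊗ₜ n) := rfl

/-- The coaction `m ⊗ n ↦ m₍₋₁₎ n₍₋₁₎ ⊗ (m₍₀₎ ⊗ n₍₀₎)` of `A` on `M ⊗_B N`. -/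
def BTensor.coact [Coalgebra ℂ A] {H : HopfStarOps A} {𝔅 : ComoduleStarOps A B} {ℳ : RelHopfOps A B M}
    {𝒩 : RelHopfOps A B N} (hH : IsHopfStarAlgebra H) (hM : IsRelHopfModule H 𝔅 ℳ)
    (hN : IsRelHopfModule H 𝔅 𝒩) : BTensor ℳ 𝒩 →ₗ[ℂ] A ⊗[ℂ] BTensor ℳ 𝒩 :=
  BTensor.lift ℳ 𝒩 ((BTensor.mk ℳ 𝒩).lTensor A ∘ₗ tensorCoact H.mul ℳ.coact 𝒩.coact)
    (fun m b n => by
      have h1 := hM.coact_ract (m ⊗ₜ b)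
      have h2 := hN.coact_lact (b ⊗ₜ n)
      simp only [tensorCoact, pairCoact, LinearMap.comp_apply, TensorProduct.map_tmul,
        LinearEquiv.coe_coe] at h1 h2 ⊢
      rw [h1, h2]
      generalize ℳ.coact m = x
      generalize 𝔅.coact b = y
      generalize 𝒩.coact n = z
      induction x using TensorProduct.induction_on with
      | zero => simp
      | add x x' hx hx' => simp only [TensorProduct.add_tmul, map_add, hx, hx']
      | tmul a m =>
        induction y using TensorProduct.induction_on with
        | zero => simp
        | add y y' hy hy' =>
          simp only [TensorProduct.add_tmul, TensorProduct.tmul_add, map_add, hy, hy']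
        | tmul a' b =>
          induction z using TensorProduct.induction_on with
          | zero => simp
          | add z z' hz hz' => simp only [TensorProduct.tmul_add, map_add, hz, hz']
          | tmul a'' n => simp [hH.mul_assoc, BTensor.mk_balanced])

end RelHopf

/-! ### Differential calculi and complex structures -/

/-- Data of a differential calculus with star over `B`: the product is the wedge product, `incl` is
the identification of `B` with the forms of degree `0`, and `deg k` is the space of `k`-forms. -/
structure CalculusOps (A B Ω : Type*) [AddCommGroup A] [Module ℂ A] [AddCommGroup B] [Module ℂ B]
    [AddCommGroup Ω] [Module ℂ Ω] extends ComoduleStarOps A Ω where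
  incl : B →ₗ[ℂ] Ω
  d : Ω →ₗ[ℂ] Ω
  deg : ℕ → Submodule ℂ Ω

/-- A direct sum decomposition of a vector space indexed by `ℕ × ℕ`. -/
structure Bigrading (Ω : Type*) [AddCommGroup Ω] [Module ℂ Ω] where
  comp : ℕ × ℕ → Submodule ℂ Ω
  internal : DirectSum.IsInternal comp

/-- The projection onto the component of bidegree `i`. -/
def Bigrading.proj {Ω : Type*} [AddCommGroup Ω] [Module ℂ Ω] (P : Bigrading Ω) (i : ℕ × ℕ) :
    Ω →ₗ[ℂ] P.comp i :=
  DirectSum.component ℂ (ℕ × ℕ) (fun i => P.comp i) i ∘ₗ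
    (LinearEquiv.ofBijective (DirectSum.coeLinearMap P.comp) P.internal).symm.toLinearMap

theorem Bigrading.proj_of_mem {Ω : Type*} [AddCommGroup Ω] [Module ℂ Ω] (P : Bigrading Ω)
    {i : ℕ × ℕ} {x : Ω} (hx : x ∈ P.comp i) : (P.proj i x : Ω) = x :=
  congrArg Subtype.val (P.internal.ofBijective_coeLinearMap_of_mem hx)

theorem Bigrading.proj_of_mem_ne {Ω : Type*} [AddCommGroup Ω] [Module ℂ Ω] (P : Bigrading Ω)
    {i j : ℕ × ℕ} (hij : i ≠ j) {x : Ω} (hx : x ∈ P.comp i) : P.proj j x = 0 :=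
  P.internal.ofBijective_coeLinearMap_of_mem_ne hij hx

section Calculi

variable {A B Ω E : Type*} [AddCommGroup A] [Module ℂ A]
  [AddCommGroup B] [Module ℂ B] [AddCommGroup Ω] [Module ℂ Ω] [AddCommGroup E] [Module ℂ E]

/-- `A`-covariant star-differential calculi over the comodule star-algebra `B`. -/
structure IsCovariantStarCalculus [Coalgebra ℂ A] (H : HopfStarOps A) (𝔅 : ComoduleStarOps A B)
    (𝒞 : CalculusOps A B Ω) : Prop extends IsComoduleAlgebra H 𝒞.toComoduleStarOps where
  deg_internal : DirectSum.IsInternal 𝒞.deg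
  deg_mul : ∀ {k l ω η}, ω ∈ 𝒞.deg k → η ∈ 𝒞.deg l → 𝒞.mul (ω ⊗ₜ η) ∈ 𝒞.deg (k + l)
  incl_injective : Function.Injective 𝒞.incl
  range_incl : LinearMap.range 𝒞.incl = 𝒞.deg 0
  incl_one : 𝒞.incl 𝔅.one = 𝒞.one
  incl_mul : ∀ b c, 𝒞.incl (𝔅.mul (b ⊗ₜ c)) = 𝒞.mul (𝒞.incl b ⊗ₜ 𝒞.incl c)
  d_deg : ∀ {k ω}, ω ∈ 𝒞.deg k → 𝒞.d ω ∈ 𝒞.deg (k + 1)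
  d_d : ∀ ω, 𝒞.d (𝒞.d ω) = 0
  d_mul : ∀ {k ω}, ω ∈ 𝒞.deg k → ∀ η,
    𝒞.d (𝒞.mul (ω ⊗ₜ η)) = 𝒞.mul (𝒞.d ω ⊗ₜ η) + (-1 : ℂ) ^ k • 𝒞.mul (ω ⊗ₜ 𝒞.d η)
  generated : ∀ W : Submodule ℂ Ω, (∀ b, 𝒞.incl b ∈ W) → (∀ b, 𝒞.d (𝒞.incl b) ∈ W) →
    (∀ ω ∈ W, ∀ η ∈ W, 𝒞.mul (ω ⊗ₜ η) ∈ W) → W = ⊤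
  coact_incl : IsCovariant 𝔅.coact 𝒞.coact 𝒞.incl
  coact_deg : ∀ k, IsSubcomodule 𝒞.coact (𝒞.deg k)
  coact_d : IsCovariant 𝒞.coact 𝒞.coact 𝒞.d
  star_star : ∀ ω, 𝒞.star (𝒞.star ω) = ω
  star_incl : ∀ b, 𝒞.star (𝒞.incl b) = 𝒞.incl (𝔅.star b)
  star_deg : ∀ {k ω}, ω ∈ 𝒞.deg k → 𝒞.star ω ∈ 𝒞.deg k
  star_d : ∀ ω, 𝒞.star (𝒞.d ω) = 𝒞.d (𝒞.star ω)
  star_mul : ∀ {k l ω η}, ω ∈ 𝒞.deg k → η ∈ 𝒞.deg l →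
    𝒞.star (𝒞.mul (ω ⊗ₜ η)) = (-1 : ℂ) ^ (k * l) • 𝒞.mul (𝒞.star η ⊗ₜ 𝒞.star ω)

/-- `A`-covariant complex structures: the bigrading `P` is an algebra grading with
`Ω^k = ⨁_{p+q=k} Ω^(p,q)`, `(Ω^(p,q))* = Ω^(q,p)`, `d Ω^(p,q) ⊆ Ω^(p+1,q) ⊕ Ω^(p,q+1)`, and all
`Ω^(p,q)` are subcomodules. -/
structure IsCovariantComplexStructure [Coalgebra ℂ A] (H : HopfStarOps A) (𝔅 : ComoduleStarOps A B)
    (𝒞 : CalculusOps A B Ω) (P : Bigrading Ω) : Prop extends IsCovariantStarCalculus H 𝔅 𝒞 where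
  comp_mul : ∀ {i j ω η}, ω ∈ P.comp i → η ∈ P.comp j → 𝒞.mul (ω ⊗ₜ η) ∈ P.comp (i + j)
  comp_zero : P.comp (0, 0) = 𝒞.deg 0
  deg_eq : ∀ k, 𝒞.deg k = ⨆ (i : ℕ × ℕ) (_ : i.1 + i.2 = k), P.comp i
  star_comp : ∀ p q ω, 𝒞.star ω ∈ P.comp (q, p) ↔ ω ∈ P.comp (p, q)
  d_comp : ∀ {p q ω}, ω ∈ P.comp (p, q) → 𝒞.d ω ∈ P.comp (p + 1, q) ⊔ P.comp (p, q + 1)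
  coact_comp : ∀ i, IsSubcomodule 𝒞.coact (P.comp i)

/-- `Ω^(p,q)` with the actions of `B` by multiplication and the restricted coaction.  (The values
already lie in `Ω^(p,q)`, resp. `A ⊗ Ω^(p,q)`; the projection only adjusts the codomain.) -/
def formOps (𝒞 : CalculusOps A B Ω) (P : Bigrading Ω) (i : ℕ × ℕ) : RelHopfOps A B (P.comp i) where
  lact := P.proj i ∘ₗ 𝒞.mul ∘ₗ TensorProduct.map 𝒞.incl (P.comp i).subtype
  ract := P.proj i ∘ₗ 𝒞.mul ∘ₗ TensorProduct.map (P.comp i).subtype 𝒞.incl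
  coact := (P.proj i).lTensor A ∘ₗ 𝒞.coact ∘ₗ (P.comp i).subtype

/-- The operator `∂̄ : B → Ω^(0,1)`. -/
def dbarB (𝒞 : CalculusOps A B Ω) (P : Bigrading Ω) : B →ₗ[ℂ] P.comp (0, 1) :=
  P.proj (0, 1) ∘ₗ 𝒞.d ∘ₗ 𝒞.incl

/-- The operator `∂̄ : Ω^(0,1) → Ω^(0,2)`. -/
def dbarForm (𝒞 : CalculusOps A B Ω) (P : Bigrading Ω) : P.comp (0, 1) →ₗ[ℂ] P.comp (0, 2) :=
  P.proj (0, 2) ∘ₗ 𝒞.d ∘ₗ (P.comp (0, 1)).subtype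

/-- The product `Ω^(0,1) ⊗ Ω^(0,1) → Ω^(0,2)`. -/
def wedgeForm (𝒞 : CalculusOps A B Ω) (P : Bigrading Ω) :
    P.comp (0, 1) ⊗[ℂ] P.comp (0, 1) →ₗ[ℂ] P.comp (0, 2) :=
  P.proj (0, 2) ∘ₗ 𝒞.mul ∘ₗ TensorProduct.map (P.comp (0, 1)).subtype (P.comp (0, 1)).subtype

theorem tensorCoact_map {M M' N N' : Type*} [AddCommGroup M] [Module ℂ M] [AddCommGroup M']
    [Module ℂ M'] [AddCommGroup N] [Module ℂ N] [AddCommGroup N'] [Module ℂ N']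
    (mulA : A ⊗[ℂ] A →ₗ[ℂ] A) {δM : M →ₗ[ℂ] A ⊗[ℂ] M} {δM' : M' →ₗ[ℂ] A ⊗[ℂ] M'}
    {δN : N →ₗ[ℂ] A ⊗[ℂ] N} {δN' : N' →ₗ[ℂ] A ⊗[ℂ] N'} {f : M →ₗ[ℂ] M'} {g : N →ₗ[ℂ] N'}
    (hf : IsCovariant δM δM' f) (hg : IsCovariant δN δN' g) (t : M ⊗[ℂ] N) :
    tensorCoact mulA δM' δN' (TensorProduct.map f g t) =
      (TensorProduct.map f g).lTensor A (tensorCoact mulA δM δN t) := by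
  induction t using TensorProduct.induction_on with
  | zero => simp
  | add s t hs ht => simp only [map_add, hs, ht]
  | tmul m n =>
    simp only [tensorCoact, pairCoact, LinearMap.comp_apply, TensorProduct.map_tmul,
      LinearEquiv.coe_coe]
    rw [hf, hg]
    generalize δM m = x
    generalize δN n = y
    induction x using TensorProduct.induction_on with
    | zero => simp
    | add x x' hx hx' => simp only [TensorProduct.add_tmul, map_add, hx, hx']
    | tmul a m =>
      induction y using TensorProduct.induction_on with
      | zero => simp
      | add y y' hy hy' => simp only [TensorProduct.tmul_add, map_add, hy, hy']
      | tmul a' n => simp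

theorem lTensor_subtype_injective (P : Bigrading Ω) (i : ℕ × ℕ) :
    Function.Injective ((P.comp i).subtype.lTensor A) :=
  Module.Flat.lTensor_preserves_injective_linearMap _ (P.comp i).injective_subtype

section FormModule

variable [Coalgebra ℂ A] {H : HopfStarOps A} {𝔅 : ComoduleStarOps A B} {𝒞 : CalculusOps A B Ω}
  {P : Bigrading Ω}

theorem IsCovariantComplexStructure.incl_mem (h : IsCovariantComplexStructure H 𝔅 𝒞 P) (b : B) :
    𝒞.incl b ∈ P.comp 0 := by
  have : 𝒞.incl b ∈ 𝒞.deg 0 := h.range_incl ▸ LinearMap.mem_range_self _ b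
  rwa [← h.comp_zero] at this

theorem IsCovariantComplexStructure.coe_lact (h : IsCovariantComplexStructure H 𝔅 𝒞 P) {i : ℕ × ℕ}
    (b : B) (ω : P.comp i) :
    ((formOps 𝒞 P i).lact (b ⊗ₜ ω) : Ω) = 𝒞.mul (𝒞.incl b ⊗ₜ (ω : Ω)) :=
  P.proj_of_mem (by simpa using h.comp_mul (h.incl_mem b) ω.2)

theorem IsCovariantComplexStructure.coe_ract (h : IsCovariantComplexStructure H 𝔅 𝒞 P) {i : ℕ × ℕ}
    (ω : P.comp i) (b : B) :
    ((formOps 𝒞 P i).ract (ω ⊗ₜ b) : Ω) = 𝒞.mul ((ω : Ω) ⊗ₜ 𝒞.incl b) :=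
  P.proj_of_mem (by simpa using h.comp_mul ω.2 (h.incl_mem b))

theorem IsCovariantComplexStructure.covariant_subtype (h : IsCovariantComplexStructure H 𝔅 𝒞 P)
    (i : ℕ × ℕ) : IsCovariant (formOps 𝒞 P i).coact 𝒞.coact (P.comp i).subtype := by
  intro ω
  obtain ⟨t, ht⟩ := h.coact_comp i ω ω.2
  have hid : P.proj i ∘ₗ (P.comp i).subtype = LinearMap.id := by
    ext x
    exact P.proj_of_mem x.2
  have : (formOps 𝒞 P i).coact ω = t := by
    simp only [formOps, LinearMap.comp_apply, Submodule.subtype_apply]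
    rw [← ht, ← LinearMap.comp_apply, ← LinearMap.lTensor_comp, hid, LinearMap.lTensor_id,
      LinearMap.id_apply]
  rw [this, ht, Submodule.subtype_apply]

theorem IsCovariantComplexStructure.isRelHopfModule (h : IsCovariantComplexStructure H 𝔅 𝒞 P)
    (i : ℕ × ℕ) : IsRelHopfModule H 𝔅 (formOps 𝒞 P i) where
  coassoc ω := by
    have hs := h.covariant_subtype i
    apply Module.Flat.lTensor_preserves_injective_linearMap (M := A) _
      (lTensor_subtype_injective (A := A) P i)
    have e1 : ∀ t : A ⊗[ℂ] P.comp i,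
        ((P.comp i).subtype.lTensor A).lTensor A
          (TensorProduct.assoc ℂ A A _ ((Coalgebra.comul (R := ℂ)).rTensor _ t)) =
        TensorProduct.assoc ℂ A A Ω ((Coalgebra.comul (R := ℂ)).rTensor Ω
          ((P.comp i).subtype.lTensor A t)) := by
      intro t
      induction t using TensorProduct.induction_on with
      | zero => simp
      | add s t hs ht => simp only [map_add, hs, ht]
      | tmul a x =>
        simp only [LinearMap.rTensor_tmul, LinearMap.lTensor_tmul]
        generalize Coalgebra.comul (R := ℂ) a = y
        induction y using TensorProduct.induction_on with
        | zero => simp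
        | add s t hs ht => simp only [TensorProduct.add_tmul, map_add, hs, ht]
        | tmul a b => simp
    have e2 : ((P.comp i).subtype.lTensor A) ∘ₗ (formOps 𝒞 P i).coact =
        𝒞.coact ∘ₗ (P.comp i).subtype := by
      ext x
      exact (hs x).symm
    rw [e1, ← LinearMap.comp_apply (LinearMap.lTensor A _) (LinearMap.lTensor A _),
      ← LinearMap.lTensor_comp, e2, LinearMap.lTensor_comp, LinearMap.comp_apply, ← hs, h.coassoc]
  counit ω := by
    have e1 : ∀ t : A ⊗[ℂ] P.comp i, (P.comp i).subtype
        (TensorProduct.lid ℂ _ ((Coalgebra.counit (R := ℂ)).rTensor _ t)) =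
        TensorProduct.lid ℂ Ω ((Coalgebra.counit (R := ℂ)).rTensor Ω
          ((P.comp i).subtype.lTensor A t)) := by
      intro t
      induction t using TensorProduct.induction_on with
      | zero => simp
      | add s t hs ht => simp only [map_add, hs, ht]
      | tmul a x => simp
    apply (P.comp i).injective_subtype
    rw [e1, ← h.covariant_subtype i, h.counit]
  one_lact ω := by
    apply Subtype.ext
    rw [h.coe_lact, h.incl_one, h.one_mul]
  mul_lact b c ω := by
    apply Subtype.ext
    rw [h.coe_lact, h.coe_lact, h.coe_lact, h.incl_mul, h.mul_assoc]
  ract_one ω := by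
    apply Subtype.ext
    rw [h.coe_ract, h.incl_one, h.mul_one]
  ract_mul ω b c := by
    apply Subtype.ext
    rw [h.coe_ract, h.coe_ract, h.coe_ract, h.incl_mul, h.mul_assoc]
  lact_ract b ω c := by
    apply Subtype.ext
    rw [h.coe_ract, h.coe_lact, h.coe_lact, h.coe_ract, h.mul_assoc]
  coact_lact t := by
    apply lTensor_subtype_injective
    have e : (P.comp i).subtype ∘ₗ (formOps 𝒞 P i).lact =
        𝒞.mul ∘ₗ TensorProduct.map 𝒞.incl (P.comp i).subtype := by
      ext b ω
      exact h.coe_lact b ω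
    rw [← h.covariant_subtype i, ← LinearMap.comp_apply (LinearMap.lTensor A _),
      ← LinearMap.lTensor_comp, ← LinearMap.comp_apply (Submodule.subtype _), e,
      LinearMap.comp_apply, h.coact_mul,
      tensorCoact_map H.mul h.coact_incl (h.covariant_subtype i), LinearMap.lTensor_comp,
      LinearMap.comp_apply]
  coact_ract t := by
    apply lTensor_subtype_injective
    have e : (P.comp i).subtype ∘ₗ (formOps 𝒞 P i).ract =
        𝒞.mul ∘ₗ TensorProduct.map (P.comp i).subtype 𝒞.incl := by
      ext ω b
      exact h.coe_ract ω b
    rw [← h.covariant_subtype i, ← LinearMap.comp_apply (LinearMap.lTensor A _),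
      ← LinearMap.lTensor_comp, ← LinearMap.comp_apply (Submodule.subtype _), e,
      LinearMap.comp_apply, h.coact_mul,
      tensorCoact_map H.mul (h.covariant_subtype i) h.coact_incl, LinearMap.lTensor_comp,
      LinearMap.comp_apply]

theorem IsCovariantComplexStructure.coe_wedge (h : IsCovariantComplexStructure H 𝔅 𝒞 P)
    (ω η : P.comp (0, 1)) : (wedgeForm 𝒞 P (ω ⊗ₜ η) : Ω) = 𝒞.mul ((ω : Ω) ⊗ₜ (η : Ω)) :=
  P.proj_of_mem (h.comp_mul ω.2 η.2)

theorem IsCovariantComplexStructure.wedge_ract (h : IsCovariantComplexStructure H 𝔅 𝒞 P)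
    (ω η : P.comp (0, 1)) (b : B) :
    wedgeForm 𝒞 P (ω ⊗ₜ (formOps 𝒞 P (0, 1)).ract (η ⊗ₜ b)) =
      (formOps 𝒞 P (0, 2)).ract (wedgeForm 𝒞 P (ω ⊗ₜ η) ⊗ₜ b) := by
  apply Subtype.ext
  rw [h.coe_wedge, h.coe_ract, h.coe_ract, h.coe_wedge, h.mul_assoc]

theorem IsCovariantComplexStructure.wedge_lact (h : IsCovariantComplexStructure H 𝔅 𝒞 P)
    (ω η : P.comp (0, 1)) (b : B) :
    wedgeForm 𝒞 P (ω ⊗ₜ (formOps 𝒞 P (0, 1)).lact (b ⊗ₜ η)) =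
      wedgeForm 𝒞 P ((formOps 𝒞 P (0, 1)).ract (ω ⊗ₜ b) ⊗ₜ η) := by
  apply Subtype.ext
  rw [h.coe_wedge, h.coe_wedge, h.coe_ract, h.coe_lact, h.mul_assoc]

/-- `∂̄ (ω b) = (∂̄ ω) b - ω ∧ ∂̄ b`. -/
theorem IsCovariantComplexStructure.dbar_ract (h : IsCovariantComplexStructure H 𝔅 𝒞 P)
    (ω : P.comp (0, 1)) (b : B) :
    dbarForm 𝒞 P ((formOps 𝒞 P (0, 1)).ract (ω ⊗ₜ b)) =
      (formOps 𝒞 P (0, 2)).ract (dbarForm 𝒞 P ω ⊗ₜ b) - wedgeForm 𝒞 P (ω ⊗ₜ dbarB 𝒞 P b) := by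
  have hdeg : (ω : Ω) ∈ 𝒞.deg 1 := by
    rw [h.deg_eq]
    exact Submodule.mem_iSup_of_mem (0, 1) (Submodule.mem_iSup_of_mem rfl ω.2)
  obtain ⟨x, hx, y, hy, hxy⟩ := Submodule.mem_sup.1 (h.d_comp ω.2)
  obtain ⟨u, hu, v, hv, huv⟩ := Submodule.mem_sup.1 (h.d_comp (p := 0) (q := 0) (h.incl_mem b))
  have h1 : (dbarForm 𝒞 P ω : Ω) = y := by
    simp only [dbarForm, LinearMap.comp_apply, Submodule.subtype_apply]
    rw [← hxy, map_add, P.proj_of_mem_ne (j := (0, 2)) (by decide) hx, zero_add, P.proj_of_mem hy]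
  have h2 : (dbarB 𝒞 P b : Ω) = v := by
    simp only [dbarB, LinearMap.comp_apply]
    rw [← huv, map_add, P.proj_of_mem_ne (j := (0, 1)) (by decide) hu, zero_add, P.proj_of_mem hv]
  apply Subtype.ext
  rw [Submodule.coe_sub, h.coe_ract, h.coe_wedge, h1, h2]
  simp only [dbarForm, LinearMap.comp_apply, Submodule.subtype_apply]
  rw [h.coe_ract, h.d_mul hdeg, ← hxy, ← huv]
  have m1 := h.comp_mul hx (h.incl_mem b)
  have m2 := h.comp_mul hy (h.incl_mem b)
  have m3 := h.comp_mul ω.2 hu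
  have m4 := h.comp_mul ω.2 hv
  simp only [TensorProduct.add_tmul, TensorProduct.tmul_add, map_add, smul_add, map_smul,
    Submodule.coe_add, Submodule.coe_smul]
  rw [P.proj_of_mem_ne (j := (0, 2)) (by decide) m1, P.proj_of_mem (i := (0, 2)) m2,
    P.proj_of_mem_ne (j := (0, 2)) (by decide) m3, P.proj_of_mem (i := (0, 2)) m4]
  simp [sub_eq_add_neg]

/-! ### Covariant holomorphic bimodules -/

variable {ℰ : RelHopfOps A B E}

/-- `D : E → Ω^(0,1) ⊗_B E` is a left `∂̄`-connection: `D(b e) = b D(e) + ∂̄ b ⊗ e`. -/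
def IsDbarConnection (h : IsCovariantComplexStructure H 𝔅 𝒞 P) (ℰ : RelHopfOps A B E)
    (D : E →ₗ[ℂ] BTensor (formOps 𝒞 P (0, 1)) ℰ) : Prop :=
  ∀ b e, D (ℰ.lact (b ⊗ₜ e)) = BTensor.lact (h.isRelHopfModule (0, 1)) ℰ b (D e) +
    BTensor.mk (formOps 𝒞 P (0, 1)) ℰ (dbarB 𝒞 P b ⊗ₜ e)

/-- `ω ∧ (η ⊗ e) = (ω ∧ η) ⊗ e`, as a map `Ω^(0,1) ⊗_B E → Ω^(0,2) ⊗_B E` for fixed `ω`. -/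
def wedgeLeft (h : IsCovariantComplexStructure H 𝔅 𝒞 P) (ℰ : RelHopfOps A B E)
    (ω : P.comp (0, 1)) :
    BTensor (formOps 𝒞 P (0, 1)) ℰ →ₗ[ℂ] BTensor (formOps 𝒞 P (0, 2)) ℰ :=
  BTensor.mapLeft _ _ ℰ (wedgeForm 𝒞 P ∘ₗ TensorProduct.mk ℂ _ _ ω) (h.wedge_ract ω)

@[simp] theorem wedgeLeft_mk (h : IsCovariantComplexStructure H 𝔅 𝒞 P) (ω η : P.comp (0, 1))
    (e : E) : wedgeLeft h ℰ ω (BTensor.mk (formOps 𝒞 P (0, 1)) ℰ (η ⊗ₜ e)) =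
      BTensor.mk (formOps 𝒞 P (0, 2)) ℰ (wedgeForm 𝒞 P (ω ⊗ₜ η) ⊗ₜ e) := rfl

/-- `id ∧ D`, as a map on `Ω^(0,1) ⊗_ℂ E`: `ω ⊗ e ↦ ω ∧ D(e)`. -/
def idWedge (h : IsCovariantComplexStructure H 𝔅 𝒞 P)
    (D : E →ₗ[ℂ] BTensor (formOps 𝒞 P (0, 1)) ℰ) :
    P.comp (0, 1) ⊗[ℂ] E →ₗ[ℂ] BTensor (formOps 𝒞 P (0, 2)) ℰ :=
  TensorProduct.lift (LinearMap.mk₂ ℂ (fun ω e => wedgeLeft h ℰ ω (D e))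
    (fun ω ω' e => by
      generalize D e = x
      induction x using BTensor.induction with
      | h0 => simp
      | ht η e => simp [TensorProduct.add_tmul]
      | ha x y hx hy => simp only [map_add, hx, hy]; abel)
    (fun c ω e => by
      generalize D e = x
      induction x using BTensor.induction with
      | h0 => simp
      | ht η e => simp [← TensorProduct.smul_tmul']
      | ha x y hx hy => simp only [map_add, hx, hy, smul_add])
    (fun ω e e' => by simp)
    (fun c ω e => by simp))

/-- The map `∂̄ ⊗ id - id ∧ D : Ω^(0,1) ⊗_B E → Ω^(0,2) ⊗_B E`. -/
def curvatureOp (h : IsCovariantComplexStructure H 𝔅 𝒞 P)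
    (D : E →ₗ[ℂ] BTensor (formOps 𝒞 P (0, 1)) ℰ) (hD : IsDbarConnection h ℰ D) :
    BTensor (formOps 𝒞 P (0, 1)) ℰ →ₗ[ℂ] BTensor (formOps 𝒞 P (0, 2)) ℰ :=
  BTensor.lift _ _
    (BTensor.mk (formOps 𝒞 P (0, 2)) ℰ ∘ₗ (dbarForm 𝒞 P).rTensor E - idWedge h D)
    (fun ω b e => by
      have key : ∀ x, wedgeLeft h ℰ ω (BTensor.lact (h.isRelHopfModule (0, 1)) ℰ b x) =
          wedgeLeft h ℰ ((formOps 𝒞 P (0, 1)).ract (ω ⊗ₜ b)) x := by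
        intro x
        induction x using BTensor.induction with
        | h0 => simp
        | ht η e => simp [BTensor.lact_mk, h.wedge_lact]
        | ha x y hx hy => simp only [map_add, hx, hy]
      simp only [LinearMap.sub_apply, LinearMap.comp_apply, LinearMap.rTensor_tmul, idWedge,
        TensorProduct.lift.tmul, LinearMap.mk₂_apply]
      rw [hD, map_add, key, h.dbar_ract, TensorProduct.sub_tmul, map_sub, BTensor.mk_balanced]
      rw [wedgeLeft_mk]
      abel)

/-- The holomorphic curvature `R = (∂̄ ⊗ id - id ∧ D) D : E → Ω^(0,2) ⊗_B E`. -/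
def holomorphicCurvature (h : IsCovariantComplexStructure H 𝔅 𝒞 P)
    (D : E →ₗ[ℂ] BTensor (formOps 𝒞 P (0, 1)) ℰ) (hD : IsDbarConnection h ℰ D) :
    E →ₗ[ℂ] BTensor (formOps 𝒞 P (0, 2)) ℰ :=
  curvatureOp h D hD ∘ₗ D

/-- `(E, D)` is a covariant holomorphic bimodule: `H` is a Hopf star-algebra, `𝔅` a left comodule
star-algebra, `(𝒞, P)` a covariant complex structure over it, `ℰ` a relative Hopf module, and `D` a
covariant left `∂̄`-connection on `ℰ` whose holomorphic curvature vanishes. -/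
structure IsCovariantHolomorphicBimodule (H : HopfStarOps A) (𝔅 : ComoduleStarOps A B)
    (𝒞 : CalculusOps A B Ω) (P : Bigrading Ω) (ℰ : RelHopfOps A B E)
    (D : E →ₗ[ℂ] BTensor (formOps 𝒞 P (0, 1)) ℰ) : Prop where
  hopf : IsHopfStarAlgebra H
  base : IsComoduleStarAlgebra H 𝔅
  complex : IsCovariantComplexStructure H 𝔅 𝒞 P
  module : IsRelHopfModule H 𝔅 ℰ
  connection : IsDbarConnection complex ℰ D
  covariant : IsCovariant ℰ.coact
    (BTensor.coact hopf (complex.isRelHopfModule (0, 1)) module) D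
  curvature : holomorphicCurvature complex D connection = 0

end FormModule

end Calculi

/-! ### Unitary 2-cocycles and cocycle deformation -/

section Cocycle

variable {A B Ω E : Type*} [AddCommGroup A] [Module ℂ A] [Coalgebra ℂ A]
  [AddCommGroup B] [Module ℂ B] [AddCommGroup Ω] [Module ℂ Ω] [AddCommGroup E] [Module ℂ E]

/-- A unital unitary 2-cocycle `γ` on `A`, together with its convolution inverse `inv`. -/
structure UnitaryTwoCocycle (H : HopfStarOps A) where
  γ : A ⊗[ℂ] A →ₗ[ℂ] ℂ
  inv : A ⊗[ℂ] A →ₗ[ℂ] ℂ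
  mul_inv : convL γ inv = Coalgebra.counit
  inv_mul : convL inv γ = Coalgebra.counit
  /-- `γ(g₍₁₎ ⊗ h₍₁₎) γ(g₍₂₎ h₍₂₎ ⊗ k) = γ(h₍₁₎ ⊗ k₍₁₎) γ(g ⊗ h₍₂₎ k₍₂₎)`. -/
  cocycle : ∀ g h k, convL γ (γ ∘ₗ (TensorProduct.mk ℂ A A).flip k ∘ₗ H.mul) (g ⊗ₜ h) =
    convL γ (γ ∘ₗ TensorProduct.mk ℂ A A g ∘ₗ H.mul) (h ⊗ₜ k)
  unital_left : ∀ h, γ (H.one ⊗ₜ h) = Coalgebra.counit h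
  unital_right : ∀ h, γ (h ⊗ₜ H.one) = Coalgebra.counit h
  unitary : ∀ a b, starRingEnd ℂ (γ (a ⊗ₜ b)) =
    inv (H.star (H.antipode a) ⊗ₜ H.star (H.antipode b))

namespace UnitaryTwoCocycle

variable {H : HopfStarOps A} (c : UnitaryTwoCocycle H)

/-- `U(k) = γ(k₍₁₎ ⊗ S(k₍₂₎))`. -/
def U : A →ₗ[ℂ] ℂ := c.γ ∘ₗ H.antipode.lTensor A ∘ₗ Coalgebra.comul

/-- `Ū(k) = γ̄(S(k₍₁₎) ⊗ k₍₂₎)`. -/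
def Ubar : A →ₗ[ℂ] ℂ := c.inv ∘ₗ H.antipode.rTensor A ∘ₗ Coalgebra.comul

/-- The inverse `a ↦ S(a*)*` of the antipode of a Hopf star-algebra. -/
def antipodeInv (H : HopfStarOps A) : A →ₗ[ℂ] A := H.star.comp (H.antipode.comp H.star)

/-- `V = U ∘ S⁻¹`. -/
def V : A →ₗ[ℂ] ℂ := c.U ∘ₗ antipodeInv H

/-- `V̄ = Ū ∘ S⁻¹`. -/
def Vbar : A →ₗ[ℂ] ℂ := c.Ubar ∘ₗ antipodeInv H

/-- The operations of `A_γ`: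
`h ·_γ k = γ(h₍₁₎ ⊗ k₍₁₎) h₍₂₎ k₍₂₎ γ̄(h₍₃₎ ⊗ k₍₃₎)`, `S_γ(h) = U(h₍₁₎) S(h₍₂₎) Ū(h₍₃₎)` and
`h ↦ V̄(h₍₁₎*) h₍₂₎* V(h₍₃₎*)`; in the last one `h₍₁₎* ⊗ h₍₂₎* ⊗ h₍₃₎*` is the iterated coproduct
of `h*`. -/
def twistHopf : HopfStarOps A where
  mul := convL c.γ (convR H.mul c.inv)
  one := H.one
  antipode := convL c.U (convR H.antipode c.Ubar)
  star := (convL c.Vbar (convR LinearMap.id c.V)).comp H.star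

/-- The operations of the deformation of a comodule star-algebra:
`a ·_γ b = γ(a₍₋₁₎ ⊗ b₍₋₁₎) a₍₀₎ b₍₀₎` and `b ↦ V̄(b₍₋₁₎*) b₍₀₎*`, where
`b₍₋₁₎* ⊗ b₍₀₎*` is the coaction on `b*`; unit and coaction are unchanged. -/
def twistAlgebra (𝔅 : ComoduleStarOps A B) : ComoduleStarOps A B where
  mul := 𝔅.mul ∘ₗ scale c.γ 𝔅.coact 𝔅.coact
  one := 𝔅.one
  star := ((TensorProduct.lid ℂ B).toLinearMap ∘ₗ c.Vbar.rTensor B ∘ₗ 𝔅.coact).comp 𝔅.star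
  coact := 𝔅.coact

/-- The deformed calculus `Ω_γ`: product and star are deformed, everything else is unchanged. -/
def twistCalculus (𝒞 : CalculusOps A B Ω) : CalculusOps A B Ω where
  toComoduleStarOps := c.twistAlgebra 𝒞.toComoduleStarOps
  incl := 𝒞.incl
  d := 𝒞.d
  deg := 𝒞.deg

/-- The operations of `Γ(E)`: `b ·_γ e = γ(b₍₋₁₎ ⊗ e₍₋₁₎) b₍₀₎ e₍₀₎`,
`e ·_γ b = γ(e₍₋₁₎ ⊗ b₍₋₁₎) e₍₀₎ b₍₀₎`, with unchanged coaction. -/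
def twistModule (𝔅 : ComoduleStarOps A B) (ℰ : RelHopfOps A B E) : RelHopfOps A B E where
  lact := ℰ.lact ∘ₗ scale c.γ 𝔅.coact ℰ.coact
  ract := ℰ.ract ∘ₗ scale c.γ ℰ.coact 𝔅.coact
  coact := ℰ.coact

end UnitaryTwoCocycle

end Cocycle

end

end CocycleTwist

/-!
A linear functional `φ` on a coalgebra `C` acts on every left `C`-comodule by
`m ↦ φ(m₍₋₁₎) m₍₀₎` (`act`), and on `C` itself also from the other side (`actR`). All data of the
twist are of this form: the twisted products, actions and the map `φ` of the theorem arise from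
`γ` acting on a tensor product of two comodules, and the twisted star operations from `V̄` and `V`.
Covariant maps commute with these actions (`act_map`), and successive actions compose by the
convolution product (`act_act`). Hence each axiom for the twisted structures follows from the
corresponding axiom for the original ones together with an identity between functionals on `A`,
`A ⊗ A` or `A ⊗ A ⊗ A`. The rebracketings of iterated coproducts are all instances of
`convolve_assoc`.

*Associativity.* If `(x y) z = x (y z)` for four bilinear maps of which the two inner ones are
covariant, then the cocycle condition says that the twisted maps satisfy the same law
(`IsCocycle.twisted_assoc`). This one statement gives the associativity of twisted algebras and
bimodules, the fact that `φ` respects the balancing relations over `B_γ` and `B`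
(`map_balancedRel`, where the invertibility of the cocycle gives the converse inclusion), and the
compatibility of `φ` with left multiplication by functions and forms (`outer_twist`).

*The Hopf star-algebra `A_γ`.* Two-sided twists by `γ` and `γ̄` are conjugations in the convolution
algebra, hence coalgebra maps (`isCoalgMap_conj`). For the antipode one needs `U ⋆ Ū = ε = Ū ⋆ U`.
These identities come from the one-sided deformation `γ(h₍₁₎ ⊗ k₍₁₎) h₍₂₎ k₍₂₎` of the product
(`leftMul`): in the convolution algebra of endomorphisms for this product, the identity has the
inverse `a ↦ S(a₍₁₎) Ū(a₍₂₎)` (`leftInv`). Comparing two inverses of `leftMul` in the convolution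
algebra of maps `A ⊗ A → A` gives the formula for `Ū(h k)` (`Ubar_mul_inv`), which together with
unitarity of `γ` is what the antimultiplicativity of the twisted star operations requires
(`funStar_γ_convL_Vbar`).

*The calculus.* As `d`, the bigrading and the inclusion of `B` are covariant, their axioms pass to
the twist; that `B` and `dB` still generate is `generated_twist`.

*The holomorphic structure.* The map `φ` intertwines the coactions, so `φ⁻¹ ∘ D` is covariant; by
`outer_twist` it satisfies the Leibniz rule, and the maps `φ` in bidegrees `(0,1)` and `(0,2)`
intertwine the two curvature operators (`curvatureOp_twist`), so that the curvature of `φ⁻¹ ∘ D`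
vanishes with that of `D`.
-/

namespace CocycleTwist

noncomputable section

/-! ### Convolution products and functionals acting on comodules -/

section Convolution

variable {C D C' D' M N K M' N' X Y Z X' Y' Z' : Type*}
  [AddCommGroup C] [Module ℂ C] [AddCommGroup D] [Module ℂ D]
  [AddCommGroup C'] [Module ℂ C'] [AddCommGroup D'] [Module ℂ D']
  [AddCommGroup M] [Module ℂ M] [AddCommGroup N] [Module ℂ N] [AddCommGroup K] [Module ℂ K]
  [AddCommGroup M'] [Module ℂ M'] [AddCommGroup N'] [Module ℂ N']
  [AddCommGroup X] [Module ℂ X] [AddCommGroup Y] [Module ℂ Y] [AddCommGroup Z] [Module ℂ Z]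
  [AddCommGroup X'] [Module ℂ X'] [AddCommGroup Y'] [Module ℂ Y'] [AddCommGroup Z'] [Module ℂ Z']

/-- The convolution `m ↦ μ(f(m₍₋₁₎) ⊗ g(m₍₀₎))` along a coaction `δ` with respect to an arbitrary
pairing `μ`.  For `δ = Δ` this is the usual convolution of maps out of a coalgebra. -/
def convolve (δ : M →ₗ[ℂ] C ⊗[ℂ] M) (μ : X ⊗[ℂ] Y →ₗ[ℂ] Z) (f : C →ₗ[ℂ] X) (g : M →ₗ[ℂ] Y) :
    M →ₗ[ℂ] Z :=
  μ ∘ₗ TensorProduct.map f g ∘ₗ δ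

/-- The functional `φ` on `C` acting on a left `C`-comodule: `m ↦ φ(m₍₋₁₎) m₍₀₎`. -/
def act (δ : M →ₗ[ℂ] C ⊗[ℂ] M) (φ : C →ₗ[ℂ] ℂ) : M →ₗ[ℂ] M :=
  (TensorProduct.lid ℂ M).toLinearMap ∘ₗ φ.rTensor M ∘ₗ δ

/-- The external product `c ⊗ d ↦ φ(c) ψ(d)` of two functionals. -/
def funTensor (φ : C →ₗ[ℂ] ℂ) (ψ : D →ₗ[ℂ] ℂ) : C ⊗[ℂ] D →ₗ[ℂ] ℂ :=
  (TensorProduct.lid ℂ ℂ).toLinearMap ∘ₗ TensorProduct.map φ ψ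

@[simp] theorem funTensor_tmul (φ : C →ₗ[ℂ] ℂ) (ψ : D →ₗ[ℂ] ℂ) (c : C) (d : D) :
    funTensor φ ψ (c ⊗ₜ d) = φ c * ψ d := rfl

/-- The coaction of `C ⊗ D` on `M ⊗ N`: the version of `pairCoact` for two coalgebras. -/
def pair (δM : M →ₗ[ℂ] C ⊗[ℂ] M) (δN : N →ₗ[ℂ] D ⊗[ℂ] N) :
    M ⊗[ℂ] N →ₗ[ℂ] (C ⊗[ℂ] D) ⊗[ℂ] (M ⊗[ℂ] N) :=
  (TensorProduct.tensorTensorTensorComm ℂ C M D N).toLinearMap ∘ₗ TensorProduct.map δM δN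

theorem pairCoact_eq_pair (δM : M →ₗ[ℂ] C ⊗[ℂ] M) (δN : N →ₗ[ℂ] C ⊗[ℂ] N) :
    pairCoact δM δN = pair δM δN := rfl

theorem scale_eq_act (γ : C ⊗[ℂ] C →ₗ[ℂ] ℂ) (δM : M →ₗ[ℂ] C ⊗[ℂ] M) (δN : N →ₗ[ℂ] C ⊗[ℂ] N) :
    scale γ δM δN = act (pair δM δN) γ := rfl

/-- `f` intertwines a `C`-coaction with a `D`-coaction along `g : C → D`. -/
def CovariantOver (g : C →ₗ[ℂ] D) (δM : M →ₗ[ℂ] C ⊗[ℂ] M) (δN : N →ₗ[ℂ] D ⊗[ℂ] N)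
    (f : M →ₗ[ℂ] N) : Prop :=
  ∀ m, δN (f m) = TensorProduct.map g f (δM m)

theorem IsCovariant.over {δM : M →ₗ[ℂ] C ⊗[ℂ] M} {δN : N →ₗ[ℂ] C ⊗[ℂ] N} {f : M →ₗ[ℂ] N}
    (h : IsCovariant δM δN f) : CovariantOver LinearMap.id δM δN f := h

theorem CovariantOver.isCovariant {δM : M →ₗ[ℂ] C ⊗[ℂ] M} {δN : N →ₗ[ℂ] C ⊗[ℂ] N}
    {f : M →ₗ[ℂ] N} (h : CovariantOver LinearMap.id δM δN f) : IsCovariant δM δN f := h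

theorem covariantOver_mul_iff {mulA : C ⊗[ℂ] C →ₗ[ℂ] C} {δM : M →ₗ[ℂ] C ⊗[ℂ] M}
    {δN : N →ₗ[ℂ] C ⊗[ℂ] N} {δK : K →ₗ[ℂ] C ⊗[ℂ] K} {μ : M ⊗[ℂ] N →ₗ[ℂ] K} :
    CovariantOver mulA (pair δM δN) δK μ ↔ IsCovariant (tensorCoact mulA δM δN) δK μ := by
  refine forall_congr' fun m => ?_
  rw [tensorCoact, LinearMap.comp_apply, LinearMap.lTensor, LinearMap.rTensor,
    TensorProduct.map_map, LinearMap.id_comp, LinearMap.comp_id, pairCoact_eq_pair]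

theorem CovariantOver.id (δM : M →ₗ[ℂ] C ⊗[ℂ] M) :
    CovariantOver LinearMap.id δM δM LinearMap.id := fun m => by
  rw [TensorProduct.map_id]; rfl

theorem CovariantOver.comp {K C₂ : Type*} [AddCommGroup K] [Module ℂ K] [AddCommGroup C₂]
    [Module ℂ C₂] {g : C →ₗ[ℂ] D} {g' : D →ₗ[ℂ] C₂} {δM : M →ₗ[ℂ] C ⊗[ℂ] M}
    {δN : N →ₗ[ℂ] D ⊗[ℂ] N} {δK : K →ₗ[ℂ] C₂ ⊗[ℂ] K} {f : M →ₗ[ℂ] N} {f' : N →ₗ[ℂ] K}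
    (h' : CovariantOver g' δN δK f') (h : CovariantOver g δM δN f) :
    CovariantOver (g' ∘ₗ g) δM δK (f' ∘ₗ f) := fun m => by
  rw [LinearMap.comp_apply, h', h, TensorProduct.map_map]

theorem pair_tmul (δM : M →ₗ[ℂ] C ⊗[ℂ] M) (δN : N →ₗ[ℂ] D ⊗[ℂ] N) (m : M) (n : N) :
    pair δM δN (m ⊗ₜ n) =
      TensorProduct.tensorTensorTensorComm ℂ C M D N (δM m ⊗ₜ δN n) := rfl

theorem map_tensorTensorTensorComm (f : C →ₗ[ℂ] C') (g : M →ₗ[ℂ] M') (f' : D →ₗ[ℂ] D')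
    (g' : N →ₗ[ℂ] N') (t : (C ⊗[ℂ] M) ⊗[ℂ] (D ⊗[ℂ] N)) :
    TensorProduct.map (TensorProduct.map f f') (TensorProduct.map g g')
      (TensorProduct.tensorTensorTensorComm ℂ C M D N t) =
    TensorProduct.tensorTensorTensorComm ℂ C' M' D' N'
      (TensorProduct.map (TensorProduct.map f g) (TensorProduct.map f' g') t) := by
  have : TensorProduct.map (TensorProduct.map f f') (TensorProduct.map g g') ∘ₗ
      (TensorProduct.tensorTensorTensorComm ℂ C M D N).toLinearMap =
      (TensorProduct.tensorTensorTensorComm ℂ C' M' D' N').toLinearMap ∘ₗ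
      (TensorProduct.map (TensorProduct.map f g) (TensorProduct.map f' g')) := by
    ext; rfl
  exact LinearMap.congr_fun this t

theorem CovariantOver.map {g : C →ₗ[ℂ] C'} {g' : D →ₗ[ℂ] D'} {δM : M →ₗ[ℂ] C ⊗[ℂ] M}
    {δM' : M' →ₗ[ℂ] C' ⊗[ℂ] M'} {δN : N →ₗ[ℂ] D ⊗[ℂ] N} {δN' : N' →ₗ[ℂ] D' ⊗[ℂ] N'}
    {f : M →ₗ[ℂ] M'} {f' : N →ₗ[ℂ] N'} (h : CovariantOver g δM δM' f)
    (h' : CovariantOver g' δN δN' f') :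
    CovariantOver (TensorProduct.map g g') (pair δM δN) (pair δM' δN')
      (TensorProduct.map f f') := by
  intro t
  induction t using TensorProduct.induction_on with
  | zero => simp
  | add s t hs ht => simp only [map_add, hs, ht]
  | tmul m n =>
    rw [TensorProduct.map_tmul, pair_tmul, pair_tmul, h, h', map_tensorTensorTensorComm,
      TensorProduct.map_tmul]

theorem CovariantOver.assoc (δM : M →ₗ[ℂ] C ⊗[ℂ] M) (δN : N →ₗ[ℂ] D ⊗[ℂ] N)
    (δK : K →ₗ[ℂ] C' ⊗[ℂ] K) :
    CovariantOver (TensorProduct.assoc ℂ C D C').toLinearMap (pair (pair δM δN) δK)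
      (pair δM (pair δN δK)) (TensorProduct.assoc ℂ M N K).toLinearMap := by
  intro t
  induction t using TensorProduct.induction_on with
  | zero => simp
  | add s t hs ht => simp only [map_add, hs, ht]
  | tmul x k =>
    induction x using TensorProduct.induction_on with
    | zero => simp
    | add s t hs ht => simp only [TensorProduct.add_tmul, map_add, hs, ht]
    | tmul m n =>
      simp only [LinearEquiv.coe_coe, TensorProduct.assoc_tmul, pair_tmul]
      generalize δM m = x
      generalize δN n = y
      generalize δK k = z
      have : (TensorProduct.tensorTensorTensorComm ℂ C M (D ⊗[ℂ] C') (N ⊗[ℂ] K)).toLinearMap ∘ₗ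
          TensorProduct.map LinearMap.id
            (TensorProduct.tensorTensorTensorComm ℂ D N C' K).toLinearMap ∘ₗ
          (TensorProduct.assoc ℂ (C ⊗[ℂ] M) (D ⊗[ℂ] N) (C' ⊗[ℂ] K)).toLinearMap =
          TensorProduct.map (TensorProduct.assoc ℂ C D C').toLinearMap
            (TensorProduct.assoc ℂ M N K).toLinearMap ∘ₗ
          (TensorProduct.tensorTensorTensorComm ℂ (C ⊗[ℂ] D) (M ⊗[ℂ] N) C' K).toLinearMap ∘ₗ
          TensorProduct.map (TensorProduct.tensorTensorTensorComm ℂ C M D N).toLinearMap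
            LinearMap.id := by
        ext; rfl
      exact LinearMap.congr_fun this (x ⊗ₜ y ⊗ₜ z)

theorem CovariantOver.comm (δM : M →ₗ[ℂ] C ⊗[ℂ] M) (δN : N →ₗ[ℂ] D ⊗[ℂ] N) :
    CovariantOver (TensorProduct.comm ℂ C D).toLinearMap (pair δM δN) (pair δN δM)
      (TensorProduct.comm ℂ M N).toLinearMap := by
  intro t
  induction t using TensorProduct.induction_on with
  | zero => simp
  | add s t hs ht => simp only [map_add, hs, ht]
  | tmul m n =>
    simp only [LinearEquiv.coe_coe, TensorProduct.comm_tmul, pair_tmul]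
    generalize δM m = x
    generalize δN n = y
    have : (TensorProduct.tensorTensorTensorComm ℂ D N C M).toLinearMap ∘ₗ
        (TensorProduct.comm ℂ (C ⊗[ℂ] M) (D ⊗[ℂ] N)).toLinearMap =
        TensorProduct.map (TensorProduct.comm ℂ C D).toLinearMap
          (TensorProduct.comm ℂ M N).toLinearMap ∘ₗ
        (TensorProduct.tensorTensorTensorComm ℂ C M D N).toLinearMap := by
      ext; rfl
    exact LinearMap.congr_fun this (x ⊗ₜ y)

/-- Covariant maps intertwine the actions of functionals. -/
theorem act_map {g : C →ₗ[ℂ] D} {δM : M →ₗ[ℂ] C ⊗[ℂ] M} {δN : N →ₗ[ℂ] D ⊗[ℂ] N} {f : M →ₗ[ℂ] N}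
    (h : CovariantOver g δM δN f) (φ : D →ₗ[ℂ] ℂ) (m : M) :
    act δN φ (f m) = f (act δM (φ ∘ₗ g) m) := by
  simp only [act, LinearMap.comp_apply, h m]
  generalize δM m = t
  induction t using TensorProduct.induction_on with
  | zero => simp
  | add s t hs ht => simp only [map_add, hs, ht]
  | tmul c m => simp

/-- Covariant maps intertwine the actions of functionals on `A ⊗ A`. -/
theorem act_map_map {A X Y X' Y' : Type*} [AddCommGroup A] [Module ℂ A]
    [AddCommGroup X] [Module ℂ X] [AddCommGroup Y] [Module ℂ Y] [AddCommGroup X'] [Module ℂ X']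
    [AddCommGroup Y'] [Module ℂ Y']
    {δX : X →ₗ[ℂ] A ⊗[ℂ] X} {δY : Y →ₗ[ℂ] A ⊗[ℂ] Y} {δX' : X' →ₗ[ℂ] A ⊗[ℂ] X'}
    {δY' : Y' →ₗ[ℂ] A ⊗[ℂ] Y'} {f : X →ₗ[ℂ] X'} {g : Y →ₗ[ℂ] Y'} (hf : IsCovariant δX δX' f)
    (hg : IsCovariant δY δY' g) (γ : A ⊗[ℂ] A →ₗ[ℂ] ℂ) (t : X ⊗[ℂ] Y) :
    act (pair δX' δY') γ (TensorProduct.map f g t) =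
      TensorProduct.map f g (act (pair δX δY) γ t) := by
  have h := act_map (hf.over.map hg.over) γ t
  rwa [TensorProduct.map_id, LinearMap.comp_id] at h

theorem act_pair (δM : M →ₗ[ℂ] C ⊗[ℂ] M) (δN : N →ₗ[ℂ] D ⊗[ℂ] N) (φ : C →ₗ[ℂ] ℂ)
    (ψ : D →ₗ[ℂ] ℂ) :
    act (pair δM δN) (funTensor φ ψ) = TensorProduct.map (act δM φ) (act δN ψ) := by
  ext m n
  simp only [act, TensorProduct.AlgebraTensorModule.curry_apply, LinearMap.restrictScalars_self,
    TensorProduct.curry_apply, LinearMap.comp_apply, pair_tmul, TensorProduct.map_tmul]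
  generalize δM m = x
  generalize δN n = y
  have : (TensorProduct.lid ℂ (M ⊗[ℂ] N)).toLinearMap ∘ₗ (funTensor φ ψ).rTensor (M ⊗[ℂ] N) ∘ₗ
      (TensorProduct.tensorTensorTensorComm ℂ C M D N).toLinearMap =
      TensorProduct.map ((TensorProduct.lid ℂ M).toLinearMap ∘ₗ φ.rTensor M)
        ((TensorProduct.lid ℂ N).toLinearMap ∘ₗ ψ.rTensor N) := by
    ext c m d n
    simp [TensorProduct.smul_tmul', TensorProduct.tmul_smul, smul_smul, mul_comm]
  exact LinearMap.congr_fun this (x ⊗ₜ y)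

theorem comp_convolve (δ : M →ₗ[ℂ] C ⊗[ℂ] M) (μ : X ⊗[ℂ] Y →ₗ[ℂ] Z) (f : C →ₗ[ℂ] X)
    (g : M →ₗ[ℂ] Y) (k : Z →ₗ[ℂ] Z') : k ∘ₗ convolve δ μ f g = convolve δ (k ∘ₗ μ) f g := rfl

theorem convolve_map (δ : M →ₗ[ℂ] C ⊗[ℂ] M) (μ : X ⊗[ℂ] Y →ₗ[ℂ] Z) (f : C →ₗ[ℂ] X')
    (g : M →ₗ[ℂ] Y') (k : X' →ₗ[ℂ] X) (l : Y' →ₗ[ℂ] Y) :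
    convolve δ (μ ∘ₗ TensorProduct.map k l) f g = convolve δ μ (k ∘ₗ f) (l ∘ₗ g) := by
  simp only [convolve, TensorProduct.map_comp, LinearMap.comp_assoc]

theorem convolve_comp {g : C →ₗ[ℂ] D} {δM : M →ₗ[ℂ] C ⊗[ℂ] M} {δN : N →ₗ[ℂ] D ⊗[ℂ] N}
    {f : M →ₗ[ℂ] N} (h : CovariantOver g δM δN f) (μ : X ⊗[ℂ] Y →ₗ[ℂ] Z) (k : D →ₗ[ℂ] X)
    (l : N →ₗ[ℂ] Y) : convolve δN μ k l ∘ₗ f = convolve δM μ (k ∘ₗ g) (l ∘ₗ f) := by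
  ext m
  simp only [convolve, LinearMap.comp_apply, h m, TensorProduct.map_map]

theorem act_eq_convolve (δ : M →ₗ[ℂ] C ⊗[ℂ] M) (φ : C →ₗ[ℂ] ℂ) :
    act δ φ = convolve δ (TensorProduct.lid ℂ M).toLinearMap φ LinearMap.id := rfl

theorem convolve_id (δ : M →ₗ[ℂ] C ⊗[ℂ] M) :
    convolve δ LinearMap.id LinearMap.id LinearMap.id = δ := by
  ext m
  simp [convolve]

end Convolution

/-! ### Comodules and coassociativity -/

section Coalgebra

variable {C D C' D' M N K M' N' X Y Z X' Y' Z' : Type*}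
  [AddCommGroup C] [Module ℂ C] [Coalgebra ℂ C] [AddCommGroup D] [Module ℂ D] [Coalgebra ℂ D]
  [AddCommGroup M] [Module ℂ M] [AddCommGroup N] [Module ℂ N] [AddCommGroup K] [Module ℂ K]
  [AddCommGroup M'] [Module ℂ M'] [AddCommGroup N'] [Module ℂ N']
  [AddCommGroup X] [Module ℂ X] [AddCommGroup Y] [Module ℂ Y] [AddCommGroup Z] [Module ℂ Z]
  [AddCommGroup X'] [Module ℂ X'] [AddCommGroup Y'] [Module ℂ Y'] [AddCommGroup Z'] [Module ℂ Z']

variable (C) in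
theorem isComodule_comul : IsComodule (Coalgebra.comul (R := ℂ) (A := C)) where
  coassoc c := Coalgebra.coassoc_apply c
  counit c := by simp

theorem comul_tensor : Coalgebra.comul (R := ℂ) (A := C ⊗[ℂ] D) =
    pair (Coalgebra.comul (R := ℂ)) (Coalgebra.comul (R := ℂ)) := by
  ext c d; rfl

theorem counit_tensor : Coalgebra.counit (R := ℂ) (A := C ⊗[ℂ] D) =
    funTensor (Coalgebra.counit (R := ℂ)) (Coalgebra.counit (R := ℂ)) := by
  ext c d; simp [mul_comm]

/-- Reassociation of iterated convolutions: every "Sweedler notation" rebracketing is an instance,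
for suitable pairings. -/
theorem convolve_assoc {δ : M →ₗ[ℂ] C ⊗[ℂ] M} (hδ : IsComodule δ) {X₁ X₂ X₃ P Q R : Type*}
    [AddCommGroup X₁] [Module ℂ X₁] [AddCommGroup X₂] [Module ℂ X₂] [AddCommGroup X₃] [Module ℂ X₃]
    [AddCommGroup P] [Module ℂ P] [AddCommGroup Q] [Module ℂ Q] [AddCommGroup R] [Module ℂ R]
    (μ₁ : X₁ ⊗[ℂ] X₂ →ₗ[ℂ] P) (μ₂ : P ⊗[ℂ] X₃ →ₗ[ℂ] R) (μ₃ : X₂ ⊗[ℂ] X₃ →ₗ[ℂ] Q)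
    (μ₄ : X₁ ⊗[ℂ] Q →ₗ[ℂ] R) (hμ : ∀ x y z, μ₂ (μ₁ (x ⊗ₜ y) ⊗ₜ z) = μ₄ (x ⊗ₜ μ₃ (y ⊗ₜ z)))
    (f : C →ₗ[ℂ] X₁) (g : C →ₗ[ℂ] X₂) (h : M →ₗ[ℂ] X₃) :
    convolve δ μ₂ (convolve Coalgebra.comul μ₁ f g) h = convolve δ μ₄ f (convolve δ μ₃ g h) := by
  have e : ∀ t : (C ⊗[ℂ] C) ⊗[ℂ] M, μ₂ (TensorProduct.map (μ₁ ∘ₗ TensorProduct.map f g) h t) =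
      μ₄ (TensorProduct.map f (μ₃ ∘ₗ TensorProduct.map g h) (TensorProduct.assoc ℂ C C M t)) := by
    have : μ₂ ∘ₗ TensorProduct.map (μ₁ ∘ₗ TensorProduct.map f g) h =
        μ₄ ∘ₗ TensorProduct.map f (μ₃ ∘ₗ TensorProduct.map g h) ∘ₗ
          (TensorProduct.assoc ℂ C C M).toLinearMap := by
      ext a b c
      exact hμ (f a) (g b) (h c)
    exact fun t => LinearMap.congr_fun this t
  ext m
  have e1 := e ((Coalgebra.comul (R := ℂ)).rTensor M (δ m))
  rw [hδ.coassoc, LinearMap.lTensor, LinearMap.rTensor, TensorProduct.map_map,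
    TensorProduct.map_map] at e1
  exact e1

variable {δM : M →ₗ[ℂ] C ⊗[ℂ] M} {δN : N →ₗ[ℂ] D ⊗[ℂ] N}

/-- Functionals act from the right: acting with `φ` and then with `ψ` is acting with `φ ⋆ ψ`. -/
theorem act_act (hM : IsComodule δM) (φ ψ : C →ₗ[ℂ] ℂ) (m : M) :
    act δM ψ (act δM φ m) = act δM (convL φ ψ) m := by
  have := convolve_assoc hM (TensorProduct.lid ℂ ℂ).toLinearMap (TensorProduct.lid ℂ M).toLinearMap
    (TensorProduct.lid ℂ M).toLinearMap (TensorProduct.lid ℂ M).toLinearMap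
    (fun x y z => by simp [smul_smul, mul_comm]) φ ψ LinearMap.id
  rw [← act_eq_convolve, ← act_eq_convolve] at this
  have h2 := comp_convolve δM (TensorProduct.lid ℂ M).toLinearMap φ LinearMap.id (act δM ψ)
  have h3 := LinearMap.congr_fun this m
  refine Eq.trans ?_ h3.symm
  simp only [convolve, act, LinearMap.comp_apply]
  generalize δM m = t
  induction t using TensorProduct.induction_on with
  | zero => simp
  | add s t hs ht => simp only [map_add, hs, ht]
  | tmul c m => simp

theorem act_counit (hM : IsComodule δM) (m : M) : act δM Coalgebra.counit m = m := hM.counit m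

theorem convL_apply (φ : C →ₗ[ℂ] ℂ) (f : C →ₗ[ℂ] X) (x : C) :
    convL φ f x = f (act Coalgebra.comul φ x) := by
  simp only [convL, act, LinearMap.comp_apply]
  generalize Coalgebra.comul (R := ℂ) x = t
  induction t using TensorProduct.induction_on with
  | zero => simp
  | add s t hs ht => simp only [map_add, hs, ht]
  | tmul c m => simp

/-- `pair δM δN` makes `M ⊗ N` a comodule over `C ⊗ D`. -/
theorem IsComodule.pair (hM : IsComodule δM) (hN : IsComodule δN) : IsComodule (pair δM δN) where
  coassoc t := by
    rw [comul_tensor]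
    induction t using TensorProduct.induction_on with
    | zero => simp
    | add s t hs ht => simp only [map_add, hs, ht]
    | tmul m n =>
      have h1 := hM.coassoc m
      have h2 := hN.coassoc n
      simp only [pair_tmul]
      let F : (C ⊗[ℂ] (C ⊗[ℂ] M)) ⊗[ℂ] (D ⊗[ℂ] (D ⊗[ℂ] N)) →ₗ[ℂ]
          (C ⊗[ℂ] D) ⊗[ℂ] ((C ⊗[ℂ] D) ⊗[ℂ] (M ⊗[ℂ] N)) :=
        (TensorProduct.tensorTensorTensorComm ℂ C M D N).toLinearMap.lTensor (C ⊗[ℂ] D) ∘ₗ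
          (TensorProduct.tensorTensorTensorComm ℂ C (C ⊗[ℂ] M) D (D ⊗[ℂ] N)).toLinearMap
      have h3 := congrArg₂ (fun x y => F (x ⊗ₜ y)) h1 h2
      have e1 : ∀ (x : C ⊗[ℂ] M) (y : D ⊗[ℂ] N),
          F (TensorProduct.assoc ℂ C C M ((Coalgebra.comul (R := ℂ)).rTensor M x) ⊗ₜ
            TensorProduct.assoc ℂ D D N ((Coalgebra.comul (R := ℂ)).rTensor N y)) =
          TensorProduct.assoc ℂ (C ⊗[ℂ] D) (C ⊗[ℂ] D) (M ⊗[ℂ] N)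
            ((CocycleTwist.pair (Coalgebra.comul (R := ℂ)) (Coalgebra.comul (R := ℂ))).rTensor
              (M ⊗[ℂ] N) (TensorProduct.tensorTensorTensorComm ℂ C M D N (x ⊗ₜ y))) := by
        intro x y
        induction x using TensorProduct.induction_on with
        | zero => simp
        | add s t hs ht => simp only [TensorProduct.add_tmul, map_add, hs, ht]
        | tmul c m =>
          induction y using TensorProduct.induction_on with
          | zero => simp
          | add s t hs ht => simp only [TensorProduct.tmul_add, map_add, hs, ht]
          | tmul d n =>
            simp only [LinearMap.rTensor_tmul, TensorProduct.tensorTensorTensorComm_tmul, pair_tmul]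
            generalize Coalgebra.comul (R := ℂ) c = x
            generalize Coalgebra.comul (R := ℂ) d = y
            induction x using TensorProduct.induction_on with
            | zero => simp
            | add s t hs ht => simp only [TensorProduct.add_tmul, map_add, hs, ht]
            | tmul c c' =>
              induction y using TensorProduct.induction_on with
              | zero => simp
              | add s t hs ht =>
                simp only [TensorProduct.add_tmul, TensorProduct.tmul_add, map_add, hs, ht]
              | tmul d d' => simp [F]
      have e2 : ∀ (x : C ⊗[ℂ] M) (y : D ⊗[ℂ] N),
          F (δM.lTensor C x ⊗ₜ δN.lTensor D y) = (CocycleTwist.pair δM δN).lTensor (C ⊗[ℂ] D)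
            (TensorProduct.tensorTensorTensorComm ℂ C M D N (x ⊗ₜ y)) := by
        intro x y
        induction x using TensorProduct.induction_on with
        | zero => simp
        | add s t hs ht => simp only [TensorProduct.add_tmul, map_add, hs, ht]
        | tmul c m =>
          induction y using TensorProduct.induction_on with
          | zero => simp
          | add s t hs ht => simp only [TensorProduct.tmul_add, map_add, hs, ht]
          | tmul d n => simp [F, pair_tmul]
      rw [← e1, ← e2, h3]
  counit t := by
    have := act_pair δM δN (Coalgebra.counit (R := ℂ)) (Coalgebra.counit (R := ℂ))
    rw [← counit_tensor] at this
    have h1 : act δM (Coalgebra.counit (R := ℂ)) = LinearMap.id := LinearMap.ext hM.counit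
    have h2 : act δN (Coalgebra.counit (R := ℂ)) = LinearMap.id := LinearMap.ext hN.counit
    rw [h1, h2, TensorProduct.map_id] at this
    exact LinearMap.congr_fun this t

end Coalgebra

/-! ### Functionals acting on coalgebras -/

section Functionals

variable {C D M N X Y Z : Type*}
  [AddCommGroup C] [Module ℂ C] [Coalgebra ℂ C] [AddCommGroup D] [Module ℂ D] [Coalgebra ℂ D]
  [AddCommGroup M] [Module ℂ M] [AddCommGroup N] [Module ℂ N]
  [AddCommGroup X] [Module ℂ X] [AddCommGroup Y] [Module ℂ Y] [AddCommGroup Z] [Module ℂ Z]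
  {δM : M →ₗ[ℂ] C ⊗[ℂ] M} {δN : N →ₗ[ℂ] D ⊗[ℂ] N}

/-- The functional `φ` acting on the coalgebra from the other side: `c ↦ c₍₁₎ φ(c₍₂₎)`. -/
def actR (φ : C →ₗ[ℂ] ℂ) : C →ₗ[ℂ] C := convR LinearMap.id φ

theorem actR_eq_convolve (φ : C →ₗ[ℂ] ℂ) : actR φ =
    convolve Coalgebra.comul (TensorProduct.rid ℂ C).toLinearMap LinearMap.id φ := rfl

theorem convR_apply (f : C →ₗ[ℂ] X) (φ : C →ₗ[ℂ] ℂ) (x : C) : convR f φ x = f (actR φ x) := by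
  simp only [convR, actR, LinearMap.comp_apply]
  generalize Coalgebra.comul (R := ℂ) x = t
  induction t using TensorProduct.induction_on with
  | zero => simp
  | add s t hs ht => simp only [map_add, hs, ht]
  | tmul c m => simp

theorem apply_actR (ψ φ : C →ₗ[ℂ] ℂ) (x : C) : ψ (actR φ x) = convL ψ φ x := by
  rw [← convR_apply]
  simp only [convR, convL, LinearMap.comp_apply]
  generalize Coalgebra.comul (R := ℂ) x = t
  induction t using TensorProduct.induction_on with
  | zero => simp
  | add s t hs ht => simp only [map_add, hs, ht]
  | tmul c m => simp [mul_comm]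

theorem apply_act (ψ φ : C →ₗ[ℂ] ℂ) (x : C) : ψ (act Coalgebra.comul φ x) = convL φ ψ x :=
  (convL_apply φ ψ x).symm

theorem convL_assoc (φ ψ : C →ₗ[ℂ] ℂ) (f : C →ₗ[ℂ] X) :
    convL (convL φ ψ) f = convL φ (convL ψ f) := by
  ext x
  rw [convL_apply, convL_apply, convL_apply, act_act (isComodule_comul C)]

@[simp] theorem counit_convL (f : C →ₗ[ℂ] X) : convL Coalgebra.counit f = f := by
  ext x
  rw [convL_apply, act_counit (isComodule_comul C)]

theorem actR_counit (x : C) : actR Coalgebra.counit x = x := by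
  simp only [actR, convR, LinearMap.comp_apply]
  exact (congrArg _ (Coalgebra.lTensor_counit_comul (R := ℂ) x)).trans (by simp)

@[simp] theorem convL_counit (φ : C →ₗ[ℂ] ℂ) : convL φ Coalgebra.counit = φ := by
  ext x
  rw [← apply_actR, actR_counit]

theorem counit_act (φ : C →ₗ[ℂ] ℂ) (x : C) :
    Coalgebra.counit (R := ℂ) (act Coalgebra.comul φ x) = φ x := by
  rw [apply_act, convL_counit]

theorem counit_actR (φ : C →ₗ[ℂ] ℂ) (x : C) :
    Coalgebra.counit (R := ℂ) (actR φ x) = φ x := by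
  rw [apply_actR, counit_convL]

/-- Uniqueness of inverses for the convolution of functionals. -/
theorem eq_of_convL_eq_counit {α β β' : C →ₗ[ℂ] ℂ} (h : convL α β = Coalgebra.counit)
    (h' : convL β β' = Coalgebra.counit) : α = β' := by
  rw [← convL_counit α, ← h', ← convL_assoc, h, counit_convL]

/-- `δ(φ(m₍₋₁₎) m₍₀₎) = φ(m₍₋₂₎) m₍₋₁₎ ⊗ m₍₀₎`. -/
theorem coact_act (hM : IsComodule δM) (φ : C →ₗ[ℂ] ℂ) (m : M) :
    δM (act δM φ m) =
      TensorProduct.map (act Coalgebra.comul φ) LinearMap.id (δM m) := by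
  have h := convolve_assoc hM (TensorProduct.lid ℂ C).toLinearMap LinearMap.id
    LinearMap.id (TensorProduct.lid ℂ (C ⊗[ℂ] M)).toLinearMap
    (fun x y z => by simp [TensorProduct.smul_tmul']) φ LinearMap.id LinearMap.id
  rw [convolve_id] at h
  refine Eq.trans ?_ (LinearMap.congr_fun h m).symm
  simp only [convolve, act, LinearMap.comp_apply]
  generalize δM m = t
  induction t using TensorProduct.induction_on with
  | zero => simp
  | add s t hs ht => simp only [map_add, hs, ht]
  | tmul c m => simp

/-- `m₍₋₂₎ φ(m₍₋₁₎) ⊗ m₍₀₎`, with `φ` absorbed into either of the outer legs. -/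
theorem map_actR_coact (hM : IsComodule δM) (φ : C →ₗ[ℂ] ℂ) (m : M) :
    TensorProduct.map (actR φ) LinearMap.id (δM m) =
      TensorProduct.map LinearMap.id (act δM φ) (δM m) := by
  have h := convolve_assoc hM (TensorProduct.rid ℂ C).toLinearMap LinearMap.id
    (TensorProduct.lid ℂ M).toLinearMap LinearMap.id
    (fun x y z => by simp [TensorProduct.smul_tmul]) LinearMap.id φ LinearMap.id
  exact LinearMap.congr_fun h m

theorem actR_actR (φ ψ : C →ₗ[ℂ] ℂ) (x : C) : actR φ (actR ψ x) = actR (convL φ ψ) x := by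
  have h := convolve_assoc (isComodule_comul C) (TensorProduct.rid ℂ C).toLinearMap
    (TensorProduct.rid ℂ C).toLinearMap (TensorProduct.lid ℂ ℂ).toLinearMap
    (TensorProduct.rid ℂ C).toLinearMap
    (fun x y z => by simp [smul_smul, mul_comm]) LinearMap.id φ ψ
  rw [← actR_eq_convolve] at h
  refine Eq.trans ?_ (LinearMap.congr_fun h x)
  rw [actR_eq_convolve ψ]
  simp only [convolve, LinearMap.comp_apply]
  generalize Coalgebra.comul (R := ℂ) x = t
  induction t using TensorProduct.induction_on with
  | zero => simp
  | add s t hs ht => simp only [map_add, hs, ht]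
  | tmul c m => simp

theorem comul_actR (φ : C →ₗ[ℂ] ℂ) (x : C) :
    Coalgebra.comul (R := ℂ) (actR φ x) =
      TensorProduct.map LinearMap.id (actR φ) (Coalgebra.comul (R := ℂ) x) := by
  have h := convolve_assoc (isComodule_comul C) LinearMap.id
    (TensorProduct.rid ℂ (C ⊗[ℂ] C)).toLinearMap (TensorProduct.rid ℂ C).toLinearMap LinearMap.id
    (fun x y z => by simp) LinearMap.id LinearMap.id φ
  rw [convolve_id] at h
  refine Eq.trans ?_ (LinearMap.congr_fun h x)
  rw [actR_eq_convolve]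
  simp only [convolve, LinearMap.comp_apply]
  generalize Coalgebra.comul (R := ℂ) x = t
  induction t using TensorProduct.induction_on with
  | zero => simp
  | add s t hs ht => simp only [map_add, hs, ht]
  | tmul c m => simp

theorem actR_act (φ ψ : C →ₗ[ℂ] ℂ) (x : C) :
    actR φ (act Coalgebra.comul ψ x) = act Coalgebra.comul ψ (actR φ x) := by
  have h1 : actR φ (act Coalgebra.comul ψ x) =
      TensorProduct.rid ℂ C (TensorProduct.map LinearMap.id φ
        (Coalgebra.comul (R := ℂ) (act Coalgebra.comul ψ x))) := rfl
  have h2 : ∀ y, actR φ y = TensorProduct.rid ℂ C (TensorProduct.map LinearMap.id φ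
        (Coalgebra.comul (R := ℂ) y)) := fun _ => rfl
  rw [h1, coact_act (isComodule_comul C), h2 x]
  generalize Coalgebra.comul (R := ℂ) x = t
  induction t using TensorProduct.induction_on with
  | zero => simp
  | add s t hs ht => simp only [map_add, hs, ht]
  | tmul c m => simp

/-- Morphisms of coalgebras. -/
structure IsCoalgMap (g : C →ₗ[ℂ] D) : Prop where
  comul : CovariantOver g (Coalgebra.comul (R := ℂ)) (Coalgebra.comul (R := ℂ)) g
  counit : ∀ x, Coalgebra.counit (R := ℂ) (g x) = Coalgebra.counit (R := ℂ) x

theorem IsCoalgMap.counit_comp {g : C →ₗ[ℂ] D} (hg : IsCoalgMap g) :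
    Coalgebra.counit (R := ℂ) ∘ₗ g = Coalgebra.counit := LinearMap.ext hg.counit

theorem IsCoalgMap.convL_comp {g : C →ₗ[ℂ] D} (hg : IsCoalgMap g) (φ : D →ₗ[ℂ] ℂ)
    (f : D →ₗ[ℂ] X) : convL φ f ∘ₗ g = convL (φ ∘ₗ g) (f ∘ₗ g) := by
  ext x
  rw [LinearMap.comp_apply, convL_apply, convL_apply, act_map hg.comul, LinearMap.comp_apply]

theorem IsCoalgMap.act {g : C →ₗ[ℂ] D} (hg : IsCoalgMap g) (φ : D →ₗ[ℂ] ℂ) (x : C) :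
    act Coalgebra.comul φ (g x) = g (act Coalgebra.comul (φ ∘ₗ g) x) :=
  act_map hg.comul φ x

theorem IsCoalgMap.actR {g : C →ₗ[ℂ] D} (hg : IsCoalgMap g) (φ : D →ₗ[ℂ] ℂ) (x : C) :
    actR φ (g x) = g (actR (φ ∘ₗ g) x) := by
  have h1 : CocycleTwist.actR φ (g x) = TensorProduct.rid ℂ D (TensorProduct.map LinearMap.id φ
        (Coalgebra.comul (R := ℂ) (g x))) := rfl
  have h2 : ∀ ψ, CocycleTwist.actR ψ x = TensorProduct.rid ℂ C (TensorProduct.map LinearMap.id ψ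
        (Coalgebra.comul (R := ℂ) x)) := fun _ => rfl
  rw [h1, hg.comul, h2]
  generalize Coalgebra.comul (R := ℂ) x = t
  induction t using TensorProduct.induction_on with
  | zero => simp
  | add s t hs ht => simp only [map_add, hs, ht]
  | tmul c m => simp

theorem IsCoalgMap.id : IsCoalgMap (LinearMap.id : C →ₗ[ℂ] C) where
  comul := by
    intro x
    rw [TensorProduct.map_id]; rfl
  counit _ := rfl

theorem IsCoalgMap.map {C' D' : Type*} [AddCommGroup C'] [Module ℂ C'] [Coalgebra ℂ C']
    [AddCommGroup D'] [Module ℂ D'] [Coalgebra ℂ D'] {g : C →ₗ[ℂ] C'} {g' : D →ₗ[ℂ] D'}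
    (hg : IsCoalgMap g) (hg' : IsCoalgMap g') : IsCoalgMap (TensorProduct.map g g') where
  comul := by
    rw [comul_tensor, comul_tensor]
    exact hg.comul.map hg'.comul
  counit x := by
    induction x using TensorProduct.induction_on with
    | zero => simp
    | add s t hs ht => simp only [map_add, hs, ht]
    | tmul c m => simp [hg.counit, hg'.counit]

variable (C D) in
theorem isCoalgMap_assoc {C' : Type*} [AddCommGroup C'] [Module ℂ C'] [Coalgebra ℂ C'] :
    IsCoalgMap (TensorProduct.assoc ℂ C D C').toLinearMap where
  comul := by
    simp only [comul_tensor]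
    exact CovariantOver.assoc _ _ _
  counit x := by
    have : Coalgebra.counit (R := ℂ) ∘ₗ (TensorProduct.assoc ℂ C D C').toLinearMap =
        Coalgebra.counit (R := ℂ) := by
      ext; simp [mul_comm, mul_assoc]
    exact LinearMap.congr_fun this x

variable (C D) in
theorem isCoalgMap_comm : IsCoalgMap (TensorProduct.comm ℂ C D).toLinearMap where
  comul := by
    simp only [comul_tensor]
    exact CovariantOver.comm _ _
  counit x := by
    have : Coalgebra.counit (R := ℂ) ∘ₗ (TensorProduct.comm ℂ C D).toLinearMap =
        Coalgebra.counit (R := ℂ) := by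
      ext; simp [mul_comm]
    exact LinearMap.congr_fun this x

theorem act_funTensor (φ : C →ₗ[ℂ] ℂ) (ψ : D →ₗ[ℂ] ℂ) :
    act Coalgebra.comul (funTensor φ ψ) =
      TensorProduct.map (act Coalgebra.comul φ) (act Coalgebra.comul ψ) := by
  rw [comul_tensor, act_pair]

theorem actR_funTensor (φ : C →ₗ[ℂ] ℂ) (ψ : D →ₗ[ℂ] ℂ) :
    actR (funTensor φ ψ) = TensorProduct.map (actR φ) (actR ψ) := by
  ext c d
  simp only [TensorProduct.AlgebraTensorModule.curry_apply, LinearMap.restrictScalars_self,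
    TensorProduct.curry_apply, TensorProduct.map_tmul]
  have e1 : ∀ φ : C →ₗ[ℂ] ℂ, actR φ c = TensorProduct.rid ℂ C (TensorProduct.map LinearMap.id φ
        (Coalgebra.comul (R := ℂ) c)) := fun _ => rfl
  have e2 : ∀ φ : D →ₗ[ℂ] ℂ, actR φ d = TensorProduct.rid ℂ D (TensorProduct.map LinearMap.id φ
        (Coalgebra.comul (R := ℂ) d)) := fun _ => rfl
  have e3 : ∀ φ : C ⊗[ℂ] D →ₗ[ℂ] ℂ, actR φ (c ⊗ₜ d) = TensorProduct.rid ℂ (C ⊗[ℂ] D)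
      (TensorProduct.map LinearMap.id φ (Coalgebra.comul (R := ℂ) (c ⊗ₜ[ℂ] d))) := fun _ => rfl
  rw [e1, e2, e3, comul_tensor, pair_tmul]
  generalize Coalgebra.comul (R := ℂ) c = x
  generalize Coalgebra.comul (R := ℂ) d = y
  have : (TensorProduct.rid ℂ (C ⊗[ℂ] D)).toLinearMap ∘ₗ
      TensorProduct.map LinearMap.id (funTensor φ ψ) ∘ₗ
      (TensorProduct.tensorTensorTensorComm ℂ C C D D).toLinearMap =
      TensorProduct.map ((TensorProduct.rid ℂ C).toLinearMap ∘ₗ TensorProduct.map LinearMap.id φ)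
        ((TensorProduct.rid ℂ D).toLinearMap ∘ₗ TensorProduct.map LinearMap.id ψ) := by
    ext c m d n
    simp [TensorProduct.smul_tmul', TensorProduct.tmul_smul, smul_smul, mul_comm]
  exact LinearMap.congr_fun this (x ⊗ₜ y)

theorem funTensor_convL (φ φ' : C →ₗ[ℂ] ℂ) (ψ ψ' : D →ₗ[ℂ] ℂ) :
    convL (funTensor φ ψ) (funTensor φ' ψ') = funTensor (convL φ φ') (convL ψ ψ') := by
  ext c d
  simp only [TensorProduct.AlgebraTensorModule.curry_apply, LinearMap.restrictScalars_self,
    TensorProduct.curry_apply]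
  rw [convL_apply, act_funTensor, TensorProduct.map_tmul, funTensor_tmul, funTensor_tmul,
    convL_apply, convL_apply]

end Functionals

/-! ### Associativity laws twisted by a cocycle -/

section TwistedAssoc

variable {A M N K P Q R : Type*} [AddCommGroup A] [Module ℂ A] [Coalgebra ℂ A]
  [AddCommGroup M] [Module ℂ M] [AddCommGroup N] [Module ℂ N] [AddCommGroup K] [Module ℂ K]
  [AddCommGroup P] [Module ℂ P] [AddCommGroup Q] [Module ℂ Q] [AddCommGroup R] [Module ℂ R]
  {δM : M →ₗ[ℂ] A ⊗[ℂ] M} {δN : N →ₗ[ℂ] A ⊗[ℂ] N} {δK : K →ₗ[ℂ] A ⊗[ℂ] K}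
  {δP : P →ₗ[ℂ] A ⊗[ℂ] P} {δQ : Q →ₗ[ℂ] A ⊗[ℂ] Q}
  {mul : A ⊗[ℂ] A →ₗ[ℂ] A} {γ : A ⊗[ℂ] A →ₗ[ℂ] ℂ}

/-- The functional `γ(g₍₁₎ ⊗ h₍₁₎) γ(g₍₂₎ h₍₂₎ ⊗ k)` on `(A ⊗ A) ⊗ A`. -/
def cocycleLeft (mul : A ⊗[ℂ] A →ₗ[ℂ] A) (γ : A ⊗[ℂ] A →ₗ[ℂ] ℂ) : (A ⊗[ℂ] A) ⊗[ℂ] A →ₗ[ℂ] ℂ :=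
  convL (funTensor γ Coalgebra.counit) (γ ∘ₗ TensorProduct.map mul LinearMap.id)

/-- The functional `γ(h₍₁₎ ⊗ k₍₁₎) γ(g ⊗ h₍₂₎ k₍₂₎)` on `A ⊗ (A ⊗ A)`. -/
def cocycleRight (mul : A ⊗[ℂ] A →ₗ[ℂ] A) (γ : A ⊗[ℂ] A →ₗ[ℂ] ℂ) : A ⊗[ℂ] (A ⊗[ℂ] A) →ₗ[ℂ] ℂ :=
  convL (funTensor Coalgebra.counit γ) (γ ∘ₗ TensorProduct.map LinearMap.id mul)

/-- The cocycle condition as an identity of functionals on `(A ⊗ A) ⊗ A`. -/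
def IsCocycle (mul : A ⊗[ℂ] A →ₗ[ℂ] A) (γ : A ⊗[ℂ] A →ₗ[ℂ] ℂ) : Prop :=
  cocycleLeft mul γ = cocycleRight mul γ ∘ₗ (TensorProduct.assoc ℂ A A A).toLinearMap

/-- Twisting the product of the first two factors and then the product with the third one amounts
to a single action of `cocycleLeft` on `M ⊗ N ⊗ K`. -/
theorem act_cocycleLeft (hM : IsComodule δM) (hN : IsComodule δN) (hK : IsComodule δK)
    {μ : M ⊗[ℂ] N →ₗ[ℂ] P} (hμ : CovariantOver mul (pair δM δN) δP μ) (t : (M ⊗[ℂ] N) ⊗[ℂ] K) :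
    act (pair δP δK) γ (TensorProduct.map (μ ∘ₗ act (pair δM δN) γ) LinearMap.id t) =
      TensorProduct.map μ LinearMap.id (act (pair (pair δM δN) δK) (cocycleLeft mul γ) t) := by
  have h1 : act δK (Coalgebra.counit (R := ℂ)) = LinearMap.id := LinearMap.ext hK.counit
  rw [cocycleLeft, ← act_act ((hM.pair hN).pair hK), act_pair, h1,
    ← act_map (hμ.map (CovariantOver.id δK)), TensorProduct.map_map, LinearMap.comp_id]

/-- Twisting the product of the last two factors and then the product with the first one amounts
to a single action of `cocycleRight` on `M ⊗ N ⊗ K`. -/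
theorem act_cocycleRight (hM : IsComodule δM) (hN : IsComodule δN) (hK : IsComodule δK)
    {μ : N ⊗[ℂ] K →ₗ[ℂ] Q} (hμ : CovariantOver mul (pair δN δK) δQ μ) (t : M ⊗[ℂ] (N ⊗[ℂ] K)) :
    act (pair δM δQ) γ (TensorProduct.map LinearMap.id (μ ∘ₗ act (pair δN δK) γ) t) =
      TensorProduct.map LinearMap.id μ (act (pair δM (pair δN δK)) (cocycleRight mul γ) t) := by
  have h1 : act δM (Coalgebra.counit (R := ℂ)) = LinearMap.id := LinearMap.ext hM.counit
  rw [cocycleRight, ← act_act (hM.pair (hN.pair hK)), act_pair, h1,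
    ← act_map ((CovariantOver.id δM).map hμ), TensorProduct.map_map, LinearMap.comp_id]

/-- Twisting by a cocycle preserves associativity laws `(x y) z = x (y z)` between four bilinear
maps. Only the inner products have to be covariant. -/
theorem IsCocycle.twisted_assoc (hγ : IsCocycle mul γ) (hM : IsComodule δM) (hN : IsComodule δN)
    (hK : IsComodule δK) {μ₁ : M ⊗[ℂ] N →ₗ[ℂ] P} {μ₂ : P ⊗[ℂ] K →ₗ[ℂ] R}
    {μ₃ : N ⊗[ℂ] K →ₗ[ℂ] Q} {μ₄ : M ⊗[ℂ] Q →ₗ[ℂ] R}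
    (h₁ : CovariantOver mul (pair δM δN) δP μ₁) (h₃ : CovariantOver mul (pair δN δK) δQ μ₃)
    (hμ : ∀ x y z, μ₂ (μ₁ (x ⊗ₜ y) ⊗ₜ z) = μ₄ (x ⊗ₜ μ₃ (y ⊗ₜ z))) (x : M) (y : N) (z : K) :
    μ₂ (act (pair δP δK) γ (μ₁ (act (pair δM δN) γ (x ⊗ₜ y)) ⊗ₜ z)) =
      μ₄ (act (pair δM δQ) γ (x ⊗ₜ μ₃ (act (pair δN δK) γ (y ⊗ₜ z)))) := by
  have e1 := act_cocycleLeft (γ := γ) hM hN hK h₁ ((x ⊗ₜ y) ⊗ₜ z)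
  have e2 := act_cocycleRight (γ := γ) hM hN hK h₃ (x ⊗ₜ (y ⊗ₜ z))
  simp only [TensorProduct.map_tmul, LinearMap.comp_apply, LinearMap.id_apply] at e1 e2
  rw [e1, e2, hγ]
  have e3 := act_map (CovariantOver.assoc δM δN δK) (cocycleRight mul γ) ((x ⊗ₜ y) ⊗ₜ z)
  simp only [LinearEquiv.coe_coe, TensorProduct.assoc_tmul] at e3
  rw [e3]
  have e4 : μ₂ ∘ₗ TensorProduct.map μ₁ LinearMap.id =
      μ₄ ∘ₗ TensorProduct.map LinearMap.id μ₃ ∘ₗ (TensorProduct.assoc ℂ M N K).toLinearMap := by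
    ext x y z
    exact hμ x y z
  exact LinearMap.congr_fun e4 _

/-- The product of a comodule algebra twisted by a functional `γ` is covariant for the product of
`A` twisted by `γ` and its convolution inverse. -/
theorem CovariantOver.twist {γinv : A ⊗[ℂ] A →ₗ[ℂ] ℂ} (hγ : convL γinv γ = Coalgebra.counit)
    (hM : IsComodule δM) (hN : IsComodule δN) {μ : M ⊗[ℂ] N →ₗ[ℂ] P}
    (hμ : CovariantOver mul (pair δM δN) δP μ) :
    CovariantOver (convL γ (convR mul γinv)) (pair δM δN) δP (μ ∘ₗ act (pair δM δN) γ) := by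
  intro t
  have hMN := hM.pair hN
  have e : convL γ (convR mul γinv) = mul ∘ₗ act Coalgebra.comul γ ∘ₗ actR γinv := by
    ext x
    simp only [TensorProduct.AlgebraTensorModule.curry_apply, LinearMap.restrictScalars_self,
      TensorProduct.curry_apply]
    rw [convL_apply, convR_apply, actR_act]
    rfl
  have e2 : TensorProduct.map (convL γ (convR mul γinv)) (μ ∘ₗ act (pair δM δN) γ) =
      TensorProduct.map mul μ ∘ₗ TensorProduct.map (act Coalgebra.comul γ) LinearMap.id ∘ₗ
        TensorProduct.map LinearMap.id (act (pair δM δN) γ) ∘ₗ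
          TensorProduct.map (actR γinv) LinearMap.id := by
    rw [e, ← TensorProduct.map_comp, ← TensorProduct.map_comp, ← TensorProduct.map_comp]
    rfl
  rw [e2]
  simp only [LinearMap.comp_apply]
  rw [map_actR_coact hMN]
  have e3 : act (pair δM δN) γ ∘ₗ act (pair δM δN) γinv = LinearMap.id := by
    ext x
    simp only [TensorProduct.AlgebraTensorModule.curry_apply, LinearMap.restrictScalars_self,
      TensorProduct.curry_apply, LinearMap.comp_apply]
    rw [act_act hMN, hγ, act_counit hMN]
    rfl
  have e4 : ∀ s : (A ⊗[ℂ] A) ⊗[ℂ] (M ⊗[ℂ] N), TensorProduct.map LinearMap.id (act (pair δM δN) γ)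
      (TensorProduct.map LinearMap.id (act (pair δM δN) γinv) s) = s := by
    intro s
    rw [TensorProduct.map_map, e3, LinearMap.id_comp, TensorProduct.map_id, LinearMap.id_apply]
  rw [e4, hμ, coact_act hMN]

end TwistedAssoc

/-! ### Convolution with values in an algebra -/

section ConvAlgebra

variable {C D X : Type*} [AddCommGroup C] [Module ℂ C] [Coalgebra ℂ C]
  [AddCommGroup D] [Module ℂ D] [Coalgebra ℂ D] [AddCommGroup X] [Module ℂ X]

/-- `μ` is an associative product with two-sided unit `e`. -/
structure IsUnitalProduct (μ : X ⊗[ℂ] X →ₗ[ℂ] X) (e : X) : Prop where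
  assoc : ∀ x y z, μ (μ (x ⊗ₜ y) ⊗ₜ z) = μ (x ⊗ₜ μ (y ⊗ₜ z))
  one_mul : ∀ x, μ (e ⊗ₜ x) = x
  mul_one : ∀ x, μ (x ⊗ₜ e) = x

/-- The convolution product of two linear maps from a coalgebra to an algebra. -/
abbrev conv (μ : X ⊗[ℂ] X →ₗ[ℂ] X) (f g : C →ₗ[ℂ] X) : C →ₗ[ℂ] X :=
  convolve Coalgebra.comul μ f g

variable {μ : X ⊗[ℂ] X →ₗ[ℂ] X} {e : X}

theorem IsUnitalProduct.conv_assoc (h : IsUnitalProduct μ e) (f g k : C →ₗ[ℂ] X) :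
    conv μ (conv μ f g) k = conv μ f (conv μ g k) :=
  convolve_assoc (isComodule_comul C) μ μ μ μ h.assoc f g k

theorem IsUnitalProduct.smulRight_conv (h : IsUnitalProduct μ e) (φ : C →ₗ[ℂ] ℂ)
    (g : C →ₗ[ℂ] X) : conv μ (φ.smulRight e) g = convL φ g := by
  ext x
  simp only [convL, convolve, LinearMap.comp_apply]
  generalize Coalgebra.comul (R := ℂ) x = t
  induction t using TensorProduct.induction_on with
  | zero => simp
  | add s t hs ht => simp only [map_add, hs, ht]
  | tmul c m => simp [← TensorProduct.smul_tmul', h.one_mul]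

theorem IsUnitalProduct.conv_smulRight (h : IsUnitalProduct μ e) (φ : C →ₗ[ℂ] ℂ)
    (f : C →ₗ[ℂ] X) : conv μ f (φ.smulRight e) = f ∘ₗ actR φ := by
  ext x
  rw [LinearMap.comp_apply, ← convR_apply]
  simp only [convR, convolve, LinearMap.comp_apply]
  generalize Coalgebra.comul (R := ℂ) x = t
  induction t using TensorProduct.induction_on with
  | zero => simp
  | add s t hs ht => simp only [map_add, hs, ht]
  | tmul c m => simp [h.mul_one]

/-- The unit `c ↦ ε(c) e` of the convolution algebra. -/
abbrev convOne (C : Type*) [AddCommGroup C] [Module ℂ C] [Coalgebra ℂ C] (e : X) : C →ₗ[ℂ] X :=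
  (Coalgebra.counit (R := ℂ) (A := C)).smulRight e

theorem IsUnitalProduct.one_conv (h : IsUnitalProduct μ e) (g : C →ₗ[ℂ] X) :
    conv μ (convOne C e) g = g := by
  rw [h.smulRight_conv, counit_convL]

theorem IsUnitalProduct.conv_one (h : IsUnitalProduct μ e) (g : C →ₗ[ℂ] X) :
    conv μ g (convOne C e) = g := by
  rw [h.conv_smulRight]
  ext x
  rw [LinearMap.comp_apply, actR_counit]

theorem IsUnitalProduct.left_inv_eq_right_inv (h : IsUnitalProduct μ e) {f g k : C →ₗ[ℂ] X}
    (h₁ : conv μ f g = convOne C e) (h₂ : conv μ g k = convOne C e) : f = k := by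
  rw [← h.conv_one f, ← h₂, ← h.conv_assoc, h₁, h.one_conv]

theorem IsUnitalProduct.conv_mul_inv (h : IsUnitalProduct μ e) {f f' g g' : C →ₗ[ℂ] X}
    (h₁ : conv μ f f' = convOne C e) (h₂ : conv μ g g' = convOne C e) :
    conv μ (conv μ f g) (conv μ g' f') = convOne C e := by
  rw [h.conv_assoc, ← h.conv_assoc g, h₂, h.one_conv, h₁]

theorem conv_comp {g : C →ₗ[ℂ] D} (hg : IsCoalgMap g) (f k : D →ₗ[ℂ] X) :
    conv μ f k ∘ₗ g = conv μ (f ∘ₗ g) (k ∘ₗ g) :=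
  convolve_comp hg.comul μ f k

theorem convOne_comp {g : C →ₗ[ℂ] D} (hg : IsCoalgMap g) :
    convOne D e ∘ₗ g = convOne C e := by
  ext x
  simp [hg.counit]

variable (C) in
/-- The coalgebra map `c ⊗ d ↦ ε(d) c`. -/
def tensorFst : C ⊗[ℂ] C →ₗ[ℂ] C :=
  (TensorProduct.rid ℂ C).toLinearMap ∘ₗ (Coalgebra.counit (R := ℂ)).lTensor C

variable (C) in
/-- The coalgebra map `c ⊗ d ↦ ε(c) d`. -/
def tensorSnd : C ⊗[ℂ] C →ₗ[ℂ] C :=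
  (TensorProduct.lid ℂ C).toLinearMap ∘ₗ (Coalgebra.counit (R := ℂ)).rTensor C

/-- `x = (id ⊗ ε)(x₍₁₎) ⊗ (ε ⊗ id)(x₍₂₎)` for `x ∈ C ⊗ C`. -/
theorem map_fst_snd_comul :
    TensorProduct.map (tensorFst C) (tensorSnd C) ∘ₗ Coalgebra.comul (R := ℂ) = LinearMap.id := by
  ext c d
  have h1 : actR Coalgebra.counit c = c := actR_counit c
  have h2 := act_counit (isComodule_comul C) d
  simp only [TensorProduct.AlgebraTensorModule.curry_apply, LinearMap.restrictScalars_self,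
    TensorProduct.curry_apply, LinearMap.comp_apply, LinearMap.id_apply]
  rw [comul_tensor, pair_tmul]
  refine Eq.trans ?_ (congrArg₂ (fun x y => x ⊗ₜ[ℂ] y) h1 h2)
  simp only [actR, convR, act, LinearMap.comp_apply]
  generalize Coalgebra.comul (R := ℂ) c = x
  generalize Coalgebra.comul (R := ℂ) d = y
  have : TensorProduct.map (tensorFst C) (tensorSnd C) ∘ₗ
      (TensorProduct.tensorTensorTensorComm ℂ C C C C).toLinearMap =
      TensorProduct.map ((TensorProduct.rid ℂ C).toLinearMap ∘ₗ
          TensorProduct.map LinearMap.id (Coalgebra.counit (R := ℂ)))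
        ((TensorProduct.lid ℂ C).toLinearMap ∘ₗ (Coalgebra.counit (R := ℂ)).rTensor C) := by
    ext c m d n
    simp [tensorFst, tensorSnd, TensorProduct.smul_tmul', TensorProduct.tmul_smul, smul_smul,
      mul_comm]
  exact LinearMap.congr_fun this (x ⊗ₜ y)

theorem tensorFst_comp_comm :
    tensorFst C ∘ₗ (TensorProduct.comm ℂ C C).toLinearMap = tensorSnd C := by
  ext; simp [tensorFst, tensorSnd]

theorem tensorSnd_comp_comm :
    tensorSnd C ∘ₗ (TensorProduct.comm ℂ C C).toLinearMap = tensorFst C := by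
  ext; simp [tensorFst, tensorSnd]

variable (C) in
theorem isCoalgMap_tensorSnd : IsCoalgMap (tensorSnd C) where
  comul x := by
    have : Coalgebra.comul (R := ℂ) ∘ₗ tensorSnd C =
        TensorProduct.map (tensorSnd C) (tensorSnd C) ∘ₗ Coalgebra.comul (R := ℂ) := by
      ext c d
      simp only [TensorProduct.AlgebraTensorModule.curry_apply, LinearMap.restrictScalars_self,
        TensorProduct.curry_apply, LinearMap.comp_apply]
      rw [comul_tensor, pair_tmul]
      have h1 : (Coalgebra.counit (R := ℂ) c : ℂ) =
          funTensor (Coalgebra.counit (R := ℂ)) (Coalgebra.counit (R := ℂ))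
            (Coalgebra.comul (R := ℂ) c) := by
        conv_lhs => rw [← counit_convL (Coalgebra.counit (R := ℂ) (A := C))]
        rfl
      simp only [tensorSnd, LinearMap.comp_apply, LinearMap.rTensor_tmul, LinearEquiv.coe_coe,
        TensorProduct.lid_tmul, map_smul]
      rw [h1]
      generalize Coalgebra.comul (R := ℂ) c = x
      generalize Coalgebra.comul (R := ℂ) d = y
      induction x using TensorProduct.induction_on with
      | zero => simp
      | add s t hs ht => simp only [TensorProduct.add_tmul, map_add, add_smul, hs, ht]
      | tmul c c' =>
        induction y using TensorProduct.induction_on with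
        | zero => simp
        | add s t hs ht =>
          simp only [TensorProduct.tmul_add, map_add, smul_add, hs, ht]
        | tmul d d' => simp [TensorProduct.smul_tmul', TensorProduct.tmul_smul, smul_smul, mul_comm]
    exact LinearMap.congr_fun this x
  counit x := by
    induction x using TensorProduct.induction_on with
    | zero => simp
    | add s t hs ht => simp only [map_add, hs, ht]
    | tmul c m => simp [tensorSnd, mul_comm]

variable (C) in
theorem isCoalgMap_tensorFst : IsCoalgMap (tensorFst C) := by
  rw [← tensorSnd_comp_comm]
  exact ⟨(isCoalgMap_tensorSnd C).comul.comp (isCoalgMap_comm C C).comul, fun x => by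
    rw [LinearMap.comp_apply, (isCoalgMap_tensorSnd C).counit, (isCoalgMap_comm C C).counit]⟩

/-- In the convolution algebra of maps out of `C ⊗ C`, a map `c ⊗ d ↦ f(c) g(d)` is the product of
`c ⊗ d ↦ f(c) ε(d)` and `c ⊗ d ↦ ε(c) g(d)`. -/
theorem conv_fst_snd (f g : C →ₗ[ℂ] X) :
    conv μ (f ∘ₗ tensorFst C) (g ∘ₗ tensorSnd C) = μ ∘ₗ TensorProduct.map f g := by
  rw [conv, ← convolve_map]
  simp only [convolve, LinearMap.comp_assoc]
  rw [map_fst_snd_comul, LinearMap.comp_id]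

theorem conv_snd_fst (f g : C →ₗ[ℂ] X) :
    conv μ (f ∘ₗ tensorSnd C) (g ∘ₗ tensorFst C) =
      μ ∘ₗ TensorProduct.map f g ∘ₗ (TensorProduct.comm ℂ C C).toLinearMap := by
  rw [← LinearMap.comp_assoc, ← conv_fst_snd, conv_comp (isCoalgMap_comm C C), LinearMap.comp_assoc,
    LinearMap.comp_assoc, tensorFst_comp_comm, tensorSnd_comp_comm]

end ConvAlgebra

/-! ### Hopf star-algebras -/

section Anti

variable {C D X : Type*} [AddCommGroup C] [Module ℂ C] [Coalgebra ℂ C]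
  [AddCommGroup D] [Module ℂ D] [Coalgebra ℂ D] [AddCommGroup X] [Module ℂ X]

/-- Linear maps that reverse the coproduct. -/
def IsAntiCoalgMap (g : C →ₗ[ℂ] D) : Prop :=
  ∀ x, Coalgebra.comul (R := ℂ) (g x) =
    TensorProduct.map g g (TensorProduct.comm ℂ C C (Coalgebra.comul (R := ℂ) x))

theorem IsAntiCoalgMap.convL_comp {g : C →ₗ[ℂ] D} (hg : IsAntiCoalgMap g) (φ ψ : D →ₗ[ℂ] ℂ) :
    convL φ ψ ∘ₗ g = convL (ψ ∘ₗ g) (φ ∘ₗ g) := by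
  ext x
  simp only [convL, LinearMap.comp_apply, hg x]
  generalize Coalgebra.comul (R := ℂ) x = t
  induction t using TensorProduct.induction_on with
  | zero => simp
  | add s t hs ht => simp only [map_add, hs, ht]
  | tmul c m => simp [mul_comm]

theorem IsAntiCoalgMap.map {g : C →ₗ[ℂ] C} (hg : IsAntiCoalgMap g) :
    IsAntiCoalgMap (TensorProduct.map g g) := by
  intro x
  induction x using TensorProduct.induction_on with
  | zero => simp
  | add s t hs ht => simp only [map_add, hs, ht]
  | tmul c d =>
    rw [comul_tensor, TensorProduct.map_tmul, pair_tmul, pair_tmul, hg, hg]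
    generalize Coalgebra.comul (R := ℂ) c = x
    generalize Coalgebra.comul (R := ℂ) d = y
    induction x using TensorProduct.induction_on with
    | zero => simp
    | add s t hs ht => simp only [TensorProduct.add_tmul, map_add, hs, ht]
    | tmul c c' =>
      induction y using TensorProduct.induction_on with
      | zero => simp
      | add s t hs ht => simp only [TensorProduct.tmul_add, map_add, hs, ht]
      | tmul d d' => simp

end Anti

open UnitaryTwoCocycle (antipodeInv)

@[simp] theorem antipodeInv_apply {A : Type*} [AddCommGroup A] [Module ℂ A] {H : HopfStarOps A}
    (a : A) : antipodeInv H a = H.star (H.antipode (H.star a)) := rfl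

section Hopf

variable {A : Type*} [AddCommGroup A] [Module ℂ A] [Coalgebra ℂ A] {H : HopfStarOps A}

namespace IsHopfStarAlgebra

theorem isUnitalProduct (hH : IsHopfStarAlgebra H) : IsUnitalProduct H.mul H.one :=
  ⟨hH.mul_assoc, hH.one_mul, hH.mul_one⟩

theorem isCoalgMap_mul (hH : IsHopfStarAlgebra H) : IsCoalgMap H.mul where
  comul := hH.comul_mul
  counit x := by
    induction x using TensorProduct.induction_on with
    | zero => simp
    | add s t hs ht => simp only [map_add, hs, ht]
    | tmul a b => simp [hH.counit_mul, mul_comm]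

theorem covariantOver_mul (hH : IsHopfStarAlgebra H) :
    CovariantOver H.mul (pair (Coalgebra.comul (R := ℂ)) (Coalgebra.comul (R := ℂ)))
      (Coalgebra.comul (R := ℂ)) H.mul := by
  rw [← comul_tensor]
  exact hH.comul_mul

theorem conv_antipode_id (hH : IsHopfStarAlgebra H) :
    conv H.mul H.antipode LinearMap.id = convOne A H.one := LinearMap.ext hH.antipode_mul

theorem conv_id_antipode (hH : IsHopfStarAlgebra H) :
    conv H.mul LinearMap.id H.antipode = convOne A H.one := LinearMap.ext hH.mul_antipode

/-- The antipode reverses products: both sides are convolution inverses of the product. -/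
theorem antipode_mul_rev (hH : IsHopfStarAlgebra H) (a b : A) :
    H.antipode (H.mul (a ⊗ₜ b)) = H.mul (H.antipode b ⊗ₜ H.antipode a) := by
  have hu := hH.isUnitalProduct
  have h1 : conv H.mul (H.antipode ∘ₗ H.mul) H.mul = convOne (A ⊗[ℂ] A) H.one := by
    have := conv_comp (μ := H.mul) hH.isCoalgMap_mul H.antipode LinearMap.id
    rw [LinearMap.id_comp] at this
    rw [← this, hH.conv_antipode_id, convOne_comp hH.isCoalgMap_mul]
  have h2 : conv H.mul H.mul (H.mul ∘ₗ TensorProduct.map H.antipode H.antipode ∘ₗ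
      (TensorProduct.comm ℂ A A).toLinearMap) = convOne (A ⊗[ℂ] A) H.one := by
    have e := conv_fst_snd (μ := H.mul) (LinearMap.id : A →ₗ[ℂ] A) LinearMap.id
    rw [TensorProduct.map_id, LinearMap.comp_id] at e
    rw [← conv_snd_fst]
    have e1 := hu.conv_mul_inv (C := A ⊗[ℂ] A) (f := LinearMap.id ∘ₗ tensorFst A)
      (f' := H.antipode ∘ₗ tensorFst A) (g := LinearMap.id ∘ₗ tensorSnd A)
      (g' := H.antipode ∘ₗ tensorSnd A)
      (by rw [← conv_comp (isCoalgMap_tensorFst A), hH.conv_id_antipode,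
        convOne_comp (isCoalgMap_tensorFst A)])
      (by rw [← conv_comp (isCoalgMap_tensorSnd A), hH.conv_id_antipode,
        convOne_comp (isCoalgMap_tensorSnd A)])
    rwa [e] at e1
  exact LinearMap.congr_fun (hu.left_inv_eq_right_inv h1 h2) (a ⊗ₜ b)

/-- The antipode reverses coproducts: both sides are convolution inverses of the coproduct. -/
theorem isAntiCoalgMap_antipode (hH : IsHopfStarAlgebra H) : IsAntiCoalgMap H.antipode := by
  let μ : (A ⊗[ℂ] A) ⊗[ℂ] (A ⊗[ℂ] A) →ₗ[ℂ] A ⊗[ℂ] A :=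
    TensorProduct.map H.mul H.mul ∘ₗ (TensorProduct.tensorTensorTensorComm ℂ A A A A).toLinearMap
  have μ_tmul : ∀ a b c d, μ ((a ⊗ₜ b) ⊗ₜ (c ⊗ₜ d)) = H.mul (a ⊗ₜ c) ⊗ₜ H.mul (b ⊗ₜ d) :=
    fun _ _ _ _ => rfl
  have hu : IsUnitalProduct μ (H.one ⊗ₜ H.one) := by
    refine ⟨fun x y z => ?_, fun x => ?_, fun x => ?_⟩
    · induction x using TensorProduct.induction_on with
      | zero => simp
      | add s t hs ht => simp only [TensorProduct.add_tmul, map_add, hs, ht]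
      | tmul a a' =>
        induction y using TensorProduct.induction_on with
        | zero => simp
        | add s t hs ht =>
          simp only [TensorProduct.add_tmul, TensorProduct.tmul_add, map_add, hs, ht]
        | tmul b b' =>
          induction z using TensorProduct.induction_on with
          | zero => simp
          | add s t hs ht => simp only [TensorProduct.tmul_add, map_add, hs, ht]
          | tmul c c' => simp only [μ_tmul, hH.mul_assoc]
    · induction x using TensorProduct.induction_on with
      | zero => simp
      | add s t hs ht => simp only [TensorProduct.tmul_add, map_add, hs, ht]
      | tmul a a' => rw [μ_tmul, hH.one_mul, hH.one_mul]
    · induction x using TensorProduct.induction_on with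
      | zero => simp
      | add s t hs ht => simp only [TensorProduct.add_tmul, map_add, hs, ht]
      | tmul a a' => rw [μ_tmul, hH.mul_one, hH.mul_one]
  let i₁ : A →ₗ[ℂ] A ⊗[ℂ] A := (TensorProduct.mk ℂ A A).flip H.one
  let i₂ : A →ₗ[ℂ] A ⊗[ℂ] A := TensorProduct.mk ℂ A A H.one
  have hcomul : Coalgebra.comul (R := ℂ) (A := A) = conv μ i₁ i₂ := by
    have : μ ∘ₗ TensorProduct.map i₁ i₂ = LinearMap.id := by
      ext a b
      simp [i₁, i₂, μ_tmul, hH.one_mul, hH.mul_one]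
    rw [conv, convolve, ← LinearMap.comp_assoc, this, LinearMap.id_comp]
  have h1 : conv μ (Coalgebra.comul (R := ℂ) ∘ₗ H.antipode) (Coalgebra.comul (R := ℂ)) =
      convOne A (H.one ⊗ₜ H.one) := by
    have e : Coalgebra.comul (R := ℂ) ∘ₗ H.mul =
        μ ∘ₗ TensorProduct.map (Coalgebra.comul (R := ℂ)) (Coalgebra.comul (R := ℂ)) := by
      ext a b
      exact hH.comul_mul (a ⊗ₜ b)
    have := comp_convolve (Coalgebra.comul (R := ℂ)) H.mul H.antipode LinearMap.id
      (Coalgebra.comul (R := ℂ))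
    rw [e, convolve_map, LinearMap.comp_id] at this
    rw [conv, ← this]
    ext a
    exact (congrArg (Coalgebra.comul (R := ℂ)) (LinearMap.congr_fun hH.conv_antipode_id a)).trans
      (by simp [hH.comul_one])
  have e1 : conv μ i₁ (i₁ ∘ₗ H.antipode) = convOne A (H.one ⊗ₜ H.one) := by
    have e : μ ∘ₗ TensorProduct.map i₁ i₁ = i₁ ∘ₗ H.mul := by
      ext a b
      simp [i₁, μ_tmul, hH.one_mul]
    have e' := convolve_map Coalgebra.comul μ LinearMap.id H.antipode i₁ i₁
    rw [e, LinearMap.comp_id] at e'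
    rw [conv, ← e', ← comp_convolve, ← conv, hH.conv_id_antipode]
    ext a
    simp [i₁, TensorProduct.smul_tmul']
  have e2 : conv μ i₂ (i₂ ∘ₗ H.antipode) = convOne A (H.one ⊗ₜ H.one) := by
    have e : μ ∘ₗ TensorProduct.map i₂ i₂ = i₂ ∘ₗ H.mul := by
      ext a b
      simp [i₂, μ_tmul, hH.one_mul]
    have e' := convolve_map Coalgebra.comul μ LinearMap.id H.antipode i₂ i₂
    rw [e, LinearMap.comp_id] at e'
    rw [conv, ← e', ← comp_convolve, ← conv, hH.conv_id_antipode]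
    ext a
    simp [i₂]
  have h2 := hu.conv_mul_inv e1 e2
  rw [← hcomul] at h2
  have h3 := hu.left_inv_eq_right_inv h1 h2
  intro a
  refine (LinearMap.congr_fun h3 a).trans ?_
  simp only [convolve, LinearMap.comp_apply]
  generalize Coalgebra.comul (R := ℂ) a = t
  induction t using TensorProduct.induction_on with
  | zero => simp
  | add s t hs ht => simp only [map_add, hs, ht]
  | tmul a b => simp [i₁, i₂, μ_tmul, hH.one_mul, hH.mul_one]

theorem star_one (hH : IsHopfStarAlgebra H) : H.star H.one = H.one := by
  have h := hH.star_mul (H.star H.one) H.one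
  rwa [hH.mul_one, hH.star_star, hH.mul_one, eq_comm] at h

theorem counit_star (hH : IsHopfStarAlgebra H) (a : A) :
    Coalgebra.counit (R := ℂ) (H.star a) = starRingEnd ℂ (Coalgebra.counit (R := ℂ) a) := by
  let ε' : A →ₗ[ℂ] ℂ := (starLinearEquiv ℂ (A := ℂ)).toLinearMap.comp
    ((Coalgebra.counit (R := ℂ)).comp H.star)
  have h : ∀ a, act Coalgebra.comul ε' a = a := by
    intro a
    have e := (isComodule_comul A).counit (H.star a)
    rw [hH.comul_star] at e
    apply (Function.LeftInverse.injective hH.star_star)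
    rw [← e, act, LinearMap.comp_apply, LinearMap.comp_apply]
    generalize Coalgebra.comul (R := ℂ) a = t
    induction t using TensorProduct.induction_on with
    | zero => simp
    | add s t hs ht => simp only [map_add, hs, ht]
    | tmul a b => simp [ε']
  have e := counit_act ε' a
  rw [h a] at e
  rw [e]
  simp [ε']

theorem counit_antipode (hH : IsHopfStarAlgebra H) (a : A) :
    Coalgebra.counit (R := ℂ) (H.antipode a) = Coalgebra.counit (R := ℂ) a := by
  have h := congrArg (Coalgebra.counit (R := ℂ)) (hH.antipode_mul a)
  rw [map_smul, hH.counit_one, smul_eq_mul, mul_one, hH.isCoalgMap_mul.counit, counit_tensor] at h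
  rw [← h]
  have e := LinearMap.congr_fun (convL_counit (Coalgebra.counit (R := ℂ) ∘ₗ H.antipode)) a
  rw [LinearMap.comp_apply] at e
  rw [← e]
  simp only [convL, LinearMap.comp_apply]
  generalize Coalgebra.comul (R := ℂ) a = t
  induction t using TensorProduct.induction_on with
  | zero => simp
  | add s t hs ht => simp only [map_add, hs, ht]
  | tmul a b => simp

/-- `S ∘ S⁻¹ = id`: the map `S ∘ S⁻¹` is another right convolution inverse of `S`. -/
theorem antipode_antipodeInv (hH : IsHopfStarAlgebra H) (a : A) :
    H.antipode (antipodeInv H a) = a := by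
  have hu := hH.isUnitalProduct
  have hS1 : H.antipode H.one = H.one := by
    have := hH.antipode_mul H.one
    rwa [hH.comul_one, LinearMap.rTensor_tmul, hH.mul_one, hH.counit_one, one_smul] at this
  have h2 : conv H.mul H.antipode (H.antipode ∘ₗ antipodeInv H) = convOne A H.one := by
    ext a
    have e := congrArg (fun x => H.antipode (H.star x)) (hH.mul_antipode (H.star a))
    simp only [map_smulₛₗ, hH.counit_star, hH.star_one, hS1, RingHomCompTriple.comp_apply] at e
    refine Eq.trans ?_ (e.trans (by simp))
    rw [hH.comul_star]
    simp only [convolve, LinearMap.comp_apply]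
    generalize Coalgebra.comul (R := ℂ) a = t
    induction t using TensorProduct.induction_on with
    | zero => simp
    | add s t hs ht => simp only [map_add, hs, ht]
    | tmul a b => simp [hH.star_mul, hH.antipode_mul_rev, hH.star_star]
  have h3 : conv H.mul LinearMap.id H.antipode = convOne A H.one := hH.conv_id_antipode
  exact (LinearMap.congr_fun (hu.left_inv_eq_right_inv h3 h2) a).symm

theorem antipode_star_antipode (hH : IsHopfStarAlgebra H) (a : A) :
    H.antipode (H.star (H.antipode a)) = H.star a := by
  have := hH.antipode_antipodeInv (H.star a)
  rwa [antipodeInv_apply, hH.star_star] at this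

theorem isAntiCoalgMap_antipodeInv (hH : IsHopfStarAlgebra H) :
    IsAntiCoalgMap (antipodeInv H) := by
  intro a
  rw [antipodeInv_apply, hH.comul_star, hH.isAntiCoalgMap_antipode, hH.comul_star]
  generalize Coalgebra.comul (R := ℂ) a = t
  induction t using TensorProduct.induction_on with
  | zero => simp
  | add s t hs ht => simp only [map_add, hs, ht]
  | tmul a b => simp

theorem counit_antipodeInv (hH : IsHopfStarAlgebra H) (a : A) :
    Coalgebra.counit (R := ℂ) (antipodeInv H a) = Coalgebra.counit (R := ℂ) a := by
  rw [antipodeInv_apply, hH.counit_star, hH.counit_antipode, hH.counit_star]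
  simp

theorem counit_comp_map_antipodeInv (hH : IsHopfStarAlgebra H) :
    Coalgebra.counit (R := ℂ) ∘ₗ TensorProduct.map (antipodeInv H) (antipodeInv H) =
      Coalgebra.counit (R := ℂ) := by
  ext a b
  have h1 := hH.counit_antipodeInv a
  have h2 := hH.counit_antipodeInv b
  rw [antipodeInv_apply] at h1 h2
  simp [h1, h2]

end IsHopfStarAlgebra

end Hopf

/-! ### Functionals acting on `a₍₁₎ ⊗ S(a₍₂₎)` and `S(a₍₁₎) ⊗ a₍₂₎` -/

section Antipode

variable {A : Type*} [AddCommGroup A] [Module ℂ A] [Coalgebra ℂ A] {H : HopfStarOps A}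

/-- `a ↦ a₍₁₎ ⊗ S(a₍₂₎)`. -/
def antR (H : HopfStarOps A) : A →ₗ[ℂ] A ⊗[ℂ] A := H.antipode.lTensor A ∘ₗ Coalgebra.comul

/-- `a ↦ S(a₍₁₎) ⊗ a₍₂₎`. -/
def antL (H : HopfStarOps A) : A →ₗ[ℂ] A ⊗[ℂ] A := H.antipode.rTensor A ∘ₗ Coalgebra.comul

/-- The coproduct of `a₍₁₎ ⊗ S(a₍₂₎)` is `(a₍₁₎ ⊗ S(a₍₄₎)) ⊗ (a₍₂₎ ⊗ S(a₍₃₎))`. -/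
theorem comul_antR (hH : IsHopfStarAlgebra H) (a : A) :
    Coalgebra.comul (R := ℂ) (antR H a) =
      convolve Coalgebra.comul ((TensorProduct.tensorTensorTensorComm ℂ A A A A).toLinearMap ∘ₗ
        TensorProduct.map LinearMap.id (TensorProduct.map H.antipode H.antipode ∘ₗ
          (TensorProduct.comm ℂ A A).toLinearMap)) Coalgebra.comul Coalgebra.comul a := by
  simp only [antR, convolve, LinearMap.comp_apply]
  generalize Coalgebra.comul (R := ℂ) a = t
  induction t using TensorProduct.induction_on with
  | zero => simp
  | add s t hs ht => simp only [map_add, hs, ht]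
  | tmul a b =>
    rw [comul_tensor, LinearMap.lTensor_tmul, pair_tmul, hH.isAntiCoalgMap_antipode]
    rfl

/-- The coproduct of `S(a₍₁₎) ⊗ a₍₂₎` is `(S(a₍₂₎) ⊗ a₍₃₎) ⊗ (S(a₍₁₎) ⊗ a₍₄₎)`. -/
theorem comul_antL (hH : IsHopfStarAlgebra H) (a : A) :
    Coalgebra.comul (R := ℂ) (antL H a) =
      convolve Coalgebra.comul ((TensorProduct.tensorTensorTensorComm ℂ A A A A).toLinearMap ∘ₗ
        TensorProduct.map (TensorProduct.map H.antipode H.antipode ∘ₗ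
          (TensorProduct.comm ℂ A A).toLinearMap) LinearMap.id)
        Coalgebra.comul Coalgebra.comul a := by
  simp only [antL, convolve, LinearMap.comp_apply]
  generalize Coalgebra.comul (R := ℂ) a = t
  induction t using TensorProduct.induction_on with
  | zero => simp
  | add s t hs ht => simp only [map_add, hs, ht]
  | tmul a b =>
    rw [comul_tensor, LinearMap.rTensor_tmul, pair_tmul, hH.isAntiCoalgMap_antipode]
    rfl

/-- In `a₍₁₎ ⊗ a₍₂₎ ⊗ a₍₃₎ ⊗ a₍₄₎` the functional `ψ` may be applied to the two inner legs first. -/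
theorem convolve_inner (ψ : A ⊗[ℂ] A →ₗ[ℂ] ℂ) {X : Type*} [AddCommGroup X] [Module ℂ X]
    (ν : A ⊗[ℂ] A →ₗ[ℂ] X) (F : (A ⊗[ℂ] A) ⊗[ℂ] (A ⊗[ℂ] A) →ₗ[ℂ] X)
    (hF : ∀ a b c d, F ((a ⊗ₜ b) ⊗ₜ (c ⊗ₜ d)) = ψ (b ⊗ₜ c) • ν (a ⊗ₜ d)) :
    convolve Coalgebra.comul F (Coalgebra.comul (R := ℂ)) (Coalgebra.comul (R := ℂ)) =
      convolve Coalgebra.comul ν LinearMap.id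
        (act Coalgebra.comul (ψ ∘ₗ Coalgebra.comul (R := ℂ))) := by
  let μ : A ⊗[ℂ] (A ⊗[ℂ] A) →ₗ[ℂ] A := (TensorProduct.lid ℂ A).toLinearMap ∘ₗ ψ.rTensor A ∘ₗ
    (TensorProduct.assoc ℂ A A A).symm.toLinearMap
  have h1 := convolve_assoc (isComodule_comul A) LinearMap.id F μ ν (fun a b z => by
    induction z using TensorProduct.induction_on with
    | zero => simp
    | add s t hs ht => simp only [TensorProduct.tmul_add, map_add, hs, ht]
    | tmul c d => simp [μ, hF]) LinearMap.id LinearMap.id (Coalgebra.comul (R := ℂ))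
  have h2 := convolve_assoc (isComodule_comul A) ψ (TensorProduct.lid ℂ A).toLinearMap
    LinearMap.id μ (fun a b c => by simp [μ]) LinearMap.id LinearMap.id LinearMap.id
  rw [convolve_id] at h1 h2
  rw [h1, ← h2]
  have h3 : convolve Coalgebra.comul ψ LinearMap.id LinearMap.id =
      ψ ∘ₗ Coalgebra.comul (R := ℂ) := by
    rw [convolve, TensorProduct.map_id, LinearMap.id_comp]
  rw [h3, act_eq_convolve]

/-- In `a₍₁₎ ⊗ a₍₂₎ ⊗ a₍₃₎ ⊗ a₍₄₎` the two inner legs cancel under a pairing `ν` with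
`ν(a₍₁₎ ⊗ a₍₂₎) = ε(a) e`. -/
theorem convolve_outer (ψ : A ⊗[ℂ] A →ₗ[ℂ] ℂ) {X : Type*} [AddCommGroup X] [Module ℂ X] (e : X)
    (ν : A ⊗[ℂ] A →ₗ[ℂ] X) (hν : ν ∘ₗ Coalgebra.comul (R := ℂ) = convOne A e)
    (F : (A ⊗[ℂ] A) ⊗[ℂ] (A ⊗[ℂ] A) →ₗ[ℂ] X)
    (hF : ∀ a b c d, F ((a ⊗ₜ b) ⊗ₜ (c ⊗ₜ d)) = ψ (a ⊗ₜ d) • ν (b ⊗ₜ c)) :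
    convolve Coalgebra.comul F (Coalgebra.comul (R := ℂ)) (Coalgebra.comul (R := ℂ)) =
      (ψ ∘ₗ Coalgebra.comul (R := ℂ)).smulRight e := by
  let μ₃ : A ⊗[ℂ] (A ⊗[ℂ] A) →ₗ[ℂ] X ⊗[ℂ] A := ν.rTensor A ∘ₗ
    (TensorProduct.assoc ℂ A A A).symm.toLinearMap
  let μ₄ : A ⊗[ℂ] (X ⊗[ℂ] A) →ₗ[ℂ] X := (TensorProduct.lid ℂ X).toLinearMap ∘ₗ ψ.rTensor X ∘ₗ
    (TensorProduct.assoc ℂ A A X).symm.toLinearMap ∘ₗ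
      (TensorProduct.comm ℂ X A).toLinearMap.lTensor A
  have h1 := convolve_assoc (isComodule_comul A) LinearMap.id F μ₃ μ₄ (fun a b z => by
    induction z using TensorProduct.induction_on with
    | zero => simp
    | add s t hs ht => simp only [TensorProduct.tmul_add, map_add, hs, ht]
    | tmul c d => simp [μ₃, μ₄, hF]) LinearMap.id LinearMap.id (Coalgebra.comul (R := ℂ))
  have h2 := convolve_assoc (isComodule_comul A) ν LinearMap.id
    LinearMap.id μ₃ (fun a b c => by simp [μ₃]) LinearMap.id LinearMap.id LinearMap.id
  rw [convolve_id] at h1 h2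
  rw [h1, ← h2]
  have h3 : convolve Coalgebra.comul ν LinearMap.id LinearMap.id = convOne A e := by
    rw [convolve, TensorProduct.map_id, LinearMap.id_comp, hν]
  have h4 : convolve Coalgebra.comul LinearMap.id (convOne A e) LinearMap.id =
      TensorProduct.mk ℂ X A e := by
    ext a
    have := congrArg (TensorProduct.mk ℂ X A e) ((isComodule_comul A).counit a)
    refine Eq.trans ?_ this
    simp only [convolve, LinearMap.comp_apply]
    generalize Coalgebra.comul (R := ℂ) a = t
    induction t using TensorProduct.induction_on with
    | zero => simp
    | add s t hs ht => simp only [map_add, hs, ht]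
    | tmul a b => simp [TensorProduct.smul_tmul]
  rw [h3, h4]
  ext a
  simp only [convolve, LinearMap.comp_apply, LinearMap.smulRight_apply]
  generalize Coalgebra.comul (R := ℂ) a = t
  induction t using TensorProduct.induction_on with
  | zero => simp
  | add s t hs ht => simp only [map_add, hs, ht, add_smul]
  | tmul a b => simp [μ₄]

/-- Acting from the right on `a₍₁₎ ⊗ S(a₍₂₎)` evaluates `φ` on the two inner legs of
`(a₍₁₎ ⊗ S(a₍₄₎)) ⊗ (a₍₂₎ ⊗ S(a₍₃₎))`. -/
theorem actR_antR (hH : IsHopfStarAlgebra H) (φ : A ⊗[ℂ] A →ₗ[ℂ] ℂ) (a : A) :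
    actR φ (antR H a) = TensorProduct.map LinearMap.id
      (H.antipode ∘ₗ act Coalgebra.comul (φ ∘ₗ antR H)) (Coalgebra.comul (R := ℂ) a) := by
  have h := convolve_inner (φ ∘ₗ H.antipode.lTensor A)
    (TensorProduct.map LinearMap.id H.antipode)
    ((TensorProduct.rid ℂ (A ⊗[ℂ] A)).toLinearMap ∘ₗ TensorProduct.map LinearMap.id φ ∘ₗ
      (TensorProduct.tensorTensorTensorComm ℂ A A A A).toLinearMap ∘ₗ
        TensorProduct.map LinearMap.id (TensorProduct.map H.antipode H.antipode ∘ₗ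
          (TensorProduct.comm ℂ A A).toLinearMap)) (fun a b c d => by simp)
  have h' := LinearMap.congr_fun h a
  have e : actR φ (antR H a) = TensorProduct.rid ℂ (A ⊗[ℂ] A) (TensorProduct.map LinearMap.id φ
    (Coalgebra.comul (R := ℂ) (antR H a))) := rfl
  rw [e, comul_antR hH]
  refine Eq.trans h' ?_
  simp only [convolve, LinearMap.comp_apply, TensorProduct.map_map, LinearMap.comp_id]
  rfl

/-- Acting from the left on `S(a₍₁₎) ⊗ a₍₂₎` evaluates `φ` on the two inner legs of
`(S(a₍₂₎) ⊗ a₍₃₎) ⊗ (S(a₍₁₎) ⊗ a₍₄₎)`. -/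
theorem act_antL (hH : IsHopfStarAlgebra H) (φ : A ⊗[ℂ] A →ₗ[ℂ] ℂ) (a : A) :
    act Coalgebra.comul φ (antL H a) = TensorProduct.map H.antipode
      (act Coalgebra.comul (φ ∘ₗ antL H)) (Coalgebra.comul (R := ℂ) a) := by
  have h := convolve_inner (φ ∘ₗ H.antipode.rTensor A)
    (TensorProduct.map H.antipode LinearMap.id)
    ((TensorProduct.lid ℂ (A ⊗[ℂ] A)).toLinearMap ∘ₗ φ.rTensor (A ⊗[ℂ] A) ∘ₗ
      (TensorProduct.tensorTensorTensorComm ℂ A A A A).toLinearMap ∘ₗ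
        TensorProduct.map (TensorProduct.map H.antipode H.antipode ∘ₗ
          (TensorProduct.comm ℂ A A).toLinearMap) LinearMap.id) (fun a b c d => by simp)
  have h' := LinearMap.congr_fun h a
  have e : act Coalgebra.comul φ (antL H a) = TensorProduct.lid ℂ (A ⊗[ℂ] A)
    (φ.rTensor (A ⊗[ℂ] A) (Coalgebra.comul (R := ℂ) (antL H a))) := rfl
  rw [e, comul_antL hH]
  refine Eq.trans h' ?_
  simp only [convolve, LinearMap.comp_apply, TensorProduct.map_map, LinearMap.comp_id]
  rfl

/-- Acting from the left on `a₍₁₎ ⊗ S(a₍₂₎)` evaluates `φ` on the outer legs; the inner ones cancel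
in the product. -/
theorem mul_act_antR (hH : IsHopfStarAlgebra H) (φ : A ⊗[ℂ] A →ₗ[ℂ] ℂ) (a : A) :
    H.mul (act Coalgebra.comul φ (antR H a)) = φ (antR H a) • H.one := by
  have h := convolve_outer (φ ∘ₗ H.antipode.lTensor A) H.one (H.mul ∘ₗ H.antipode.lTensor A)
    hH.conv_id_antipode
    (H.mul ∘ₗ (TensorProduct.lid ℂ (A ⊗[ℂ] A)).toLinearMap ∘ₗ φ.rTensor (A ⊗[ℂ] A) ∘ₗ
      (TensorProduct.tensorTensorTensorComm ℂ A A A A).toLinearMap ∘ₗ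
        TensorProduct.map LinearMap.id (TensorProduct.map H.antipode H.antipode ∘ₗ
          (TensorProduct.comm ℂ A A).toLinearMap)) (fun a b c d => by simp)
  have e : act Coalgebra.comul φ (antR H a) = TensorProduct.lid ℂ (A ⊗[ℂ] A)
    (φ.rTensor (A ⊗[ℂ] A) (Coalgebra.comul (R := ℂ) (antR H a))) := rfl
  rw [e, comul_antR hH]
  exact LinearMap.congr_fun h a

/-- Acting from the right on `S(a₍₁₎) ⊗ a₍₂₎` evaluates `φ` on the outer legs; the inner ones cancel
in the product. -/
theorem mul_actR_antL (hH : IsHopfStarAlgebra H) (φ : A ⊗[ℂ] A →ₗ[ℂ] ℂ) (a : A) :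
    H.mul (actR φ (antL H a)) = φ (antL H a) • H.one := by
  have h := convolve_outer (φ ∘ₗ H.antipode.rTensor A) H.one (H.mul ∘ₗ H.antipode.rTensor A)
    hH.conv_antipode_id
    (H.mul ∘ₗ (TensorProduct.rid ℂ (A ⊗[ℂ] A)).toLinearMap ∘ₗ TensorProduct.map LinearMap.id φ ∘ₗ
      (TensorProduct.tensorTensorTensorComm ℂ A A A A).toLinearMap ∘ₗ
        TensorProduct.map (TensorProduct.map H.antipode H.antipode ∘ₗ
          (TensorProduct.comm ℂ A A).toLinearMap) LinearMap.id) (fun a b c d => by simp)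
  have e : actR φ (antL H a) = TensorProduct.rid ℂ (A ⊗[ℂ] A) (TensorProduct.map LinearMap.id φ
    (Coalgebra.comul (R := ℂ) (antL H a))) := rfl
  rw [e, comul_antL hH]
  exact LinearMap.congr_fun h a

end Antipode

/-! ### Cocycles -/

section CocycleFacts

variable {A : Type*} [AddCommGroup A] [Module ℂ A] [Coalgebra ℂ A] {H : HopfStarOps A}

theorem IsHopfStarAlgebra.isCoalgMap_one_tmul (hH : IsHopfStarAlgebra H) :
    IsCoalgMap (TensorProduct.mk ℂ A A H.one) where
  comul a := by
    rw [TensorProduct.mk_apply, comul_tensor, pair_tmul, hH.comul_one]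
    generalize Coalgebra.comul (R := ℂ) a = t
    induction t using TensorProduct.induction_on with
    | zero => simp
    | add s t hs ht => simp only [TensorProduct.tmul_add, map_add, hs, ht]
    | tmul a b => simp
  counit a := by simp [hH.counit_one]

theorem IsHopfStarAlgebra.isCoalgMap_tmul_one (hH : IsHopfStarAlgebra H) :
    IsCoalgMap ((TensorProduct.mk ℂ A A).flip H.one) where
  comul a := by
    rw [LinearMap.flip_apply, TensorProduct.mk_apply, comul_tensor, pair_tmul, hH.comul_one]
    generalize Coalgebra.comul (R := ℂ) a = t
    induction t using TensorProduct.induction_on with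
    | zero => simp
    | add s t hs ht => simp only [TensorProduct.add_tmul, map_add, hs, ht]
    | tmul a b => simp
  counit a := by simp [hH.counit_one]

namespace UnitaryTwoCocycle

variable (c : UnitaryTwoCocycle H)

theorem γ_comp_one_tmul : c.γ ∘ₗ TensorProduct.mk ℂ A A H.one = Coalgebra.counit :=
  LinearMap.ext c.unital_left

theorem γ_comp_tmul_one : c.γ ∘ₗ (TensorProduct.mk ℂ A A).flip H.one = Coalgebra.counit :=
  LinearMap.ext c.unital_right

theorem inv_comp_one_tmul (hH : IsHopfStarAlgebra H) :
    c.inv ∘ₗ TensorProduct.mk ℂ A A H.one = Coalgebra.counit := by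
  have h := hH.isCoalgMap_one_tmul.convL_comp c.inv c.γ
  rw [c.inv_mul, c.γ_comp_one_tmul, hH.isCoalgMap_one_tmul.counit_comp, convL_counit] at h
  exact h.symm

theorem inv_comp_tmul_one (hH : IsHopfStarAlgebra H) :
    c.inv ∘ₗ (TensorProduct.mk ℂ A A).flip H.one = Coalgebra.counit := by
  have h := hH.isCoalgMap_tmul_one.convL_comp c.inv c.γ
  rw [c.inv_mul, c.γ_comp_tmul_one, hH.isCoalgMap_tmul_one.counit_comp, convL_counit] at h
  exact h.symm

theorem isCocycle : IsCocycle H.mul c.γ := by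
  apply TensorProduct.ext_threefold
  intro g h k
  have e1 : act Coalgebra.comul (Coalgebra.counit (R := ℂ) (A := A)) = LinearMap.id :=
    LinearMap.ext (act_counit (isComodule_comul A))
  have e := c.cocycle g h k
  rw [convL_apply, convL_apply] at e
  rw [cocycleLeft, cocycleRight, LinearMap.comp_apply, convL_apply, act_funTensor, e1]
  simp only [LinearEquiv.coe_coe, TensorProduct.assoc_tmul]
  rw [convL_apply, act_funTensor, e1]
  exact e

theorem inv_convL_cocycleLeft (hH : IsHopfStarAlgebra H) :
    convL (convL (c.inv ∘ₗ TensorProduct.map H.mul LinearMap.id)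
      (funTensor c.inv Coalgebra.counit)) (cocycleLeft H.mul c.γ) = Coalgebra.counit := by
  have m1 : IsCoalgMap (TensorProduct.map H.mul (LinearMap.id : A →ₗ[ℂ] A)) :=
    hH.isCoalgMap_mul.map IsCoalgMap.id
  rw [cocycleLeft, convL_assoc, ← convL_assoc _ _ (c.γ ∘ₗ _), funTensor_convL, c.inv_mul,
    convL_counit, ← counit_tensor, counit_convL, ← m1.convL_comp, c.inv_mul, m1.counit_comp]

/-- `γ̄(g₍₁₎ h₍₁₎ ⊗ k) γ̄(g₍₂₎ ⊗ h₍₂₎) = γ̄(g ⊗ h₍₁₎ k₍₁₎) γ̄(h₍₂₎ ⊗ k₍₂₎)`, the cocycle condition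
for the convolution inverse. -/
theorem inv_cocycle (hH : IsHopfStarAlgebra H) :
    convL (c.inv ∘ₗ TensorProduct.map H.mul LinearMap.id) (funTensor c.inv Coalgebra.counit) =
      convL (c.inv ∘ₗ TensorProduct.map LinearMap.id H.mul) (funTensor Coalgebra.counit c.inv) ∘ₗ
        (TensorProduct.assoc ℂ A A A).toLinearMap := by
  have m2 : IsCoalgMap (TensorProduct.map (LinearMap.id : A →ₗ[ℂ] A) H.mul) :=
    IsCoalgMap.id.map hH.isCoalgMap_mul
  apply eq_of_convL_eq_counit (β := cocycleLeft H.mul c.γ)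
  · exact c.inv_convL_cocycleLeft hH
  · rw [c.isCocycle, ← (isCoalgMap_assoc A A).convL_comp, cocycleRight, convL_assoc,
      ← convL_assoc _ _ (funTensor _ _), ← m2.convL_comp, c.mul_inv, m2.counit_comp, counit_convL,
      funTensor_convL, c.mul_inv, convL_counit, ← counit_tensor, (isCoalgMap_assoc A A).counit_comp]

/-- The product `h k ↦ γ(h₍₁₎ ⊗ k₍₁₎) h₍₂₎ k₍₂₎` of the one-sided deformation of `A`. -/
def leftMul : A ⊗[ℂ] A →ₗ[ℂ] A := H.mul ∘ₗ act Coalgebra.comul c.γ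

theorem isUnitalProduct_leftMul (hH : IsHopfStarAlgebra H) :
    IsUnitalProduct c.leftMul H.one where
  assoc x y z := by
    have h := isComodule_comul A
    rw [leftMul, comul_tensor]
    exact c.isCocycle.twisted_assoc h h h hH.covariantOver_mul hH.covariantOver_mul hH.mul_assoc
      x y z
  one_mul x := by
    have h := hH.isCoalgMap_one_tmul.act c.γ x
    rw [c.γ_comp_one_tmul, act_counit (isComodule_comul A)] at h
    exact (congrArg H.mul h).trans (hH.one_mul x)
  mul_one x := by
    have h := hH.isCoalgMap_tmul_one.act c.γ x
    rw [c.γ_comp_tmul_one, act_counit (isComodule_comul A)] at h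
    exact (congrArg H.mul h).trans (hH.mul_one x)

/-- `a ↦ S(a₍₁₎) Ū(a₍₂₎)`, the convolution inverse of the identity for the product `leftMul`. -/
def leftInv : A →ₗ[ℂ] A := H.antipode ∘ₗ actR c.Ubar

theorem conv_leftInv_id (hH : IsHopfStarAlgebra H) :
    conv c.leftMul c.leftInv LinearMap.id = convOne A H.one := by
  ext a
  have e : conv c.leftMul c.leftInv LinearMap.id a = c.leftMul (TensorProduct.map H.antipode
      LinearMap.id (TensorProduct.map (actR c.Ubar) LinearMap.id
        (Coalgebra.comul (R := ℂ) a))) := by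
    rw [TensorProduct.map_map]
    rfl
  rw [e, map_actR_coact (isComodule_comul A), TensorProduct.map_map, LinearMap.id_comp,
    LinearMap.comp_id]
  have e2 := act_antL hH c.inv a
  rw [← (show c.Ubar = c.inv ∘ₗ antL H from rfl)] at e2
  rw [← e2, leftMul, LinearMap.comp_apply, act_act (isComodule_comul _), c.inv_mul,
    act_counit (isComodule_comul _)]
  exact hH.antipode_mul a

theorem leftMul_antR (hH : IsHopfStarAlgebra H) (a : A) :
    c.leftMul (antR H a) = c.U a • H.one := mul_act_antR hH c.γ a

/-- `Ū ⋆ U = ε`: for the product `leftMul`, the counit of `leftInv ⋆ id ⋆ S` is `Ū ⋆ U` on the one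
hand and `ε ∘ S = ε` on the other. -/
theorem Ubar_convL_U (hH : IsHopfStarAlgebra H) : convL c.Ubar c.U = Coalgebra.counit := by
  have hu := c.isUnitalProduct_leftMul hH
  have h1 : conv c.leftMul LinearMap.id H.antipode = c.U.smulRight H.one :=
    LinearMap.ext (c.leftMul_antR hH)
  have h2 := hu.conv_assoc c.leftInv LinearMap.id H.antipode
  rw [c.conv_leftInv_id hH, hu.one_conv, h1, hu.conv_smulRight] at h2
  ext a
  have h3 := congrArg (Coalgebra.counit (R := ℂ)) (LinearMap.congr_fun h2 a)
  rw [LinearMap.comp_apply, leftInv, LinearMap.comp_apply, hH.counit_antipode, hH.counit_antipode,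
    actR_actR, counit_actR] at h3
  exact h3.symm

/-- An intermediate form of `conv_id_leftInv`, available before `U ⋆ Ū = ε` is known. -/
theorem conv_id_leftInv_eq_smulRight (hH : IsHopfStarAlgebra H) :
    conv c.leftMul LinearMap.id c.leftInv = (convL c.U c.Ubar).smulRight H.one := by
  ext a
  have e : conv c.leftMul LinearMap.id c.leftInv a = c.leftMul (TensorProduct.map LinearMap.id
      H.antipode (TensorProduct.map LinearMap.id (actR c.Ubar)
        (Coalgebra.comul (R := ℂ) a))) := by
    rw [TensorProduct.map_map]
    rfl
  rw [e, ← comul_actR, LinearMap.smulRight_apply, ← apply_actR]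
  exact c.leftMul_antR hH _

/-- `U ⋆ Ū = ε`: as `leftInv` is a left inverse of the identity, the element `(U ⋆ Ū) 1` acts
trivially on the identity. -/
theorem U_convL_Ubar (hH : IsHopfStarAlgebra H) : convL c.U c.Ubar = Coalgebra.counit := by
  have hu := c.isUnitalProduct_leftMul hH
  have h2 := hu.conv_assoc LinearMap.id c.leftInv LinearMap.id
  rw [c.conv_leftInv_id hH, hu.conv_one, c.conv_id_leftInv_eq_smulRight hH, hu.smulRight_conv] at h2
  ext a
  have h3 := congrArg (Coalgebra.counit (R := ℂ)) (LinearMap.congr_fun h2 a)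
  rwa [convL_apply, LinearMap.id_apply, counit_act] at h3

theorem conv_id_leftInv (hH : IsHopfStarAlgebra H) :
    conv c.leftMul LinearMap.id c.leftInv = convOne A H.one := by
  rw [c.conv_id_leftInv_eq_smulRight hH, c.U_convL_Ubar hH]

/-- `Ū(h₍₁₎ k₍₁₎) γ̄(h₍₂₎ ⊗ k₍₂₎) = γ(S(k₍₁₎) ⊗ S(h₍₁₎)) Ū(h₍₂₎) Ū(k₍₂₎)`. In the convolution
algebra of maps from `A ⊗ A` to `A` with the product `leftMul`, both sides come from an inverse of
`leftMul`: one from `leftMul = γ ⋆ mul`, the other from the factorization of `leftMul` into the two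
coordinates. -/
theorem Ubar_mul_inv (hH : IsHopfStarAlgebra H) :
    convL (c.Ubar ∘ₗ H.mul) c.inv =
      convL (c.γ ∘ₗ TensorProduct.map H.antipode H.antipode ∘ₗ
        (TensorProduct.comm ℂ A A).toLinearMap) (funTensor c.Ubar c.Ubar) := by
  have hu := c.isUnitalProduct_leftMul hH
  have hm := hH.isCoalgMap_mul
  have h1 : conv c.leftMul (c.leftMul ∘ₗ TensorProduct.map c.leftInv c.leftInv ∘ₗ
      (TensorProduct.comm ℂ A A).toLinearMap) c.leftMul = convOne (A ⊗[ℂ] A) H.one := by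
    have e := conv_fst_snd (μ := c.leftMul) (LinearMap.id : A →ₗ[ℂ] A) LinearMap.id
    rw [TensorProduct.map_id, LinearMap.comp_id] at e
    rw [← conv_snd_fst]
    have e1 := hu.conv_mul_inv (C := A ⊗[ℂ] A) (f' := LinearMap.id ∘ₗ tensorSnd A)
      (f := c.leftInv ∘ₗ tensorSnd A) (g' := LinearMap.id ∘ₗ tensorFst A)
      (g := c.leftInv ∘ₗ tensorFst A)
      (by rw [← conv_comp (isCoalgMap_tensorSnd A), c.conv_leftInv_id hH,
        convOne_comp (isCoalgMap_tensorSnd A)])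
      (by rw [← conv_comp (isCoalgMap_tensorFst A), c.conv_leftInv_id hH,
        convOne_comp (isCoalgMap_tensorFst A)])
    rwa [e] at e1
  have h2 : conv c.leftMul c.leftMul ((c.leftInv ∘ₗ H.mul) ∘ₗ actR c.inv) =
      convOne (A ⊗[ℂ] A) H.one := by
    have e1 : conv c.leftMul H.mul (c.leftInv ∘ₗ H.mul) = convOne (A ⊗[ℂ] A) H.one := by
      have := conv_comp (μ := c.leftMul) hm LinearMap.id c.leftInv
      rw [LinearMap.id_comp] at this
      rw [← this, c.conv_id_leftInv hH, convOne_comp hm]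
    have e2 : c.leftMul = conv c.leftMul (c.γ.smulRight H.one) H.mul := by
      rw [hu.smulRight_conv]
      ext x y
      simp only [TensorProduct.AlgebraTensorModule.curry_apply, LinearMap.restrictScalars_self,
        TensorProduct.curry_apply]
      rw [convL_apply, leftMul, LinearMap.comp_apply]
    have e3 : conv c.leftMul c.leftMul (c.leftInv ∘ₗ H.mul) = c.γ.smulRight H.one := by
      have := hu.conv_assoc (c.γ.smulRight H.one) H.mul (c.leftInv ∘ₗ H.mul)
      rwa [← e2, e1, hu.conv_one] at this
    rw [← hu.conv_smulRight, ← hu.conv_assoc, e3, hu.conv_smulRight]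
    ext x y
    simp only [TensorProduct.AlgebraTensorModule.curry_apply, LinearMap.restrictScalars_self,
      TensorProduct.curry_apply, LinearMap.comp_apply, LinearMap.smulRight_apply]
    rw [apply_actR, c.mul_inv]
  have h3 := hu.left_inv_eq_right_inv h1 h2
  apply LinearMap.ext
  intro x
  have h4 := congrArg (Coalgebra.counit (R := ℂ)) (LinearMap.congr_fun h3 x)
  simp only [LinearMap.comp_apply, leftInv, leftMul, hm.counit, counit_act, hH.counit_antipode,
    counit_actR] at h4
  rw [← apply_actR, ← apply_actR, LinearMap.comp_apply, ← h4, LinearMap.comp_apply,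
    LinearMap.comp_apply]
  congr 1
  rw [TensorProduct.map_comp, LinearMap.comp_apply, ← actR_funTensor, LinearEquiv.coe_coe,
    ← LinearEquiv.coe_coe, (isCoalgMap_comm A A).actR]
  have hs : funTensor c.Ubar c.Ubar ∘ₗ (TensorProduct.comm ℂ A A).toLinearMap =
      funTensor c.Ubar c.Ubar := by
    ext
    simp [mul_comm]
  rw [hs]

theorem Ubar_mul (hH : IsHopfStarAlgebra H) :
    c.Ubar ∘ₗ H.mul = convL (convL (c.γ ∘ₗ TensorProduct.map H.antipode H.antipode ∘ₗ
        (TensorProduct.comm ℂ A A).toLinearMap) (funTensor c.Ubar c.Ubar)) c.γ := by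
  rw [← c.Ubar_mul_inv hH, convL_assoc, c.inv_mul, convL_counit]

end UnitaryTwoCocycle

end CocycleFacts

/-! ### Functionals and star operations -/

section Star

variable {C M : Type*} [AddCommGroup C] [Module ℂ C] [AddCommGroup M] [Module ℂ M]

/-- The functional `c ↦ conj (φ (c*))`. -/
def funStar (s : C →ₗ⋆[ℂ] C) (φ : C →ₗ[ℂ] ℂ) : C →ₗ[ℂ] ℂ :=
  (starLinearEquiv ℂ (A := ℂ)).toLinearMap.comp (φ.comp s)

@[simp] theorem funStar_apply (s : C →ₗ⋆[ℂ] C) (φ : C →ₗ[ℂ] ℂ) (x : C) :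
    funStar s φ x = starRingEnd ℂ (φ (s x)) := rfl

theorem funStar_funStar {s : C →ₗ⋆[ℂ] C} (hs : ∀ x, s (s x) = x) (φ : C →ₗ[ℂ] ℂ) :
    funStar s (funStar s φ) = φ := by
  ext x
  simp [hs]

theorem act_star {δ : M →ₗ[ℂ] C ⊗[ℂ] M} {s : C →ₗ⋆[ℂ] C} {sM : M →ₗ⋆[ℂ] M}
    (hs : ∀ x, s (s x) = x) (h : ∀ m, δ (sM m) = TensorProduct.map s sM (δ m))
    (φ : C →ₗ[ℂ] ℂ) (m : M) : sM (act δ φ m) = act δ (funStar s φ) (sM m) := by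
  simp only [act, LinearMap.comp_apply, h m]
  generalize δ m = t
  induction t using TensorProduct.induction_on with
  | zero => simp
  | add s t hs ht => simp only [map_add, hs, ht]
  | tmul c m => simp [hs]

theorem actR_star [Coalgebra ℂ C] {s : C →ₗ⋆[ℂ] C} (hs : ∀ x, s (s x) = x)
    (h : ∀ x, Coalgebra.comul (R := ℂ) (s x) = TensorProduct.map s s (Coalgebra.comul (R := ℂ) x))
    (φ : C →ₗ[ℂ] ℂ) (x : C) : s (actR φ x) = actR (funStar s φ) (s x) := by
  simp only [actR, convR, LinearMap.comp_apply, h x]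
  generalize Coalgebra.comul (R := ℂ) x = t
  induction t using TensorProduct.induction_on with
  | zero => simp
  | add s t hs ht => simp only [map_add, hs, ht]
  | tmul c m => simp [hs]

theorem pair_star {D N : Type*} [AddCommGroup D] [Module ℂ D] [AddCommGroup N] [Module ℂ N]
    {δM : M →ₗ[ℂ] C ⊗[ℂ] M} {s : C →ₗ⋆[ℂ] C} {sM : M →ₗ⋆[ℂ] M}
    (hM : ∀ m, δM (sM m) = TensorProduct.map s sM (δM m))
    {δN : N →ₗ[ℂ] D ⊗[ℂ] N} {s' : D →ₗ⋆[ℂ] D} {sN : N →ₗ⋆[ℂ] N}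
    (hN : ∀ m, δN (sN m) = TensorProduct.map s' sN (δN m)) (t : M ⊗[ℂ] N) :
    pair δM δN (TensorProduct.map sM sN t) =
      TensorProduct.map (TensorProduct.map s s') (TensorProduct.map sM sN) (pair δM δN t) := by
  induction t using TensorProduct.induction_on with
  | zero => simp
  | add s t hs ht => simp only [map_add, hs, ht]
  | tmul m n =>
    rw [TensorProduct.map_tmul, pair_tmul, pair_tmul, hM, hN]
    generalize δM m = x
    generalize δN n = y
    induction x using TensorProduct.induction_on with
    | zero => simp
    | add s t hs ht => simp only [TensorProduct.add_tmul, map_add, hs, ht]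
    | tmul c m =>
      induction y using TensorProduct.induction_on with
      | zero => simp
      | add s t hs ht => simp only [TensorProduct.tmul_add, map_add, hs, ht]
      | tmul d n => simp

theorem map_star_star {s : C →ₗ⋆[ℂ] C} (hs : ∀ x, s (s x) = x) (t : C ⊗[ℂ] C) :
    TensorProduct.map s s (TensorProduct.map s s t) = t := by
  induction t using TensorProduct.induction_on with
  | zero => simp
  | add s t hs ht => simp only [map_add, hs, ht]
  | tmul m n => simp [hs]

theorem IsCoalgMap.comp {C D E : Type*} [AddCommGroup C] [Module ℂ C] [Coalgebra ℂ C]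
    [AddCommGroup D] [Module ℂ D] [Coalgebra ℂ D] [AddCommGroup E] [Module ℂ E] [Coalgebra ℂ E]
    {g : D →ₗ[ℂ] E} {f : C →ₗ[ℂ] D} (hg : IsCoalgMap g) (hf : IsCoalgMap f) :
    IsCoalgMap (g ∘ₗ f) where
  comul := hg.comul.comp hf.comul
  counit x := by rw [LinearMap.comp_apply, hg.counit, hf.counit]

/-- Conjugation `x ↦ φ(x₍₁₎) x₍₂₎ φ⁻¹(x₍₃₎)` by an invertible functional is a coalgebra map. -/
theorem isCoalgMap_conj [Coalgebra ℂ C] {φ φ' : C →ₗ[ℂ] ℂ}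
    (h : convL φ' φ = Coalgebra.counit) (h' : convL φ φ' = Coalgebra.counit) :
    IsCoalgMap (actR φ' ∘ₗ act Coalgebra.comul φ) where
  comul x := by
    have hC := isComodule_comul C
    have e : actR φ' ∘ₗ act Coalgebra.comul φ = act Coalgebra.comul φ ∘ₗ actR φ' :=
      LinearMap.ext (actR_act φ' φ)
    have e1 : TensorProduct.map (actR φ' ∘ₗ act Coalgebra.comul φ)
        (actR φ' ∘ₗ act Coalgebra.comul φ) (Coalgebra.comul (R := ℂ) x) =
        TensorProduct.map (act Coalgebra.comul φ) (actR φ')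
          (TensorProduct.map LinearMap.id (act Coalgebra.comul φ)
            (TensorProduct.map (actR φ') LinearMap.id (Coalgebra.comul (R := ℂ) x))) := by
      rw [TensorProduct.map_map, TensorProduct.map_map, LinearMap.comp_id, LinearMap.comp_id]
      exact congrArg (fun g => TensorProduct.map g _ _) e
    have e2 : act Coalgebra.comul φ ∘ₗ act Coalgebra.comul φ' = LinearMap.id := by
      ext y
      rw [LinearMap.comp_apply, act_act hC, h, act_counit hC, LinearMap.id_apply]
    have e3 : ∀ s : C ⊗[ℂ] C, TensorProduct.map LinearMap.id (act Coalgebra.comul φ)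
        (TensorProduct.map LinearMap.id (act Coalgebra.comul φ') s) = s := by
      intro s
      rw [TensorProduct.map_map, e2, LinearMap.id_comp, TensorProduct.map_id, LinearMap.id_apply]
    rw [e1, map_actR_coact hC, e3, LinearMap.comp_apply, comul_actR, coact_act hC,
      TensorProduct.map_map, LinearMap.id_comp, LinearMap.comp_id]
  counit x := by
    rw [LinearMap.comp_apply, counit_actR, apply_act, h']

end Star

/-! ### The twisted Hopf star-algebra -/

section TwistHopf

variable {A : Type*} [AddCommGroup A] [Module ℂ A] [Coalgebra ℂ A] {H : HopfStarOps A}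

namespace UnitaryTwoCocycle

variable (c : UnitaryTwoCocycle H)

theorem V_convL_Vbar (hH : IsHopfStarAlgebra H) : convL c.V c.Vbar = Coalgebra.counit := by
  rw [V, Vbar, ← hH.isAntiCoalgMap_antipodeInv.convL_comp, c.Ubar_convL_U hH]
  exact LinearMap.ext hH.counit_antipodeInv

theorem Vbar_convL_V (hH : IsHopfStarAlgebra H) : convL c.Vbar c.V = Coalgebra.counit := by
  rw [V, Vbar, ← hH.isAntiCoalgMap_antipodeInv.convL_comp, c.U_convL_Ubar hH]
  exact LinearMap.ext hH.counit_antipodeInv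

/-- `conj V̄(a*) = V(a)`. -/
theorem funStar_Vbar (hH : IsHopfStarAlgebra H) : funStar H.star c.Vbar = c.V := by
  ext a
  simp only [funStar_apply, Vbar, V, LinearMap.comp_apply, Ubar, U]
  rw [antipodeInv_apply, hH.star_star, hH.comul_star, hH.isAntiCoalgMap_antipode,
    hH.isAntiCoalgMap_antipodeInv]
  generalize Coalgebra.comul (R := ℂ) a = t
  induction t using TensorProduct.induction_on with
  | zero => simp
  | add s t hs ht => simp only [map_add, hs, ht]
  | tmul a b =>
    have h := c.unitary (antipodeInv H b) a
    rw [hH.antipode_antipodeInv] at h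
    simp only [TensorProduct.comm_tmul, TensorProduct.map_tmul, LinearMap.rTensor_tmul,
      LinearMap.lTensor_tmul, hH.antipode_star_antipode, hH.antipode_antipodeInv]
    rw [← h, Complex.conj_conj]

theorem funStar_V (hH : IsHopfStarAlgebra H) : funStar H.star c.V = c.Vbar := by
  rw [← c.funStar_Vbar hH, funStar_funStar hH.star_star]

theorem funStar_γ : funStar (TensorProduct.map H.star H.star) c.γ =
    c.inv ∘ₗ TensorProduct.map (antipodeInv H) (antipodeInv H) := by
  ext a b
  exact c.unitary (H.star a) (H.star b)

theorem funStar_inv (hH : IsHopfStarAlgebra H) : funStar (TensorProduct.map H.star H.star) c.inv =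
    c.γ ∘ₗ TensorProduct.map (antipodeInv H) (antipodeInv H) := by
  ext a b
  have h := c.unitary (antipodeInv H a) (antipodeInv H b)
  rw [hH.antipode_antipodeInv, hH.antipode_antipodeInv] at h
  exact (congrArg (starRingEnd ℂ) h).symm.trans (Complex.conj_conj _)

/-- `Ubar_mul` composed with `S⁻¹ ⊗ S⁻¹`, which reverses products and convolutions. -/
theorem Vbar_mul_comm (hH : IsHopfStarAlgebra H) :
    c.Vbar ∘ₗ H.mul ∘ₗ (TensorProduct.comm ℂ A A).toLinearMap =
      convL (convL (c.γ ∘ₗ TensorProduct.map (antipodeInv H) (antipodeInv H))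
        (funTensor c.Vbar c.Vbar)) (c.γ ∘ₗ (TensorProduct.comm ℂ A A).toLinearMap) := by
  have hS := hH.isAntiCoalgMap_antipodeInv.map
  have e : c.Vbar ∘ₗ H.mul ∘ₗ (TensorProduct.comm ℂ A A).toLinearMap =
      (c.Ubar ∘ₗ H.mul) ∘ₗ TensorProduct.map (antipodeInv H) (antipodeInv H) := by
    ext a b
    simp [Vbar, hH.star_mul, hH.antipode_mul_rev]
  have e1 : funTensor c.Ubar c.Ubar ∘ₗ TensorProduct.map (antipodeInv H) (antipodeInv H) =
      funTensor c.Vbar c.Vbar := by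
    ext a b
    simp [Vbar]
  have e2 : (c.γ ∘ₗ TensorProduct.map H.antipode H.antipode ∘ₗ
      (TensorProduct.comm ℂ A A).toLinearMap) ∘ₗ
        TensorProduct.map (antipodeInv H) (antipodeInv H) =
      c.γ ∘ₗ (TensorProduct.comm ℂ A A).toLinearMap := by
    ext a b
    simp [hH.antipode_star_antipode, hH.star_star]
  rw [e, c.Ubar_mul hH, hS.convL_comp, hS.convL_comp, convL_assoc, e1, e2]

/-- `γ̄(S⁻¹x₍₁₎ ⊗ S⁻¹y₍₁₎) V̄(y₍₂₎ x₍₂₎) = V̄(y₍₁₎) V̄(x₍₁₎) γ(y₍₂₎ ⊗ x₍₂₎)`: compatibility of the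
cocycle with the functional that deforms the star operation. -/
theorem funStar_γ_convL_Vbar (hH : IsHopfStarAlgebra H) :
    convL (funStar (TensorProduct.map H.star H.star) c.γ)
      (c.Vbar ∘ₗ H.mul ∘ₗ (TensorProduct.comm ℂ A A).toLinearMap) =
      convL (funTensor c.Vbar c.Vbar) c.γ ∘ₗ (TensorProduct.comm ℂ A A).toLinearMap := by
  have hS := hH.isAntiCoalgMap_antipodeInv.map
  have h0 := hH.counit_comp_map_antipodeInv
  have hs : funTensor c.Vbar c.Vbar ∘ₗ (TensorProduct.comm ℂ A A).toLinearMap =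
      funTensor c.Vbar c.Vbar := by
    ext
    simp [mul_comm]
  rw [c.funStar_γ, c.Vbar_mul_comm hH, ← convL_assoc, ← convL_assoc, ← hS.convL_comp, c.mul_inv, h0,
    counit_convL, (isCoalgMap_comm A A).convL_comp, hs]

/-- The convolution inverse of the identity `funStar_γ_convL_Vbar`. -/
theorem convL_funStar_inv (hH : IsHopfStarAlgebra H) :
    convL (c.V ∘ₗ H.mul ∘ₗ (TensorProduct.comm ℂ A A).toLinearMap)
      (funStar (TensorProduct.map H.star H.star) c.inv) =
      convL c.inv (funTensor c.V c.V) ∘ₗ (TensorProduct.comm ℂ A A).toLinearMap := by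
  have hS := hH.isAntiCoalgMap_antipodeInv.map
  have h0 := hH.counit_comp_map_antipodeInv
  have hmc := hH.isCoalgMap_mul.comp (isCoalgMap_comm A A)
  have hc := isCoalgMap_comm A A
  apply eq_of_convL_eq_counit (β := convL (funStar (TensorProduct.map H.star H.star) c.γ)
      (c.Vbar ∘ₗ H.mul ∘ₗ (TensorProduct.comm ℂ A A).toLinearMap))
  · rw [convL_assoc, ← convL_assoc (funStar _ c.inv), c.funStar_γ, c.funStar_inv hH,
      ← hS.convL_comp, c.inv_mul, h0, counit_convL, ← hmc.convL_comp, c.V_convL_Vbar hH,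
      hmc.counit_comp]
  · rw [c.funStar_γ_convL_Vbar hH, ← hc.convL_comp, convL_assoc, ← convL_assoc c.γ, c.mul_inv,
      counit_convL, funTensor_convL, c.Vbar_convL_V hH, ← counit_tensor, hc.counit_comp]

theorem twistHopf_mul (x : A ⊗[ℂ] A) :
    c.twistHopf.mul x = H.mul (actR c.inv (act Coalgebra.comul c.γ x)) := by
  rw [← convR_apply, ← convL_apply]
  rfl

theorem twistHopf_mul_eq :
    c.twistHopf.mul = H.mul ∘ₗ (actR c.inv ∘ₗ act Coalgebra.comul c.γ) :=
  LinearMap.ext c.twistHopf_mul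

theorem twistHopf_antipode_eq :
    c.twistHopf.antipode = H.antipode ∘ₗ actR c.Ubar ∘ₗ act Coalgebra.comul c.U := by
  ext a
  rw [LinearMap.comp_apply, LinearMap.comp_apply, ← convR_apply, ← convL_apply]
  rfl

theorem twistHopf_star (a : A) :
    c.twistHopf.star a = actR c.V (act Coalgebra.comul c.Vbar (H.star a)) := by
  have e : c.twistHopf.star a = convL c.Vbar (convR LinearMap.id c.V) (H.star a) := rfl
  rw [e, convL_apply, convR_apply, LinearMap.id_apply]

theorem isCoalgMap_twistHopf_mul (hH : IsHopfStarAlgebra H) : IsCoalgMap c.twistHopf.mul := by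
  rw [twistHopf_mul_eq]
  exact hH.isCoalgMap_mul.comp (isCoalgMap_conj c.inv_mul c.mul_inv)

/-- Each side is a threefold product of `A` on which `γ` acts from the left by a side of the cocycle
identity, and `γ̄` from the right by a side of the inverse cocycle identity. -/
theorem twistHopf_mul_assoc (hH : IsHopfStarAlgebra H) (x y z : A) :
    c.twistHopf.mul (c.twistHopf.mul (x ⊗ₜ y) ⊗ₜ z) =
      c.twistHopf.mul (x ⊗ₜ c.twistHopf.mul (y ⊗ₜ z)) := by
  have hm := hH.isCoalgMap_mul
  have m1 : IsCoalgMap (TensorProduct.map H.mul (LinearMap.id : A →ₗ[ℂ] A)) := hm.map IsCoalgMap.id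
  have m2 : IsCoalgMap (TensorProduct.map (LinearMap.id : A →ₗ[ℂ] A) H.mul) := IsCoalgMap.id.map hm
  have hA := isComodule_comul A
  have hA3 := isComodule_comul ((A ⊗[ℂ] A) ⊗[ℂ] A)
  have hA3' := isComodule_comul (A ⊗[ℂ] (A ⊗[ℂ] A))
  have ha : act Coalgebra.comul (Coalgebra.counit (R := ℂ) (A := A)) = LinearMap.id :=
    LinearMap.ext (act_counit hA)
  have hr : actR (Coalgebra.counit (R := ℂ) (A := A)) = LinearMap.id :=
    LinearMap.ext actR_counit
  have e1 : ∀ t : (A ⊗[ℂ] A) ⊗[ℂ] A, c.twistHopf.mul (TensorProduct.map c.twistHopf.mul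
      LinearMap.id t) = H.mul (TensorProduct.map H.mul LinearMap.id
        (actR (convL (c.inv ∘ₗ TensorProduct.map H.mul LinearMap.id)
          (funTensor c.inv Coalgebra.counit))
          (act Coalgebra.comul (cocycleLeft H.mul c.γ) t))) := by
    intro t
    have e : TensorProduct.map c.twistHopf.mul LinearMap.id t =
        TensorProduct.map H.mul LinearMap.id (actR (funTensor c.inv Coalgebra.counit)
          (act Coalgebra.comul (funTensor c.γ Coalgebra.counit) t)) := by
      rw [act_funTensor, actR_funTensor, ha, hr, TensorProduct.map_map, TensorProduct.map_map,
        LinearMap.id_comp, LinearMap.id_comp, twistHopf_mul_eq]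
      rfl
    rw [twistHopf_mul, e, m1.act, m1.actR, ← actR_act, actR_actR, act_act hA3, cocycleLeft]
  have e2 : ∀ t : A ⊗[ℂ] (A ⊗[ℂ] A), c.twistHopf.mul (TensorProduct.map
      LinearMap.id c.twistHopf.mul t) = H.mul (TensorProduct.map LinearMap.id H.mul
        (actR (convL (c.inv ∘ₗ TensorProduct.map LinearMap.id H.mul)
          (funTensor Coalgebra.counit c.inv))
          (act Coalgebra.comul (cocycleRight H.mul c.γ) t))) := by
    intro t
    have e : TensorProduct.map LinearMap.id c.twistHopf.mul t =
        TensorProduct.map LinearMap.id H.mul (actR (funTensor Coalgebra.counit c.inv)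
          (act Coalgebra.comul (funTensor Coalgebra.counit c.γ) t)) := by
      rw [act_funTensor, actR_funTensor, ha, hr, TensorProduct.map_map, TensorProduct.map_map,
        LinearMap.id_comp, LinearMap.id_comp, twistHopf_mul_eq]
      rfl
    rw [twistHopf_mul, e, m2.act, m2.actR, ← actR_act, actR_actR, act_act hA3', cocycleRight]
  have e1' := e1 ((x ⊗ₜ y) ⊗ₜ z)
  have e2' := e2 (x ⊗ₜ (y ⊗ₜ z))
  simp only [TensorProduct.map_tmul, LinearMap.id_apply] at e1' e2'
  rw [e1', e2', c.inv_cocycle hH, c.isCocycle]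
  have h1 := (isCoalgMap_assoc A A (C' := A)).act (cocycleRight H.mul c.γ) ((x ⊗ₜ y) ⊗ₜ z)
  simp only [LinearEquiv.coe_coe, TensorProduct.assoc_tmul] at h1
  rw [h1, ← LinearEquiv.coe_coe, (isCoalgMap_assoc A A).actR]
  have h2 : H.mul ∘ₗ TensorProduct.map H.mul LinearMap.id =
      H.mul ∘ₗ TensorProduct.map LinearMap.id H.mul ∘ₗ
        (TensorProduct.assoc ℂ A A A).toLinearMap := by
    ext x y z
    exact hH.mul_assoc x y z
  exact LinearMap.congr_fun h2 _

/-- The left and right factors `V̄` and `V` of the star operation are matched by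
`funStar_γ_convL_Vbar` and `convL_funStar_inv`. -/
theorem twistHopf_star_mul (hH : IsHopfStarAlgebra H) (a b : A) :
    c.twistHopf.star (c.twistHopf.mul (a ⊗ₜ b)) =
      c.twistHopf.mul (c.twistHopf.star b ⊗ₜ c.twistHopf.star a) := by
  have hmc := hH.isCoalgMap_mul.comp (isCoalgMap_comm A A)
  have hA2 := isComodule_comul (A ⊗[ℂ] A)
  have hss := map_star_star hH.star_star
  have hsc : ∀ x : A ⊗[ℂ] A, Coalgebra.comul (R := ℂ) (TensorProduct.map H.star H.star x) =
      TensorProduct.map (TensorProduct.map H.star H.star) (TensorProduct.map H.star H.star)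
        (Coalgebra.comul (R := ℂ) x) := by
    rw [comul_tensor]
    exact pair_star hH.comul_star hH.comul_star
  have hsm : ∀ x : A ⊗[ℂ] A, H.star (H.mul x) =
      (H.mul ∘ₗ (TensorProduct.comm ℂ A A).toLinearMap) (TensorProduct.map H.star H.star x) := by
    intro x
    induction x using TensorProduct.induction_on with
    | zero => simp
    | add s t hs ht => simp only [map_add, hs, ht]
    | tmul a b => simp [hH.star_mul]
  have e : (c.twistHopf.star b ⊗ₜ[ℂ] c.twistHopf.star a) =
      actR (funTensor c.V c.V) (act Coalgebra.comul (funTensor c.Vbar c.Vbar)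
        ((TensorProduct.comm ℂ A A).toLinearMap (TensorProduct.map H.star H.star (a ⊗ₜ b)))) := by
    rw [actR_funTensor, act_funTensor, twistHopf_star, twistHopf_star]
    rfl
  rw [twistHopf_star, twistHopf_mul, twistHopf_mul, hsm, actR_star hss hsc, act_star hss hsc,
    hmc.act, hmc.actR, ← actR_act, actR_actR, act_act hA2, c.funStar_γ_convL_Vbar hH,
    c.convL_funStar_inv hH, e, ← actR_act, actR_actR, act_act hA2, (isCoalgMap_comm A A).act,
    (isCoalgMap_comm A A).actR]
  rfl

/-- `A_γ` is a Hopf star-algebra. -/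
theorem isHopfStarAlgebra_twistHopf (hH : IsHopfStarAlgebra H) :
    IsHopfStarAlgebra c.twistHopf where
  mul_assoc := c.twistHopf_mul_assoc hH
  one_mul x := by
    have h1 := hH.isCoalgMap_one_tmul.act c.γ x
    rw [c.γ_comp_one_tmul, act_counit (isComodule_comul A)] at h1
    have h2 := hH.isCoalgMap_one_tmul.actR c.inv x
    rw [c.inv_comp_one_tmul hH, actR_counit] at h2
    refine (c.twistHopf_mul _).trans ((congrArg (fun y => H.mul (actR c.inv y)) h1).trans ?_)
    exact (congrArg H.mul h2).trans (hH.one_mul x)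
  mul_one x := by
    have h1 := hH.isCoalgMap_tmul_one.act c.γ x
    rw [c.γ_comp_tmul_one, act_counit (isComodule_comul A)] at h1
    have h2 := hH.isCoalgMap_tmul_one.actR c.inv x
    rw [c.inv_comp_tmul_one hH, actR_counit] at h2
    refine (c.twistHopf_mul _).trans ((congrArg (fun y => H.mul (actR c.inv y)) h1).trans ?_)
    exact (congrArg H.mul h2).trans (hH.mul_one x)
  comul_one := hH.comul_one
  comul_mul := (c.isCoalgMap_twistHopf_mul hH).comul
  counit_one := hH.counit_one
  counit_mul a b := by
    rw [(c.isCoalgMap_twistHopf_mul hH).counit, TensorProduct.counit_tmul, smul_eq_mul, mul_comm]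
  antipode_mul a := by
    have hA := isComodule_comul A
    -- the factor `Ū` of `S_γ` is `γ̄` on the inner legs of `S(a₍₁₎) ⊗ a₍₂₎`, so it cancels
    -- against the left factor `γ` of the product
    have e : c.twistHopf.antipode.rTensor A (Coalgebra.comul (R := ℂ) a) =
        act Coalgebra.comul c.inv (antL H (act Coalgebra.comul c.U a)) := by
      rw [act_antL hH, coact_act hA]
      have e2 := map_actR_coact hA c.Ubar (act Coalgebra.comul c.U a)
      rw [coact_act hA] at e2
      have e3 := congrArg (TensorProduct.map H.antipode LinearMap.id) e2
      rw [TensorProduct.map_map, TensorProduct.map_map, TensorProduct.map_map, LinearMap.id_comp,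
        LinearMap.id_comp, LinearMap.comp_id] at e3
      rw [twistHopf_antipode_eq]
      refine Eq.trans ?_ e3
      rfl
    rw [twistHopf_mul, e, act_act (isComodule_comul _), c.inv_mul, act_counit (isComodule_comul _),
      mul_actR_antL hH]
    have e4 := LinearMap.congr_fun (c.U_convL_Ubar hH) a
    rw [← apply_act] at e4
    rw [← e4]
    rfl
  mul_antipode a := by
    have hA := isComodule_comul A
    -- the factor `U` of `S_γ` is `γ` on the inner legs of `a₍₁₎ ⊗ S(a₍₂₎)`, so it cancels
    -- against the right factor `γ̄` of the product
    have e : c.twistHopf.antipode.lTensor A (Coalgebra.comul (R := ℂ) a) =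
        actR c.γ (antR H (actR c.Ubar a)) := by
      have e0 : actR c.Ubar ∘ₗ act Coalgebra.comul c.U = act Coalgebra.comul c.U ∘ₗ actR c.Ubar :=
        LinearMap.ext (actR_act _ _)
      rw [actR_antR hH, comul_actR, TensorProduct.map_map, LinearMap.id_comp,
        twistHopf_antipode_eq, e0]
      rfl
    rw [twistHopf_mul, e, ← actR_act, actR_act, actR_act, actR_actR, c.inv_mul, actR_counit,
      mul_act_antR hH]
    have e4 := LinearMap.congr_fun (c.U_convL_Ubar hH) a
    rw [← apply_actR] at e4
    rw [← e4]
    rfl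
  star_star a := by
    have hA := isComodule_comul A
    rw [twistHopf_star, twistHopf_star, actR_star hH.star_star hH.comul_star,
      act_star hH.star_star hH.comul_star, hH.star_star, c.funStar_V hH, c.funStar_Vbar hH,
      ← actR_act, act_act hA, actR_actR, c.V_convL_Vbar hH, actR_counit, act_counit hA]
  star_mul := c.twistHopf_star_mul hH
  comul_star a := by
    rw [twistHopf_star, ← LinearMap.comp_apply (actR c.V),
      (isCoalgMap_conj (c.V_convL_Vbar hH) (c.Vbar_convL_V hH)).comul, hH.comul_star]
    generalize Coalgebra.comul (R := ℂ) a = t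
    induction t using TensorProduct.induction_on with
    | zero => simp
    | add s t hs ht => simp only [map_add, hs, ht]
    | tmul a b =>
      simp only [TensorProduct.map_tmul, twistHopf_star, LinearMap.comp_apply]

end UnitaryTwoCocycle

end TwistHopf

/-! ### Subcomodules -/

section Subcomodules

variable {A M N K : Type*} [AddCommGroup A] [Module ℂ A]
  [AddCommGroup M] [Module ℂ M] [AddCommGroup N] [Module ℂ N] [AddCommGroup K] [Module ℂ K]
  {δM : M →ₗ[ℂ] A ⊗[ℂ] M} {δN : N →ₗ[ℂ] A ⊗[ℂ] N}

theorem isSubcomodule_top (δ : M →ₗ[ℂ] A ⊗[ℂ] M) : IsSubcomodule δ ⊤ := by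
  intro m _
  refine ⟨(Submodule.topEquiv (R := ℂ) (M := M)).symm.toLinearMap.lTensor A (δ m), ?_⟩
  rw [← LinearMap.comp_apply, ← LinearMap.lTensor_comp]
  have : (⊤ : Submodule ℂ M).subtype ∘ₗ (Submodule.topEquiv (R := ℂ) (M := M)).symm.toLinearMap =
      LinearMap.id := rfl
  rw [this, LinearMap.lTensor_id, LinearMap.id_apply]

theorem IsSubcomodule.act_mem {W : Submodule ℂ M} (hW : IsSubcomodule δM W) (φ : A →ₗ[ℂ] ℂ)
    {m : M} (hm : m ∈ W) : act δM φ m ∈ W := by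
  obtain ⟨t, ht⟩ := hW m hm
  rw [act, LinearMap.comp_apply, LinearMap.comp_apply, ← ht]
  clear ht
  induction t using TensorProduct.induction_on with
  | zero => simp
  | add s t hs ht => simpa only [map_add] using W.add_mem hs ht
  | tmul a w => simp [W.smul_mem]

theorem IsSubcomodule.pair_eq {W : Submodule ℂ M} {W' : Submodule ℂ N} {m : M} {n : N}
    (hm : δM m ∈ LinearMap.range (W.subtype.lTensor A))
    (hn : δN n ∈ LinearMap.range (W'.subtype.lTensor A)) :
    ∃ z : (A ⊗[ℂ] A) ⊗[ℂ] (W ⊗[ℂ] W'), pair δM δN (m ⊗ₜ n) =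
      TensorProduct.map LinearMap.id (TensorProduct.map W.subtype W'.subtype) z := by
  obtain ⟨s, hs⟩ := hm
  obtain ⟨t, ht⟩ := hn
  refine ⟨TensorProduct.tensorTensorTensorComm ℂ A W A W' (s ⊗ₜ t), ?_⟩
  rw [pair_tmul, ← hs, ← ht, ← TensorProduct.map_id, map_tensorTensorTensorComm]
  rfl

/-- A functional acts on `W ⊗ W'` for subcomodules `W` and `W'`. -/
theorem IsSubcomodule.exists_act_eq {W : Submodule ℂ M} {W' : Submodule ℂ N}
    (hW : IsSubcomodule δM W) (hW' : IsSubcomodule δN W') (φ : A ⊗[ℂ] A →ₗ[ℂ] ℂ) {m : M} {n : N}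
    (hm : m ∈ W) (hn : n ∈ W') :
    ∃ z : W ⊗[ℂ] W', act (pair δM δN) φ (m ⊗ₜ n) = TensorProduct.map W.subtype W'.subtype z := by
  obtain ⟨z, hz⟩ := IsSubcomodule.pair_eq (hW m hm) (hW' n hn)
  refine ⟨TensorProduct.lid ℂ _ (φ.rTensor _ z), ?_⟩
  rw [act, LinearMap.comp_apply, LinearMap.comp_apply, hz]
  clear hz
  induction z using TensorProduct.induction_on with
  | zero => simp
  | add s t hs ht => simp only [map_add, hs, ht]
  | tmul c w => simp

theorem map_subtype_mem {W : Submodule ℂ M} {W' : Submodule ℂ N} {P : Submodule ℂ K}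
    {μ : M ⊗[ℂ] N →ₗ[ℂ] K} (h : ∀ m ∈ W, ∀ n ∈ W', μ (m ⊗ₜ n) ∈ P) (z : W ⊗[ℂ] W') :
    μ (TensorProduct.map W.subtype W'.subtype z) ∈ P := by
  induction z using TensorProduct.induction_on with
  | zero => simp
  | add s t hs ht => simpa only [map_add] using P.add_mem hs ht
  | tmul w w' => exact h w w.2 w' w'.2

theorem IsSubcomodule.map_act_mem {W : Submodule ℂ M} {W' : Submodule ℂ N} {P : Submodule ℂ K}
    (hW : IsSubcomodule δM W) (hW' : IsSubcomodule δN W') {μ : M ⊗[ℂ] N →ₗ[ℂ] K}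
    (h : ∀ m ∈ W, ∀ n ∈ W', μ (m ⊗ₜ n) ∈ P) (φ : A ⊗[ℂ] A →ₗ[ℂ] ℂ) {m : M} {n : N}
    (hm : m ∈ W) (hn : n ∈ W') : μ (act (pair δM δN) φ (m ⊗ₜ n)) ∈ P := by
  obtain ⟨z, hz⟩ := hW.exists_act_eq hW' φ hm hn
  rw [hz]
  exact map_subtype_mem h z

theorem lTensor_mem_range {W : Submodule ℂ K} {f : M →ₗ[ℂ] K} (hf : ∀ m, f m ∈ W) (t : A ⊗[ℂ] M) :
    f.lTensor A t ∈ LinearMap.range (W.subtype.lTensor A) := by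
  refine ⟨(f.codRestrict W hf).lTensor A t, ?_⟩
  rw [← LinearMap.comp_apply, ← LinearMap.lTensor_comp]
  rfl

end Subcomodules

/-! ### Twisted comodule algebras, modules and calculi -/

section Twist

variable {A B Ω M N : Type*} [AddCommGroup A] [Module ℂ A] [Coalgebra ℂ A]
  [AddCommGroup B] [Module ℂ B] [AddCommGroup Ω] [Module ℂ Ω]
  [AddCommGroup M] [Module ℂ M] [AddCommGroup N] [Module ℂ N]
  {H : HopfStarOps A} {𝔅 : ComoduleStarOps A B} {𝒞 : CalculusOps A B Ω} {P : Bigrading Ω}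
  {ℳ : RelHopfOps A B M}

/-- A functional that is normalized in its first argument acts trivially on `m ⊗ n` if `m` is
coinvariant. -/
theorem act_one_tmul {γ : A ⊗[ℂ] A →ₗ[ℂ] ℂ}
    (hγ : γ ∘ₗ TensorProduct.mk ℂ A A H.one = Coalgebra.counit) {δM : M →ₗ[ℂ] A ⊗[ℂ] M}
    {δN : N →ₗ[ℂ] A ⊗[ℂ] N} (hN : IsComodule δN) {m : M} (hm : δM m = H.one ⊗ₜ m) (n : N) :
    act (pair δM δN) γ (m ⊗ₜ n) = m ⊗ₜ n := by
  have h : CovariantOver (TensorProduct.mk ℂ A A H.one) δN (pair δM δN)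
      (TensorProduct.mk ℂ M N m) := by
    intro n
    rw [TensorProduct.mk_apply, pair_tmul, hm]
    generalize δN n = t
    induction t using TensorProduct.induction_on with
    | zero => simp
    | add s t hs ht => simp only [TensorProduct.tmul_add, map_add, hs, ht]
    | tmul a b => simp
  have e := act_map h γ n
  rwa [hγ, act_counit hN] at e

/-- A functional that is normalized in its second argument acts trivially on `m ⊗ n` if `n` is
coinvariant. -/
theorem act_tmul_one {γ : A ⊗[ℂ] A →ₗ[ℂ] ℂ}
    (hγ : γ ∘ₗ (TensorProduct.mk ℂ A A).flip H.one = Coalgebra.counit) {δM : M →ₗ[ℂ] A ⊗[ℂ] M}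
    {δN : N →ₗ[ℂ] A ⊗[ℂ] N} (hM : IsComodule δM) {n : N} (hn : δN n = H.one ⊗ₜ n) (m : M) :
    act (pair δM δN) γ (m ⊗ₜ n) = m ⊗ₜ n := by
  have h : CovariantOver ((TensorProduct.mk ℂ A A).flip H.one) δM (pair δM δN)
      ((TensorProduct.mk ℂ M N).flip n) := by
    intro m
    rw [LinearMap.flip_apply, TensorProduct.mk_apply, pair_tmul, hn]
    generalize δM m = t
    induction t using TensorProduct.induction_on with
    | zero => simp
    | add s t hs ht => simp only [TensorProduct.add_tmul, map_add, hs, ht]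
    | tmul a b => simp
  have e := act_map h γ m
  rwa [hγ, act_counit hM] at e

namespace UnitaryTwoCocycle

variable (c : UnitaryTwoCocycle H)

/-- Twisted products are covariant for the twisted Hopf algebra. -/
theorem isCovariant_twist {X Y Z : Type*} [AddCommGroup X] [Module ℂ X] [AddCommGroup Y]
    [Module ℂ Y] [AddCommGroup Z] [Module ℂ Z] {δX : X →ₗ[ℂ] A ⊗[ℂ] X} {δY : Y →ₗ[ℂ] A ⊗[ℂ] Y}
    {δZ : Z →ₗ[ℂ] A ⊗[ℂ] Z} (hX : IsComodule δX) (hY : IsComodule δY) {μ : X ⊗[ℂ] Y →ₗ[ℂ] Z}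
    (hμ : IsCovariant (tensorCoact H.mul δX δY) δZ μ) :
    IsCovariant (tensorCoact c.twistHopf.mul δX δY) δZ (μ ∘ₗ scale c.γ δX δY) :=
  covariantOver_mul_iff.1 ((covariantOver_mul_iff.2 hμ).twist c.inv_mul hX hY)

theorem isComoduleAlgebra_twist (hH : IsHopfStarAlgebra H) (h : IsComoduleAlgebra H 𝔅) :
    IsComoduleAlgebra c.twistHopf (c.twistAlgebra 𝔅) where
  mul_assoc x y z := by
    have hc := h.toIsComodule
    have hm := covariantOver_mul_iff.2 h.coact_mul
    exact c.isCocycle.twisted_assoc hc hc hc hm hm h.mul_assoc x y z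
  one_mul x := (congrArg 𝔅.mul (act_one_tmul c.γ_comp_one_tmul h.toIsComodule
    h.coact_one x)).trans (h.one_mul x)
  mul_one x := (congrArg 𝔅.mul (act_tmul_one c.γ_comp_tmul_one h.toIsComodule
    h.coact_one x)).trans (h.mul_one x)
  coassoc := h.coassoc
  counit := h.counit
  coact_one := h.coact_one
  coact_mul := c.isCovariant_twist h.toIsComodule h.toIsComodule h.coact_mul
  coact_star b := by
    have hc := h.toIsComodule
    -- the right factor `V` of the star operation of `A_γ` moves to `B`, where it cancels
    -- against `V̄`
    have e : TensorProduct.map c.twistHopf.star (c.twistAlgebra 𝔅).star (𝔅.coact b) =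
        TensorProduct.map (act Coalgebra.comul c.Vbar) LinearMap.id
          (TensorProduct.map LinearMap.id (act 𝔅.coact c.Vbar)
            (TensorProduct.map (actR c.V) LinearMap.id (𝔅.coact (𝔅.star b)))) := by
      rw [h.coact_star, TensorProduct.map_map, TensorProduct.map_map, LinearMap.id_comp,
        LinearMap.comp_id]
      generalize 𝔅.coact b = t
      induction t using TensorProduct.induction_on with
      | zero => simp
      | add s t hs ht => simp only [map_add, hs, ht]
      | tmul a b =>
        simp only [TensorProduct.map_tmul, twistHopf_star, actR_act]
        rfl
    have e2 : act 𝔅.coact c.Vbar ∘ₗ act 𝔅.coact c.V = LinearMap.id := by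
      ext x
      rw [LinearMap.comp_apply, act_act hc, c.V_convL_Vbar hH, act_counit hc, LinearMap.id_apply]
    have e3 : ∀ s : A ⊗[ℂ] B, TensorProduct.map LinearMap.id (act 𝔅.coact c.Vbar)
        (TensorProduct.map LinearMap.id (act 𝔅.coact c.V) s) = s := by
      intro s
      rw [TensorProduct.map_map, e2, LinearMap.id_comp, TensorProduct.map_id, LinearMap.id_apply]
    refine Eq.trans ?_ e.symm
    rw [map_actR_coact hc, e3, ← coact_act hc]
    rfl

theorem twistAlgebra_star (b : B) :
    (c.twistAlgebra 𝔅).star b = act 𝔅.coact c.Vbar (𝔅.star b) := rfl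

theorem twistAlgebra_mul (t : B ⊗[ℂ] B) :
    (c.twistAlgebra 𝔅).mul t = 𝔅.mul (act (pair 𝔅.coact 𝔅.coact) c.γ t) := rfl

theorem twistAlgebra_star_star (hH : IsHopfStarAlgebra H) (h : IsComoduleAlgebra H 𝔅)
    (hs : ∀ b, 𝔅.star (𝔅.star b) = b) (b : B) :
    (c.twistAlgebra 𝔅).star ((c.twistAlgebra 𝔅).star b) = b := by
  have hc := h.toIsComodule
  rw [twistAlgebra_star, twistAlgebra_star, act_star hH.star_star h.coact_star, hs,
    c.funStar_Vbar hH, act_act hc, c.V_convL_Vbar hH, act_counit hc]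

/-- If the star operation of a comodule algebra reverses the product up to the sign `s` on the
tensors that occur in the twisted product of `x` and `y`, then so does the twisted one. -/
theorem twistAlgebra_star_mul (hH : IsHopfStarAlgebra H) (h : IsComoduleAlgebra H 𝔅) (s : ℂ)
    (x y : B) (hs : ∀ φ : A ⊗[ℂ] A →ₗ[ℂ] ℂ,
      𝔅.star (𝔅.mul (act (pair 𝔅.coact 𝔅.coact) φ (x ⊗ₜ y))) =
        s • 𝔅.mul (TensorProduct.comm ℂ B B (TensorProduct.map 𝔅.star 𝔅.star
          (act (pair 𝔅.coact 𝔅.coact) φ (x ⊗ₜ y))))) :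
    (c.twistAlgebra 𝔅).star ((c.twistAlgebra 𝔅).mul (x ⊗ₜ y)) =
      s • (c.twistAlgebra 𝔅).mul ((c.twistAlgebra 𝔅).star y ⊗ₜ (c.twistAlgebra 𝔅).star x) := by
  have hc := h.toIsComodule
  have hcc := hc.pair hc
  have hmc : CovariantOver (H.mul ∘ₗ (TensorProduct.comm ℂ A A).toLinearMap)
      (pair 𝔅.coact 𝔅.coact) 𝔅.coact (𝔅.mul ∘ₗ (TensorProduct.comm ℂ B B).toLinearMap) :=
    (covariantOver_mul_iff.2 h.coact_mul).comp (CovariantOver.comm _ _)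
  have e : ((c.twistAlgebra 𝔅).star y ⊗ₜ[ℂ] (c.twistAlgebra 𝔅).star x) =
      act (pair 𝔅.coact 𝔅.coact) (funTensor c.Vbar c.Vbar) ((TensorProduct.comm ℂ B B).toLinearMap
        (TensorProduct.map 𝔅.star 𝔅.star (x ⊗ₜ y))) := by
    rw [act_pair]
    rfl
  rw [twistAlgebra_star, twistAlgebra_mul, hs, map_smul, twistAlgebra_mul, e, act_act hcc,
    act_star (map_star_star hH.star_star) (pair_star h.coact_star h.coact_star),
    act_map (CovariantOver.comm 𝔅.coact 𝔅.coact), ← c.funStar_γ_convL_Vbar hH, ← act_act hcc]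
  exact congrArg (s • ·) (act_map hmc c.Vbar _)

theorem isComoduleStarAlgebra_twist (hH : IsHopfStarAlgebra H) (h : IsComoduleStarAlgebra H 𝔅) :
    IsComoduleStarAlgebra c.twistHopf (c.twistAlgebra 𝔅) where
  toIsComoduleAlgebra := c.isComoduleAlgebra_twist hH h.toIsComoduleAlgebra
  star_star := c.twistAlgebra_star_star hH h.toIsComoduleAlgebra h.star_star
  star_mul x y := by
    have e := c.twistAlgebra_star_mul hH h.toIsComoduleAlgebra 1 x y (fun φ => by
      generalize act (pair 𝔅.coact 𝔅.coact) φ (x ⊗ₜ y) = t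
      rw [one_smul]
      induction t using TensorProduct.induction_on with
      | zero => simp
      | add s t hs ht => simp only [map_add, hs, ht]
      | tmul a b => simp [h.star_mul])
    rwa [one_smul] at e

theorem isRelHopfModule_twist (hB : IsComoduleAlgebra H 𝔅)
    (h : IsRelHopfModule H 𝔅 ℳ) :
    IsRelHopfModule c.twistHopf (c.twistAlgebra 𝔅) (c.twistModule 𝔅 ℳ) where
  coassoc := h.coassoc
  counit := h.counit
  one_lact m := (congrArg ℳ.lact (act_one_tmul c.γ_comp_one_tmul h.toIsComodule
    hB.coact_one m)).trans (h.one_lact m)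
  ract_one m := (congrArg ℳ.ract (act_tmul_one c.γ_comp_tmul_one h.toIsComodule
    hB.coact_one m)).trans (h.ract_one m)
  mul_lact := c.isCocycle.twisted_assoc hB.toIsComodule hB.toIsComodule h.toIsComodule
    (covariantOver_mul_iff.2 hB.coact_mul) (covariantOver_mul_iff.2 h.coact_lact) h.mul_lact
  ract_mul m b b' := (c.isCocycle.twisted_assoc h.toIsComodule hB.toIsComodule hB.toIsComodule
    (covariantOver_mul_iff.2 h.coact_ract) (covariantOver_mul_iff.2 hB.coact_mul)
    (fun m b b' => (h.ract_mul m b b').symm) m b b').symm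
  lact_ract := c.isCocycle.twisted_assoc hB.toIsComodule h.toIsComodule hB.toIsComodule
    (covariantOver_mul_iff.2 h.coact_lact) (covariantOver_mul_iff.2 h.coact_ract) h.lact_ract
  coact_lact := c.isCovariant_twist hB.toIsComodule h.toIsComodule h.coact_lact
  coact_ract := c.isCovariant_twist h.toIsComodule hB.toIsComodule h.coact_ract

/-- The twisted calculus is still generated by `B` and `dB`: for a subspace `W` closed under the
twisted product, `{ω | δ(ω) ∈ A ⊗ W}` is closed under the original one. -/
theorem generated_twist (h : IsCovariantStarCalculus H 𝔅 𝒞) (W : Submodule ℂ Ω)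
    (hi : ∀ b, 𝒞.incl b ∈ W) (hd : ∀ b, 𝒞.d (𝒞.incl b) ∈ W)
    (hm : ∀ ω ∈ W, ∀ η ∈ W, (c.twistCalculus 𝒞).mul (ω ⊗ₜ η) ∈ W) : W = ⊤ := by
  have hc := h.toIsComodule
  have hcc := hc.pair hc
  have key := h.generated ((LinearMap.range (W.subtype.lTensor A)).comap 𝒞.coact) (fun b => by
      rw [Submodule.mem_comap, h.coact_incl]
      exact lTensor_mem_range hi _) (fun b => by
      rw [Submodule.mem_comap, h.coact_d, h.coact_incl, ← LinearMap.comp_apply,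
        ← LinearMap.lTensor_comp]
      exact lTensor_mem_range (f := 𝒞.d ∘ₗ 𝒞.incl) hd _) (fun ω hω η hη => by
      obtain ⟨z, hz⟩ := IsSubcomodule.pair_eq (δM := 𝒞.coact) (δN := 𝒞.coact) hω hη
      have e2 : (c.twistCalculus 𝒞).mul ∘ₗ act (pair 𝒞.coact 𝒞.coact) c.inv = 𝒞.mul := by
        apply LinearMap.ext
        intro t
        refine (congrArg 𝒞.mul (act_act hcc c.inv c.γ t)).trans ?_
        rw [c.inv_mul, act_counit hcc]
      have e3 : 𝒞.coact (𝒞.mul (ω ⊗ₜ η)) = TensorProduct.map (H.mul ∘ₗ actR c.inv)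
          ((c.twistCalculus 𝒞).mul ∘ₗ TensorProduct.map W.subtype W.subtype) z := by
        rw [covariantOver_mul_iff.2 h.coact_mul]
        have e4 := congrArg (TensorProduct.map H.mul (c.twistCalculus 𝒞).mul)
          (map_actR_coact hcc c.inv (ω ⊗ₜ η))
        rw [TensorProduct.map_map, TensorProduct.map_map, LinearMap.comp_id, LinearMap.comp_id,
          e2] at e4
        rw [← e4, hz, TensorProduct.map_map, LinearMap.comp_id]
      rw [Submodule.mem_comap, e3]
      have e5 := lTensor_mem_range (A := A) (W := W)
        (f := (c.twistCalculus 𝒞).mul ∘ₗ TensorProduct.map W.subtype W.subtype)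
        (map_subtype_mem hm) (TensorProduct.map (H.mul ∘ₗ actR c.inv) LinearMap.id z)
      refine Eq.mp (congrArg (· ∈ _) ?_) e5
      rw [LinearMap.lTensor, TensorProduct.map_map, LinearMap.id_comp, LinearMap.comp_id])
  rw [eq_top_iff]
  intro ω _
  have hω : ω ∈ (LinearMap.range (W.subtype.lTensor A)).comap 𝒞.coact := key ▸ Submodule.mem_top
  obtain ⟨t, ht⟩ := hω
  rw [← h.counit ω, ← ht]
  clear ht
  induction t using TensorProduct.induction_on with
  | zero => simp
  | add s t hs ht => simpa only [map_add] using W.add_mem hs ht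
  | tmul a w => simp [W.smul_mem]

theorem isCovariantStarCalculus_twist (hH : IsHopfStarAlgebra H)
    (h : IsCovariantStarCalculus H 𝔅 𝒞) :
    IsCovariantStarCalculus c.twistHopf (c.twistAlgebra 𝔅) (c.twistCalculus 𝒞) where
  toIsComoduleAlgebra := c.isComoduleAlgebra_twist hH h.toIsComoduleAlgebra
  deg_internal := h.deg_internal
  deg_mul hω hη := (h.coact_deg _).map_act_mem (h.coact_deg _)
    (fun _ hm _ hn => h.deg_mul hm hn) c.γ hω hη
  incl_injective := h.incl_injective
  range_incl := h.range_incl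
  incl_one := h.incl_one
  incl_mul b b' := by
    have e := act_map_map h.coact_incl h.coact_incl c.γ (b ⊗ₜ b')
    refine Eq.trans ?_ (congrArg 𝒞.mul e).symm
    have e2 : 𝒞.incl ∘ₗ 𝔅.mul = 𝒞.mul ∘ₗ TensorProduct.map 𝒞.incl 𝒞.incl := by
      ext x y
      exact h.incl_mul x y
    exact LinearMap.congr_fun e2 _
  d_deg := h.d_deg
  d_d := h.d_d
  d_mul {k ω} hω η := by
    obtain ⟨z, hz⟩ := (h.coact_deg k).exists_act_eq (isSubcomodule_top 𝒞.coact) c.γ hω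
      (Submodule.mem_top (x := η))
    have e1 := act_map_map h.coact_d (CovariantOver.id 𝒞.coact).isCovariant c.γ (ω ⊗ₜ η)
    have e2 := act_map_map (CovariantOver.id 𝒞.coact).isCovariant h.coact_d c.γ (ω ⊗ₜ η)
    rw [hz] at e1 e2
    have e3 : ∀ z : 𝒞.deg k ⊗[ℂ] (⊤ : Submodule ℂ Ω),
        𝒞.d (𝒞.mul (TensorProduct.map (𝒞.deg k).subtype (⊤ : Submodule ℂ Ω).subtype z)) =
        𝒞.mul (TensorProduct.map 𝒞.d LinearMap.id
          (TensorProduct.map (𝒞.deg k).subtype (⊤ : Submodule ℂ Ω).subtype z)) +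
        (-1 : ℂ) ^ k • 𝒞.mul (TensorProduct.map LinearMap.id 𝒞.d
          (TensorProduct.map (𝒞.deg k).subtype (⊤ : Submodule ℂ Ω).subtype z)) := by
      intro z
      induction z using TensorProduct.induction_on with
      | zero => simp
      | add s t hs ht => simp only [map_add, hs, ht, smul_add]; abel
      | tmul x y => exact h.d_mul x.2 y
    refine (congrArg (fun x => 𝒞.d (𝒞.mul x)) hz).trans ((e3 z).trans ?_)
    rw [← e1, ← e2]
    rfl
  generated := c.generated_twist h
  coact_incl := h.coact_incl
  coact_deg := h.coact_deg
  coact_d := h.coact_d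
  star_star := c.twistAlgebra_star_star hH h.toIsComoduleAlgebra h.star_star
  star_incl b := by
    have e := act_map h.coact_incl.over c.Vbar (𝔅.star b)
    refine (congrArg (act 𝒞.coact c.Vbar) (h.star_incl b)).trans (e.trans ?_)
    rw [LinearMap.comp_id]
    rfl
  star_deg {k ω} hω := (h.coact_deg k).act_mem c.Vbar (h.star_deg hω)
  star_d ω := by
    have e := act_map h.coact_d.over c.Vbar (𝒞.star ω)
    refine (congrArg (act 𝒞.coact c.Vbar) (h.star_d ω)).trans (e.trans ?_)
    rw [LinearMap.comp_id]
    rfl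
  star_mul {k l ω η} hω hη := by
    refine c.twistAlgebra_star_mul hH h.toIsComoduleAlgebra ((-1 : ℂ) ^ (k * l)) ω η (fun φ => ?_)
    obtain ⟨z, hz⟩ := (h.coact_deg k).exists_act_eq (h.coact_deg l) φ hω hη
    rw [hz]
    clear hz
    induction z using TensorProduct.induction_on with
    | zero => simp
    | add s t hs ht => simp only [map_add, hs, ht, smul_add]
    | tmul x y => exact h.star_mul x.2 y.2

theorem isCovariantComplexStructure_twist (hH : IsHopfStarAlgebra H)
    (h : IsCovariantComplexStructure H 𝔅 𝒞 P) :
    IsCovariantComplexStructure c.twistHopf (c.twistAlgebra 𝔅) (c.twistCalculus 𝒞) P where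
  toIsCovariantStarCalculus := c.isCovariantStarCalculus_twist hH h.toIsCovariantStarCalculus
  comp_mul hω hη := (h.coact_comp _).map_act_mem (h.coact_comp _)
    (fun _ hm _ hn => h.comp_mul hm hn) c.γ hω hη
  comp_zero := h.comp_zero
  deg_eq := h.deg_eq
  star_comp p q ω := by
    have key : ∀ p q ω, ω ∈ P.comp (p, q) → (c.twistCalculus 𝒞).star ω ∈ P.comp (q, p) :=
      fun p q ω hω => (h.coact_comp (q, p)).act_mem c.Vbar ((h.star_comp p q ω).2 hω)
    refine ⟨fun hω => ?_, key p q ω⟩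
    have := key q p _ hω
    rwa [(c.isCovariantStarCalculus_twist hH h.toIsCovariantStarCalculus).star_star] at this
  d_comp := h.d_comp
  coact_comp := h.coact_comp

end UnitaryTwoCocycle

end Twist

/-! ### Forms of a given bidegree -/

section Forms

variable {A B Ω : Type*} [AddCommGroup A] [Module ℂ A] [Coalgebra ℂ A]
  [AddCommGroup B] [Module ℂ B] [AddCommGroup Ω] [Module ℂ Ω]
  {H : HopfStarOps A} {𝔅 : ComoduleStarOps A B} {𝒞 : CalculusOps A B Ω} {P : Bigrading Ω}

namespace IsCovariantComplexStructure

theorem covariant_proj (h : IsCovariantComplexStructure H 𝔅 𝒞 P) (j : ℕ × ℕ) :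
    IsCovariant 𝒞.coact (formOps 𝒞 P j).coact (P.proj j) := by
  intro ω
  have hω : ω ∈ ⨆ i, P.comp i := by
    rw [P.internal.submodule_iSup_eq_top]
    exact Submodule.mem_top
  induction hω using Submodule.iSup_induction' with
  | zero => simp
  | add x y _ _ hx hy => simp only [map_add, hx, hy]
  | mem i x hx =>
    obtain ⟨t, ht⟩ := h.coact_comp i x hx
    by_cases hij : i = j
    · subst hij
      have e := P.proj_of_mem hx
      simp only [formOps, LinearMap.comp_apply, Submodule.subtype_apply, e]
    · rw [P.proj_of_mem_ne hij hx, map_zero, ← ht, ← LinearMap.comp_apply, ← LinearMap.lTensor_comp]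
      have e : P.proj j ∘ₗ (P.comp i).subtype = 0 :=
        LinearMap.ext fun y => P.proj_of_mem_ne hij y.2
      rw [e, LinearMap.lTensor_zero, LinearMap.zero_apply]

theorem covariant_dbarB (h : IsCovariantComplexStructure H 𝔅 𝒞 P) :
    IsCovariant 𝔅.coact (formOps 𝒞 P (0, 1)).coact (dbarB 𝒞 P) :=
  ((h.covariant_proj (0, 1)).over.comp (h.coact_d.over.comp h.coact_incl.over)).isCovariant

theorem covariant_dbarForm (h : IsCovariantComplexStructure H 𝔅 𝒞 P) :
    IsCovariant (formOps 𝒞 P (0, 1)).coact (formOps 𝒞 P (0, 2)).coact (dbarForm 𝒞 P) :=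
  ((h.covariant_proj (0, 2)).over.comp
    (h.coact_d.over.comp (h.covariant_subtype (0, 1)).over)).isCovariant

theorem covariant_wedgeForm (h : IsCovariantComplexStructure H 𝔅 𝒞 P) :
    CovariantOver H.mul (pair (formOps 𝒞 P (0, 1)).coact (formOps 𝒞 P (0, 1)).coact)
      (formOps 𝒞 P (0, 2)).coact (wedgeForm 𝒞 P) := by
  have e := (h.covariant_proj (0, 2)).over.comp ((covariantOver_mul_iff.2 h.coact_mul).comp
    ((h.covariant_subtype (0, 1)).over.map (h.covariant_subtype (0, 1)).over))
  rwa [TensorProduct.map_id] at e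

/-- The forms of a given bidegree in the twisted calculus are the twist of the relative Hopf module
of forms. -/
theorem formOps_twist (h : IsCovariantComplexStructure H 𝔅 𝒞 P) (c : UnitaryTwoCocycle H)
    (i : ℕ × ℕ) : formOps (c.twistCalculus 𝒞) P i = c.twistModule 𝔅 (formOps 𝒞 P i) := by
  have h1 : (formOps (c.twistCalculus 𝒞) P i).lact =
      (c.twistModule 𝔅 (formOps 𝒞 P i)).lact := by
    apply LinearMap.ext
    intro t
    exact congrArg (fun x => P.proj i (𝒞.mul x))
      (act_map_map h.coact_incl (h.covariant_subtype i) c.γ t)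
  have h2 : (formOps (c.twistCalculus 𝒞) P i).ract =
      (c.twistModule 𝔅 (formOps 𝒞 P i)).ract := by
    apply LinearMap.ext
    intro t
    exact congrArg (fun x => P.proj i (𝒞.mul x))
      (act_map_map (h.covariant_subtype i) h.coact_incl c.γ t)
  have h3 : (formOps (c.twistCalculus 𝒞) P i).coact =
      (c.twistModule 𝔅 (formOps 𝒞 P i)).coact := rfl
  cases e1 : formOps (c.twistCalculus 𝒞) P i
  cases e2 : c.twistModule 𝔅 (formOps 𝒞 P i)
  rw [e1, e2] at h1 h2 h3
  simp only at h1 h2 h3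
  rw [h1, h2, h3]

theorem wedgeForm_twist (h : IsCovariantComplexStructure H 𝔅 𝒞 P) (c : UnitaryTwoCocycle H)
    (t : P.comp (0, 1) ⊗[ℂ] P.comp (0, 1)) : wedgeForm (c.twistCalculus 𝒞) P t =
      wedgeForm 𝒞 P (act (pair (formOps 𝒞 P (0, 1)).coact (formOps 𝒞 P (0, 1)).coact) c.γ t) :=
  congrArg (fun x => P.proj (0, 2) (𝒞.mul x))
    (act_map_map (h.covariant_subtype (0, 1)) (h.covariant_subtype (0, 1)) c.γ t)

end IsCovariantComplexStructure

end Forms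

/-! ### Twisting tensor products over `B` -/

section TensorTwist

variable {A B M M' N X : Type*} [AddCommGroup A] [Module ℂ A] [Coalgebra ℂ A]
  [AddCommGroup B] [Module ℂ B] [AddCommGroup M] [Module ℂ M] [AddCommGroup M'] [Module ℂ M']
  [AddCommGroup N] [Module ℂ N] [AddCommGroup X] [Module ℂ X]
  {H : HopfStarOps A} {𝔅 : ComoduleStarOps A B} {ℳ : RelHopfOps A B M} {ℳ' : RelHopfOps A B M'}
  {𝒩 : RelHopfOps A B N}

/-- The pairing `x ⊗ (m ⊗ n) ↦ ρ(x ⊗ m) ⊗ n` on `X ⊗ (M ⊗_B N)` for a bilinear map `ρ` that is right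
`B`-linear in `m`. -/
def BTensor.outer (𝒩 : RelHopfOps A B N) (ρ : X ⊗[ℂ] M →ₗ[ℂ] M')
    (hρ : ∀ x m b, ρ (x ⊗ₜ ℳ.ract (m ⊗ₜ b)) = ℳ'.ract (ρ (x ⊗ₜ m) ⊗ₜ b)) :
    X ⊗[ℂ] BTensor ℳ 𝒩 →ₗ[ℂ] BTensor ℳ' 𝒩 :=
  TensorProduct.lift (LinearMap.mk₂ ℂ
    (fun x t => BTensor.mapLeft ℳ ℳ' 𝒩 (ρ ∘ₗ TensorProduct.mk ℂ X M x) (hρ x) t)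
    (fun x x' t => by
      induction t using BTensor.induction with
      | h0 => simp
      | ht m n =>
        change BTensor.mk ℳ' 𝒩 (ρ ((x + x') ⊗ₜ m) ⊗ₜ n) =
          BTensor.mk ℳ' 𝒩 (ρ (x ⊗ₜ m) ⊗ₜ n) + BTensor.mk ℳ' 𝒩 (ρ (x' ⊗ₜ m) ⊗ₜ n)
        rw [TensorProduct.add_tmul, map_add, TensorProduct.add_tmul, map_add]
      | ha s t hs ht =>
        exact (LinearMap.map_add _ s t).trans ((congrArg₂ (· + ·) hs ht).trans
          ((add_add_add_comm _ _ _ _).trans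
            (congrArg₂ (· + ·) (LinearMap.map_add _ s t) (LinearMap.map_add _ s t)).symm)))
    (fun a x t => by
      induction t using BTensor.induction with
      | h0 => simp
      | ht m n =>
        change BTensor.mk ℳ' 𝒩 (ρ ((a • x) ⊗ₜ m) ⊗ₜ n) = a • BTensor.mk ℳ' 𝒩 (ρ (x ⊗ₜ m) ⊗ₜ n)
        rw [← TensorProduct.smul_tmul', map_smul, ← TensorProduct.smul_tmul', map_smul]
      | ha s t hs ht => rw [LinearMap.map_add, LinearMap.map_add, hs, ht, smul_add])
    (fun x t t' => by simp)
    (fun a x t => by simp))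

theorem BTensor.covariant_mk (hH : IsHopfStarAlgebra H) (hM : IsRelHopfModule H 𝔅 ℳ)
    (hN : IsRelHopfModule H 𝔅 𝒩) : IsCovariant (tensorCoact H.mul ℳ.coact 𝒩.coact)
      (BTensor.coact hH hM hN) (BTensor.mk ℳ 𝒩) := fun _ => rfl

namespace UnitaryTwoCocycle

variable (c : UnitaryTwoCocycle H)

/-- `m ⊗ n ↦ γ(m₍₋₁₎ ⊗ n₍₋₁₎) m₍₀₎ ⊗ n₍₀₎` as a linear automorphism. -/
def scaleEquiv {δM : M →ₗ[ℂ] A ⊗[ℂ] M} {δN : N →ₗ[ℂ] A ⊗[ℂ] N} (hM : IsComodule δM)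
    (hN : IsComodule δN) : (M ⊗[ℂ] N) ≃ₗ[ℂ] (M ⊗[ℂ] N) :=
  LinearEquiv.ofLinearMap (scale c.γ δM δN) (scale c.inv δM δN)
    (LinearMap.ext fun t => by
      rw [LinearMap.comp_apply, scale_eq_act, scale_eq_act, act_act (hM.pair hN), c.inv_mul,
        act_counit (hM.pair hN), LinearMap.id_apply])
    (LinearMap.ext fun t => by
      rw [LinearMap.comp_apply, scale_eq_act, scale_eq_act, act_act (hM.pair hN), c.mul_inv,
        act_counit (hM.pair hN), LinearMap.id_apply])

/-- The action of `γ` carries the relations of the twisted tensor product onto those of the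
original one. -/
theorem map_balancedRel (hH : IsHopfStarAlgebra H) (hB : IsComodule 𝔅.coact)
    (hM : IsRelHopfModule H 𝔅 ℳ) (hN : IsRelHopfModule H 𝔅 𝒩) :
    (balancedRel (c.twistModule 𝔅 ℳ) (c.twistModule 𝔅 𝒩)).map
      (c.scaleEquiv hM.toIsComodule hN.toIsComodule).toLinearMap = balancedRel ℳ 𝒩 := by
  have hMc := hM.toIsComodule
  have hNc := hN.toIsComodule
  have hr := covariantOver_mul_iff.2 hM.coact_ract
  have hl := covariantOver_mul_iff.2 hN.coact_lact
  apply le_antisymm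
  · rw [balancedRel, Submodule.map_span, Submodule.span_le]
    rintro _ ⟨_, ⟨m, b, n, rfl⟩, rfl⟩
    have e := c.isCocycle.twisted_assoc (μ₂ := BTensor.mk ℳ 𝒩) (μ₄ := BTensor.mk ℳ 𝒩) hMc hB hNc
      hr hl (BTensor.mk_balanced ℳ 𝒩) m b n
    rw [map_sub]
    exact (Submodule.Quotient.eq _).1 e
  · rw [balancedRel, Submodule.span_le]
    rintro _ ⟨m, b, n, rfl⟩
    -- as `cocycleLeft` is invertible, every `m ⊗ b ⊗ n` is `cocycleLeft` acting on
    -- some `t`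
    obtain ⟨ψ, hψ⟩ : ∃ ψ, convL ψ (cocycleLeft H.mul c.γ) = Coalgebra.counit :=
      ⟨_, c.inv_convL_cocycleLeft hH⟩
    have e0 := act_act ((hMc.pair hB).pair hNc) ψ (cocycleLeft H.mul c.γ) ((m ⊗ₜ b) ⊗ₜ n)
    rw [hψ, act_counit ((hMc.pair hB).pair hNc)] at e0
    generalize act (pair (pair ℳ.coact 𝔅.coact) 𝒩.coact) ψ ((m ⊗ₜ b) ⊗ₜ n) = t at e0
    refine ⟨TensorProduct.map (ℳ.ract ∘ₗ act (pair ℳ.coact 𝔅.coact) c.γ) LinearMap.id t -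
      TensorProduct.map LinearMap.id (𝒩.lact ∘ₗ act (pair 𝔅.coact 𝒩.coact) c.γ)
        (TensorProduct.assoc ℂ M B N t), ?_, ?_⟩
    · clear e0
      induction t using TensorProduct.induction_on with
      | zero => simp
      | add s t hs ht =>
        simp only [map_add, add_sub_add_comm]
        exact Submodule.add_mem _ hs ht
      | tmul x n =>
        induction x using TensorProduct.induction_on with
        | zero => simp
        | add s t hs ht =>
          simp only [TensorProduct.add_tmul, map_add, add_sub_add_comm]
          exact Submodule.add_mem _ hs ht
        | tmul m b => exact Submodule.subset_span ⟨m, b, n, rfl⟩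
    · have e1 := act_cocycleLeft (γ := c.γ) hMc hB hNc hr t
      have e2 := act_cocycleRight (γ := c.γ) hMc hB hNc hl (TensorProduct.assoc ℂ M B N t)
      have e3 := act_map (CovariantOver.assoc ℳ.coact 𝔅.coact 𝒩.coact) (cocycleRight H.mul c.γ) t
      rw [← c.isCocycle, e0] at e3
      rw [e0] at e1
      simp only [LinearEquiv.coe_coe] at e3
      rw [e3] at e2
      rw [map_sub]
      refine (congrArg₂ (· - ·) e1 e2).trans ?_
      simp

/-- The isomorphism `M_γ ⊗_{B_γ} N_γ ≃ M ⊗_B N` induced by the action of `γ` on `M ⊗ N`; the twisted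
module `M_γ` is given up to a propositional equality. -/
def twistTensorEquiv (hH : IsHopfStarAlgebra H) (hB : IsComodule 𝔅.coact)
    (hM : IsRelHopfModule H 𝔅 ℳ) (hN : IsRelHopfModule H 𝔅 𝒩) {ℳγ : RelHopfOps A B M}
    (e : ℳγ = c.twistModule 𝔅 ℳ) :
    BTensor ℳγ (c.twistModule 𝔅 𝒩) ≃ₗ[ℂ] BTensor ℳ 𝒩 :=
  Submodule.Quotient.equiv _ _ (c.scaleEquiv hM.toIsComodule hN.toIsComodule)
    (by subst e; exact c.map_balancedRel hH hB hM hN)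

section Equiv

variable (hH : IsHopfStarAlgebra H) (hB : IsComodule 𝔅.coact)
    (hM : IsRelHopfModule H 𝔅 ℳ) (hN : IsRelHopfModule H 𝔅 𝒩) {ℳγ : RelHopfOps A B M}
    (e : ℳγ = c.twistModule 𝔅 ℳ)

theorem twistTensorEquiv_mk (t : M ⊗[ℂ] N) :
    c.twistTensorEquiv hH hB hM hN e (BTensor.mk _ _ t) =
      BTensor.mk ℳ 𝒩 (act (pair ℳ.coact 𝒩.coact) c.γ t) := rfl

theorem covariant_twistTensorEquiv (hM' : IsRelHopfModule c.twistHopf (c.twistAlgebra 𝔅) ℳγ)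
    (hN' : IsRelHopfModule c.twistHopf (c.twistAlgebra 𝔅) (c.twistModule 𝔅 𝒩))
    (hH' : IsHopfStarAlgebra c.twistHopf) :
    IsCovariant (BTensor.coact hH' hM' hN') (BTensor.coact hH hM hN)
      (c.twistTensorEquiv hH hB hM hN e).toLinearMap := by
  intro x
  obtain ⟨t, rfl⟩ := (balancedRel _ _).mkQ_surjective x
  have h := c.isCovariant_twist hM.toIsComodule hN.toIsComodule (BTensor.covariant_mk hH hM hN) t
  refine h.trans ?_
  have e2 : BTensor.coact hH' hM' hN' ((balancedRel ℳγ (c.twistModule 𝔅 𝒩)).mkQ t) =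
      (BTensor.mk ℳγ (c.twistModule 𝔅 𝒩)).lTensor A
        (tensorCoact c.twistHopf.mul ℳγ.coact 𝒩.coact t) := rfl
  rw [e2, ← LinearMap.comp_apply (LinearMap.lTensor A _) (LinearMap.lTensor A _),
    ← LinearMap.lTensor_comp]
  subst e
  rfl

theorem covariant_twistTensorEquiv_symm
    (hM' : IsRelHopfModule c.twistHopf (c.twistAlgebra 𝔅) ℳγ)
    (hN' : IsRelHopfModule c.twistHopf (c.twistAlgebra 𝔅) (c.twistModule 𝔅 𝒩))
    (hH' : IsHopfStarAlgebra c.twistHopf) :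
    IsCovariant (BTensor.coact hH hM hN) (BTensor.coact hH' hM' hN')
      (c.twistTensorEquiv hH hB hM hN e).symm.toLinearMap := by
  intro x
  have h := c.covariant_twistTensorEquiv hH hB hM hN e hM' hN' hH'
    ((c.twistTensorEquiv hH hB hM hN e).symm x)
  have h' := congrArg ((c.twistTensorEquiv hH hB hM hN e).symm.toLinearMap.lTensor A) h
  rw [← LinearMap.comp_apply (LinearMap.lTensor A _) (LinearMap.lTensor A _),
    ← LinearMap.lTensor_comp, LinearEquiv.symm_comp, LinearMap.lTensor_id, LinearMap.id_apply,
    LinearEquiv.coe_coe, LinearEquiv.apply_symm_apply] at h'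
  exact h'.symm

/-- Compatibility of the isomorphisms with outer multiplications `x ⊗ (m ⊗ n) ↦ ρ(x ⊗ m) ⊗ n`. -/
theorem outer_twist (hM' : IsRelHopfModule H 𝔅 ℳ') {δX : X →ₗ[ℂ] A ⊗[ℂ] X} (hX : IsComodule δX)
    {ρ : X ⊗[ℂ] M →ₗ[ℂ] M'}
    (hρ : ∀ x m b, ρ (x ⊗ₜ ℳ.ract (m ⊗ₜ b)) = ℳ'.ract (ρ (x ⊗ₜ m) ⊗ₜ b))
    (hc : CovariantOver H.mul (pair δX ℳ.coact) ℳ'.coact ρ) {ℳγ' : RelHopfOps A B M'}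
    (e' : ℳγ' = c.twistModule 𝔅 ℳ') {Φ : BTensor ℳγ (c.twistModule 𝔅 𝒩) →ₗ[ℂ]
      BTensor ℳγ' (c.twistModule 𝔅 𝒩)} (x : X)
    (hΦ : ∀ m n, Φ (BTensor.mk _ _ (m ⊗ₜ n)) =
      BTensor.mk _ _ (ρ (act (pair δX ℳ.coact) c.γ (x ⊗ₜ m)) ⊗ₜ n))
    (t : BTensor ℳγ (c.twistModule 𝔅 𝒩)) :
    c.twistTensorEquiv hH hB hM' hN e' (Φ t) = BTensor.outer 𝒩 ρ hρ
      (act (pair δX (BTensor.coact hH hM hN)) c.γ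
        (x ⊗ₜ c.twistTensorEquiv hH hB hM hN e t)) := by
  induction t using BTensor.induction with
  | h0 => simp
  | ha s t hs ht => simp only [map_add, TensorProduct.tmul_add, hs, ht]
  | ht m n =>
    rw [hΦ, twistTensorEquiv_mk, twistTensorEquiv_mk]
    exact c.isCocycle.twisted_assoc hX hM.toIsComodule hN.toIsComodule hc
      (covariantOver_mul_iff.2 (BTensor.covariant_mk hH hM hN)) (fun _ _ _ => rfl) x m n

end Equiv

end UnitaryTwoCocycle

end TensorTwist

/-! ### Twisting holomorphic bimodules -/

section Holomorphic

variable {A B Ω E : Type*} [AddCommGroup A] [Module ℂ A] [Coalgebra ℂ A]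
  [AddCommGroup B] [Module ℂ B] [AddCommGroup Ω] [Module ℂ Ω] [AddCommGroup E] [Module ℂ E]
  {H : HopfStarOps A} {𝔅 : ComoduleStarOps A B} {𝒞 : CalculusOps A B Ω} {P : Bigrading Ω}
  {ℰ : RelHopfOps A B E}

/-- `id ∧ D` as an outer multiplication, defined on `Ω⁽⁰,¹⁾ ⊗ (Ω⁽⁰,¹⁾ ⊗_B E)`. -/
theorem idWedge_eq_outer (h : IsCovariantComplexStructure H 𝔅 𝒞 P)
    (D : E →ₗ[ℂ] BTensor (formOps 𝒞 P (0, 1)) ℰ) (t : P.comp (0, 1) ⊗[ℂ] E) :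
    idWedge h D t = BTensor.outer ℰ (wedgeForm 𝒞 P) h.wedge_ract
      (TensorProduct.map LinearMap.id D t) := by
  induction t using TensorProduct.induction_on with
  | zero => simp
  | add s t hs ht => simp only [map_add, hs, ht]
  | tmul ω e => rfl

/-- The Leibniz rule on arbitrary tensors, as needed for `b ⊗ e` acted on by `γ`. -/
theorem IsDbarConnection.apply_lact {h : IsCovariantComplexStructure H 𝔅 𝒞 P}
    {D : E →ₗ[ℂ] BTensor (formOps 𝒞 P (0, 1)) ℰ} (hD : IsDbarConnection h ℰ D) (t : B ⊗[ℂ] E) :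
    D (ℰ.lact t) = BTensor.outer ℰ (formOps 𝒞 P (0, 1)).lact
        (fun b m b' => ((h.isRelHopfModule (0, 1)).lact_ract b m b').symm)
        (TensorProduct.map LinearMap.id D t) +
      BTensor.mk (formOps 𝒞 P (0, 1)) ℰ (TensorProduct.map (dbarB 𝒞 P) LinearMap.id t) := by
  induction t using TensorProduct.induction_on with
  | zero => simp
  | add s t hs ht => simp only [map_add, hs, ht]; abel
  | tmul b e => exact hD b e

namespace UnitaryTwoCocycle

variable (c : UnitaryTwoCocycle H)

/-- `D_γ = φ⁻¹ ∘ D` is a left `∂̄`-connection. -/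
theorem isDbarConnection_twist (hH : IsHopfStarAlgebra H) (hB : IsComodule 𝔅.coact)
    (h : IsCovariantComplexStructure H 𝔅 𝒞 P) (hE : IsRelHopfModule H 𝔅 ℰ)
    {D : E →ₗ[ℂ] BTensor (formOps 𝒞 P (0, 1)) ℰ} (hD : IsDbarConnection h ℰ D)
    (hDc : IsCovariant ℰ.coact (BTensor.coact hH (h.isRelHopfModule (0, 1)) hE) D)
    (h' : IsCovariantComplexStructure c.twistHopf (c.twistAlgebra 𝔅) (c.twistCalculus 𝒞) P) :
    IsDbarConnection h' (c.twistModule 𝔅 ℰ) ((c.twistTensorEquiv hH hB (h.isRelHopfModule (0, 1)) hE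
      (h.formOps_twist c (0, 1))).symm.toLinearMap ∘ₗ D) := by
  intro b e
  have h01 := h.isRelHopfModule (0, 1)
  set φ := c.twistTensorEquiv hH hB h01 hE (h.formOps_twist c (0, 1)) with hφ
  apply φ.injective
  have e1 : φ ((φ.symm.toLinearMap ∘ₗ D) ((c.twistModule 𝔅 ℰ).lact (b ⊗ₜ e))) =
      D (ℰ.lact (act (pair 𝔅.coact ℰ.coact) c.γ (b ⊗ₜ e))) := φ.apply_symm_apply _
  have e2 := c.outer_twist hH hB h01 hE (h.formOps_twist c (0, 1)) h01 hB
    (fun b m b' => (h01.lact_ract b m b').symm) (covariantOver_mul_iff.2 h01.coact_lact)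
    (h.formOps_twist c (0, 1))
    (Φ := BTensor.lact (h'.isRelHopfModule (0, 1)) (c.twistModule 𝔅 ℰ) b) b
    (fun m n => by rw [BTensor.lact_mk, h.formOps_twist c (0, 1)]; rfl)
    ((φ.symm.toLinearMap ∘ₗ D) e)
  rw [← hφ] at e2
  rw [e1, hD.apply_lact, map_add, e2,
    ← act_map_map (CovariantOver.id 𝔅.coact).isCovariant hDc,
    ← act_map_map h.covariant_dbarB (CovariantOver.id ℰ.coact).isCovariant, LinearMap.comp_apply,
    LinearEquiv.coe_coe, LinearEquiv.apply_symm_apply]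
  rfl

/-- The isomorphisms `φ` in bidegrees `(0,1)` and `(0,2)` intertwine the curvature operators. -/
theorem curvatureOp_twist (hH : IsHopfStarAlgebra H) (hB : IsComodule 𝔅.coact)
    (h : IsCovariantComplexStructure H 𝔅 𝒞 P) (hE : IsRelHopfModule H 𝔅 ℰ)
    {D : E →ₗ[ℂ] BTensor (formOps 𝒞 P (0, 1)) ℰ} (hD : IsDbarConnection h ℰ D)
    (hDc : IsCovariant ℰ.coact (BTensor.coact hH (h.isRelHopfModule (0, 1)) hE) D)
    (h' : IsCovariantComplexStructure c.twistHopf (c.twistAlgebra 𝔅) (c.twistCalculus 𝒞) P)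
    (x : BTensor (formOps (c.twistCalculus 𝒞) P (0, 1)) (c.twistModule 𝔅 ℰ)) :
    c.twistTensorEquiv hH hB (h.isRelHopfModule (0, 2)) hE (h.formOps_twist c (0, 2))
      (curvatureOp h' _ (c.isDbarConnection_twist hH hB h hE hD hDc h') x) =
    curvatureOp h D hD (c.twistTensorEquiv hH hB (h.isRelHopfModule (0, 1)) hE
      (h.formOps_twist c (0, 1)) x) := by
  have h01 := h.isRelHopfModule (0, 1)
  have h02 := h.isRelHopfModule (0, 2)
  set φ := c.twistTensorEquiv hH hB h01 hE (h.formOps_twist c (0, 1)) with hφ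
  induction x using BTensor.induction with
  | h0 => simp
  | ha s t hs ht => simp only [map_add, hs, ht]
  | ht ω e =>
    have e2 := c.outer_twist hH hB h01 hE (h.formOps_twist c (0, 1)) h02 h01.toIsComodule
      h.wedge_ract h.covariant_wedgeForm (h.formOps_twist c (0, 2))
      (Φ := wedgeLeft h' (c.twistModule 𝔅 ℰ) ω) ω
      (fun m n => by rw [wedgeLeft_mk, h.wedgeForm_twist c])
      ((φ.symm.toLinearMap ∘ₗ D) e)
    have e3 : curvatureOp h' _ (c.isDbarConnection_twist hH hB h hE hD hDc h')
        (BTensor.mk (formOps (c.twistCalculus 𝒞) P (0, 1)) (c.twistModule 𝔅 ℰ) (ω ⊗ₜ e)) =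
        BTensor.mk _ _ (dbarForm 𝒞 P ω ⊗ₜ e) -
          wedgeLeft h' (c.twistModule 𝔅 ℰ) ω ((φ.symm.toLinearMap ∘ₗ D) e) := rfl
    have e4 : ∀ t, curvatureOp h D hD (BTensor.mk (formOps 𝒞 P (0, 1)) ℰ t) =
        BTensor.mk _ _ (TensorProduct.map (dbarForm 𝒞 P) LinearMap.id t) - idWedge h D t :=
      fun _ => rfl
    rw [e3, map_sub, e2, hφ, twistTensorEquiv_mk, twistTensorEquiv_mk, e4, idWedge_eq_outer,
      ← act_map_map (CovariantOver.id (formOps 𝒞 P (0, 1)).coact).isCovariant hDc,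
      ← act_map_map h.covariant_dbarForm (CovariantOver.id ℰ.coact).isCovariant, ← hφ,
      LinearMap.comp_apply, LinearEquiv.coe_coe, LinearEquiv.apply_symm_apply]
    rfl

end UnitaryTwoCocycle

end Holomorphic

end

end CocycleTwist

theorem mainTheorem5 {A B Ω E : Type*}
    [AddCommGroup A] [Module ℂ A] [Coalgebra ℂ A] [AddCommGroup B] [Module ℂ B]
    [AddCommGroup Ω] [Module ℂ Ω] [AddCommGroup E] [Module ℂ E]
    (H : CocycleTwist.HopfStarOps A) (𝔅 : CocycleTwist.ComoduleStarOps A B)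
    (𝒞 : CocycleTwist.CalculusOps A B Ω) (P : CocycleTwist.Bigrading Ω)
    (ℰ : CocycleTwist.RelHopfOps A B E)
    (D : E →ₗ[ℂ] CocycleTwist.BTensor (CocycleTwist.formOps 𝒞 P (0, 1)) ℰ)
    (hED : CocycleTwist.IsCovariantHolomorphicBimodule H 𝔅 𝒞 P ℰ D)
    (c : CocycleTwist.UnitaryTwoCocycle H) :
    ∃ φ : CocycleTwist.BTensor (CocycleTwist.formOps (c.twistCalculus 𝒞) P (0, 1))
          (c.twistModule 𝔅 ℰ) ≃ₗ[ℂ]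
        CocycleTwist.BTensor (CocycleTwist.formOps 𝒞 P (0, 1)) ℰ,
      (∀ t : P.comp (0, 1) ⊗[ℂ] E,
        φ (CocycleTwist.BTensor.mk _ _ t) = CocycleTwist.BTensor.mk _ _
          (CocycleTwist.scale c.γ (CocycleTwist.formOps 𝒞 P (0, 1)).coact ℰ.coact t)) ∧
      (∀ t : P.comp (0, 1) ⊗[ℂ] E,
        φ.symm (CocycleTwist.BTensor.mk _ _ t) = CocycleTwist.BTensor.mk _ _
          (CocycleTwist.scale c.inv (CocycleTwist.formOps 𝒞 P (0, 1)).coact ℰ.coact t)) ∧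
      CocycleTwist.IsCovariantHolomorphicBimodule c.twistHopf (c.twistAlgebra 𝔅)
        (c.twistCalculus 𝒞) P (c.twistModule 𝔅 ℰ) (φ.symm.toLinearMap ∘ₗ D) := by
  have hH := hED.hopf
  have hB := hED.base.toIsComodule
  have h := hED.complex
  have hE := hED.module
  have hH' := c.isHopfStarAlgebra_twistHopf hH
  have h' := c.isCovariantComplexStructure_twist hH h
  have hE' := c.isRelHopfModule_twist hED.base.toIsComoduleAlgebra hE
  refine ⟨c.twistTensorEquiv hH hB (h.isRelHopfModule (0, 1)) hE (h.formOps_twist c (0, 1)),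
    fun t => rfl, fun t => rfl, ?_⟩
  exact
    { hopf := hH'
      base := c.isComoduleStarAlgebra_twist hH hED.base
      complex := h'
      module := hE'
      connection := c.isDbarConnection_twist hH hB h hE hED.connection hED.covariant h'
      covariant := ((c.covariant_twistTensorEquiv_symm hH hB (h.isRelHopfModule (0, 1)) hE
        (h.formOps_twist c (0, 1)) (h'.isRelHopfModule (0, 1)) hE' hH').over.comp
          hED.covariant.over).isCovariant
      curvature := by
        apply LinearMap.ext
        intro e
        apply (c.twistTensorEquiv hH hB (h.isRelHopfModule (0, 2)) hE
          (h.formOps_twist c (0, 2))).injective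
        refine (c.curvatureOp_twist hH hB h hE hED.connection hED.covariant h' _).trans ?_
        rw [LinearMap.comp_apply, LinearEquiv.coe_coe, LinearEquiv.apply_symm_apply,
          LinearMap.zero_apply, map_zero]
        exact LinearMap.congr_fun hED.curvature e }
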